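/- Let $k$ be an algebraically closed field, let $n\ge 2$ and let $F\in GL(n,k)$. For $m\ge1$ and $G\in GL(m,k)$, let $H(G)$ be the $k$-algebra with generators $u_{ij},v_{ij}$ ($1\le i,j\le m$) and relations, with $u=(u_{ij})$ and $v=(v_{ij})$, $$u\,{}^t\!v={}^t\!v\,u=I_m,\qquad vG\,{}^t\!u\,G^{-1}=G\,{}^t\!u\,G^{-1}v=I_m .$$ It is a Hopf algebra with $\Delta(u_{ij})=\sum_l u_{il}\otimes u_{lj}$, $\Delta(v_{ij})=\sum_l v_{il}\otimes v_{lj}$, $\varepsilon(u_{ij})=\varepsilon(v_{ij})=\delta_{ij}$, $S(u)={}^t\!v$ and $S(v)=G\,{}^t\!u\,G^{-1}$. For $q\in k^*$ put $H(q)=H(F_q)$ with $F_q=\begin{pmatrix}q^{-1}&0\\0&q\end{pmatrix}$. Let $\mathrm{Comod}(A)$ be the $k$-linear monoidal category of right comodules over a Hopf algebra $A$, and write $\mathrm{Comod}(A)\cong^{\otimes}\mathrm{Comod}(B)$ if there is a $k$-linear monoidal equivalence between these categories. Call $F$ normalized if $\mathrm{tr}(F)=\mathrm{tr}(F^{-1})$,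 and normalizable if $\lambda F$ is normalized for some $\lambda\in k^*$. (a) If $F$ is normalizable, then there exists $q\in k^*$ such that $\mathrm{Comod}(H(F))\cong^{\otimes}\mathrm{Comod}(H(q))$. If $F$ is normalized, then this holds for every $q\in k^*$ with $q^2-\mathrm{tr}(F)q+1=0$. (b) If $F$ is not normalizable, then $\mathrm{Comod}(H(F))\cong^{\otimes}\mathrm{Comod}(H(E))$ for every $E\in GL(3,k)$ with $\mathrm{tr}(E)=0$ and $\mathrm{tr}(E^{-1})\ne0$. -/

import Mathlib

noncomputable section

namespace CosovHopf

open CategoryTheory MonoidalCategory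
open scoped TensorProduct

universe u

/-- The generators `u i j` and `v i j` of the algebra `H(F)`. -/
inductive Gen (n : ℕ) : Type
  | u (i j : Fin n) : Gen n
  | v (i j : Fin n) : Gen n

section Algebra

variable {k : Type u} [Field k] {n : ℕ}

/-- A scalar matrix, viewed as a matrix over the `k`-algebra `A`. -/
def scalarMat (A : Type u) [Ring A] [Algebra k A] (M : Matrix (Fin n) (Fin n) k) :
    Matrix (Fin n) (Fin n) A :=
  M.map (algebraMap k A)

/-- The matrices `U`, `V` over the algebra `A` satisfy
`U ᵗV = ᵗV U = I` and `V F ᵗU F⁻¹ = F ᵗU F⁻¹ V = I`. -/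
structure IsSolution (F : GL (Fin n) k) {A : Type u} [Ring A] [Algebra k A]
    (U V : Matrix (Fin n) (Fin n) A) : Prop where
  u_vt : U * V.transpose = 1
  vt_u : V.transpose * U = 1
  v_ut : V * scalarMat A F.val * U.transpose * scalarMat A F⁻¹.val = 1
  ut_v : scalarMat A F.val * U.transpose * scalarMat A F⁻¹.val * V = 1

/-- The matrix of the generators `u i j`. -/
def freeU (k : Type u) [Field k] (n : ℕ) : Matrix (Fin n) (Fin n) (FreeAlgebra k (Gen n)) :=
  Matrix.of fun i j => FreeAlgebra.ι k (Gen.u i j)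

/-- The matrix of the generators `v i j`. -/
def freeV (k : Type u) [Field k] (n : ℕ) : Matrix (Fin n) (Fin n) (FreeAlgebra k (Gen n)) :=
  Matrix.of fun i j => FreeAlgebra.ι k (Gen.v i j)

/-- The defining relations of `H(F)`, entry by entry:
`u ᵗv = ᵗv u = I` and `v F ᵗu F⁻¹ = F ᵗu F⁻¹ v = I`. -/
inductive Rel (F : GL (Fin n) k) : FreeAlgebra k (Gen n) → FreeAlgebra k (Gen n) → Prop
  | u_vt (i j : Fin n) :
      Rel F ((freeU k n * (freeV k n).transpose) i j)
        ((1 : Matrix (Fin n) (Fin n) (FreeAlgebra k (Gen n))) i j)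
  | vt_u (i j : Fin n) :
      Rel F (((freeV k n).transpose * freeU k n) i j)
        ((1 : Matrix (Fin n) (Fin n) (FreeAlgebra k (Gen n))) i j)
  | v_ut (i j : Fin n) :
      Rel F ((freeV k n * scalarMat (FreeAlgebra k (Gen n)) F.val * (freeU k n).transpose *
        scalarMat (FreeAlgebra k (Gen n)) F⁻¹.val) i j)
        ((1 : Matrix (Fin n) (Fin n) (FreeAlgebra k (Gen n))) i j)
  | ut_v (i j : Fin n) :
      Rel F ((scalarMat (FreeAlgebra k (Gen n)) F.val * (freeU k n).transpose *
        scalarMat (FreeAlgebra k (Gen n)) F⁻¹.val * freeV k n) i j)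
        ((1 : Matrix (Fin n) (Fin n) (FreeAlgebra k (Gen n))) i j)

/-- The algebra `H(F)`: the free algebra on the `u i j`, `v i j` modulo the relations `Rel F`. -/
def H (F : GL (Fin n) k) : Type u := RingQuot (Rel F)

instance (F : GL (Fin n) k) : Ring (H F) := inferInstanceAs (Ring (RingQuot (Rel F)))
instance (F : GL (Fin n) k) : Algebra k (H F) := inferInstanceAs (Algebra k (RingQuot (Rel F)))

variable (F : GL (Fin n) k)

/-- The quotient map. -/
def H.mk : FreeAlgebra k (Gen n) →ₐ[k] H F := RingQuot.mkAlgHom k (Rel F)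

/-- The matrix `u` over `H(F)`. -/
def H.u : Matrix (Fin n) (Fin n) (H F) := (freeU k n).map (H.mk F)
/-- The matrix `v` over `H(F)`. -/
def H.v : Matrix (Fin n) (Fin n) (H F) := (freeV k n).map (H.mk F)

theorem H.mk_surjective : Function.Surjective (H.mk F) := RingQuot.mkAlgHom_surjective k (Rel F)

theorem scalarMat_map {A B : Type u} [Ring A] [Algebra k A] [Ring B] [Algebra k B] (f : A →ₐ[k] B)
    (M : Matrix (Fin n) (Fin n) k) : (scalarMat A M).map f = scalarMat B M := by
  ext i j; simp [scalarMat]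

theorem H.isSolution : IsSolution F (H.u F) (H.v F) where
  u_vt := by
    have : (freeU k n * (freeV k n).transpose).map (H.mk F) = Matrix.map 1 (H.mk F) := by
      ext i j; exact RingQuot.mkAlgHom_rel k (Rel.u_vt i j)
    simpa [Matrix.map_mul, Matrix.transpose_map, H.u, H.v] using this
  vt_u := by
    have : ((freeV k n).transpose * freeU k n).map (H.mk F) = Matrix.map 1 (H.mk F) := by
      ext i j; exact RingQuot.mkAlgHom_rel k (Rel.vt_u i j)
    simpa [Matrix.map_mul, Matrix.transpose_map, H.u, H.v] using this
  v_ut := by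
    have : (freeV k n * scalarMat (FreeAlgebra k (Gen n)) F.val * (freeU k n).transpose *
        scalarMat (FreeAlgebra k (Gen n)) F⁻¹.val).map
        (H.mk F) = Matrix.map 1 (H.mk F) := by
      ext i j; exact RingQuot.mkAlgHom_rel k (Rel.v_ut i j)
    simpa only [Matrix.map_mul, Matrix.transpose_map, scalarMat_map, Matrix.map_one, map_zero,
      map_one, H.u, H.v] using this
  ut_v := by
    have : (scalarMat (FreeAlgebra k (Gen n)) F.val * (freeU k n).transpose *
        scalarMat (FreeAlgebra k (Gen n)) F⁻¹.val * freeV k n).map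
        (H.mk F) = Matrix.map 1 (H.mk F) := by
      ext i j; exact RingQuot.mkAlgHom_rel k (Rel.ut_v i j)
    simpa only [Matrix.map_mul, Matrix.transpose_map, scalarMat_map, Matrix.map_one, map_zero,
      map_one, H.u, H.v] using this

variable {F}

/-- A map on generators from two matrices. -/
def genMap {A : Type u} (U V : Matrix (Fin n) (Fin n) A) : Gen n → A
  | Gen.u i j => U i j
  | Gen.v i j => V i j

/-- The universal property of `H(F)`: a solution of the defining relations in `A` gives an algebra
morphism `H(F) → A`. -/
def H.lift {A : Type u} [Ring A] [Algebra k A] (U V : Matrix (Fin n) (Fin n) A)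
    (h : IsSolution F U V) : H F →ₐ[k] A :=
  RingQuot.liftAlgHom k ⟨FreeAlgebra.lift k (genMap U V), by
    have hU : (freeU k n).map (FreeAlgebra.lift k (genMap U V)) = U := by
      ext i j; simp [freeU, genMap]
    have hV : (freeV k n).map (FreeAlgebra.lift k (genMap U V)) = V := by
      ext i j; simp [freeV, genMap]
    have key : ∀ M : Matrix (Fin n) (Fin n) (FreeAlgebra k (Gen n)),
        M.map (FreeAlgebra.lift k (genMap U V)) = 1 → ∀ i j,
        FreeAlgebra.lift k (genMap U V) (M i j) = FreeAlgebra.lift k (genMap U V)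
          ((1 : Matrix (Fin n) (Fin n) (FreeAlgebra k (Gen n))) i j) := by
      intro M hM i j
      have h1 : (1 : Matrix (Fin n) (Fin n) (FreeAlgebra k (Gen n))).map
        (FreeAlgebra.lift k (genMap U V)) = 1 := by simp
      exact congrFun (congrFun (hM.trans h1.symm) i) j
    intro x y hxy
    rcases hxy with ⟨i, j⟩ | ⟨i, j⟩ | ⟨i, j⟩ | ⟨i, j⟩ <;> apply key <;>
      simp only [Matrix.map_mul, Matrix.transpose_map, hU, hV, scalarMat_map]
    exacts [h.u_vt, h.vt_u, h.v_ut, h.ut_v]⟩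

@[simp] theorem H.lift_u {A : Type u} [Ring A] [Algebra k A] (U V : Matrix (Fin n) (Fin n) A)
    (h : IsSolution F U V) (i j : Fin n) : H.lift U V h (H.u F i j) = U i j := by
  refine (RingQuot.liftAlgHom_mkAlgHom_apply k _ _ _).trans ?_
  simp [freeU, genMap]

@[simp] theorem H.lift_v {A : Type u} [Ring A] [Algebra k A] (U V : Matrix (Fin n) (Fin n) A)
    (h : IsSolution F U V) (i j : Fin n) : H.lift U V h (H.v F i j) = V i j := by
  refine (RingQuot.liftAlgHom_mkAlgHom_apply k _ _ _).trans ?_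
  simp [freeV, genMap]

theorem H.algHom_ext {A : Type u} [Ring A] [Algebra k A] {f g : H F →ₐ[k] A}
    (hu : ∀ i j, f (H.u F i j) = g (H.u F i j)) (hv : ∀ i j, f (H.v F i j) = g (H.v F i j)) :
    f = g := by
  apply RingQuot.ringQuot_ext'
  apply FreeAlgebra.hom_ext
  funext x
  rcases x with ⟨i, j⟩ | ⟨i, j⟩
  exacts [hu i j, hv i j]

theorem H.induction {p : H F → Prop} (hs : ∀ c : k, p (algebraMap k _ c))
    (hu : ∀ i j, p (H.u F i j)) (hv : ∀ i j, p (H.v F i j))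
    (hadd : ∀ x y, p x → p y → p (x + y)) (hmul : ∀ x y, p x → p y → p (x * y)) (x : H F) :
    p x := by
  obtain ⟨y, rfl⟩ := H.mk_surjective F x
  induction y using FreeAlgebra.induction with
  | grade0 r => simpa using hs r
  | grade1 x => rcases x with ⟨i, j⟩ | ⟨i, j⟩; exacts [hu i j, hv i j]
  | mul a b ha hb => rw [map_mul]; exact hmul _ _ ha hb
  | add a b ha hb => rw [map_add]; exact hadd _ _ ha hb

/-- Transposition reverses products of matrices whose entries commute. -/
theorem transpose_mul_of_commute {A : Type u} [Ring A] (M N : Matrix (Fin n) (Fin n) A)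
    (h : ∀ i j i' j', Commute (M i j) (N i' j')) :
    (M * N).transpose = N.transpose * M.transpose := by
  ext i j
  simp only [Matrix.transpose_apply, Matrix.mul_apply]
  exact Finset.sum_congr rfl fun l _ => h _ _ _ _

theorem scalarMat_mul {A : Type u} [Ring A] [Algebra k A] (M N : Matrix (Fin n) (Fin n) k) :
    scalarMat A M * scalarMat A N = scalarMat A (M * N) := by
  simp [scalarMat, Matrix.map_mul]

theorem scalarMat_one {A : Type u} [Ring A] [Algebra k A] :
    scalarMat A (1 : Matrix (Fin n) (Fin n) k) = 1 := by
  simp [scalarMat]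

theorem scalarMat_val_inv {A : Type u} [Ring A] [Algebra k A] :
    scalarMat A F.val * scalarMat A F⁻¹.val = 1 := by
  rw [scalarMat_mul, ← Units.val_mul]; simp [scalarMat_one]

theorem scalarMat_inv_val {A : Type u} [Ring A] [Algebra k A] :
    scalarMat A F⁻¹.val * scalarMat A F.val = 1 := by
  rw [scalarMat_mul, ← Units.val_mul]; simp [scalarMat_one]

theorem IsSolution.map {A B : Type u} [Ring A] [Algebra k A] [Ring B] [Algebra k B]
    {U V : Matrix (Fin n) (Fin n) A} (h : IsSolution F U V) (f : A →ₐ[k] B) :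
    IsSolution F (U.map f) (V.map f) where
  u_vt := by
    simpa only [Matrix.map_mul, Matrix.transpose_map, scalarMat_map, Matrix.map_one, map_zero,
      map_one] using congrArg (fun M => M.map f) h.u_vt
  vt_u := by
    simpa only [Matrix.map_mul, Matrix.transpose_map, scalarMat_map, Matrix.map_one, map_zero,
      map_one] using congrArg (fun M => M.map f) h.vt_u
  v_ut := by
    simpa only [Matrix.map_mul, Matrix.transpose_map, scalarMat_map, Matrix.map_one, map_zero,
      map_one] using congrArg (fun M => M.map f) h.v_ut
  ut_v := by
    simpa only [Matrix.map_mul, Matrix.transpose_map, scalarMat_map, Matrix.map_one, map_zero,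
      map_one] using congrArg (fun M => M.map f) h.ut_v

theorem IsSolution.mul {A : Type u} [Ring A] [Algebra k A] {U V U' V' : Matrix (Fin n) (Fin n) A}
    (h : IsSolution F U V) (h' : IsSolution F U' V')
    (hU : ∀ i j i' j', Commute (U i j) (U' i' j')) (hV : ∀ i j i' j', Commute (V i j) (V' i' j')) :
    IsSolution F (U * U') (V * V') where
  u_vt := by
    rw [transpose_mul_of_commute _ _ hV, Matrix.mul_assoc, ← Matrix.mul_assoc U', h'.u_vt,
      Matrix.one_mul, h.u_vt]
  vt_u := by
    rw [transpose_mul_of_commute _ _ hV, Matrix.mul_assoc, ← Matrix.mul_assoc _ U, h.vt_u,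
      Matrix.one_mul, h'.vt_u]
  v_ut := by
    rw [transpose_mul_of_commute _ _ hU]
    calc V * V' * scalarMat A F.val * (U'.transpose * U.transpose) * scalarMat A F⁻¹.val
        = V * (V' * scalarMat A F.val * U'.transpose * (scalarMat A F⁻¹.val * scalarMat A F.val))
            * U.transpose * scalarMat A F⁻¹.val := by
          rw [scalarMat_inv_val]; simp only [Matrix.mul_assoc, Matrix.mul_one]
      _ = V * (V' * scalarMat A F.val * U'.transpose * scalarMat A F⁻¹.val) * scalarMat A F.val
            * U.transpose * scalarMat A F⁻¹.val := by simp only [Matrix.mul_assoc]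
      _ = 1 := by rw [h'.v_ut, Matrix.mul_one, h.v_ut]
  ut_v := by
    rw [transpose_mul_of_commute _ _ hU]
    calc scalarMat A F.val * (U'.transpose * U.transpose) * scalarMat A F⁻¹.val * (V * V')
        = scalarMat A F.val * U'.transpose * (scalarMat A F⁻¹.val * scalarMat A F.val) *
            U.transpose * scalarMat A F⁻¹.val * (V * V') := by
          rw [scalarMat_inv_val]; simp only [Matrix.mul_assoc, Matrix.mul_one]
      _ = scalarMat A F.val * U'.transpose * scalarMat A F⁻¹.val * (scalarMat A F.val *
            U.transpose * scalarMat A F⁻¹.val * V) * V' := by simp only [Matrix.mul_assoc]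
      _ = 1 := by rw [h.ut_v, Matrix.mul_one, h'.ut_v]

theorem isSolution_one : IsSolution F (1 : Matrix (Fin n) (Fin n) k) 1 where
  u_vt := by simp
  vt_u := by simp
  v_ut := by simpa using scalarMat_val_inv
  ut_v := by simpa using scalarMat_val_inv

variable (F)

/-- The matrix with entries `∑ l, X i l ⊗ X l j`. -/
def H.comulMat (X : Matrix (Fin n) (Fin n) (H F)) : Matrix (Fin n) (Fin n) (H F ⊗[k] H F) :=
  Matrix.of fun i j => ∑ l, X i l ⊗ₜ[k] X l j

theorem H.comulMat_eq (X : Matrix (Fin n) (Fin n) (H F)) :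
    H.comulMat F X = X.map (Algebra.TensorProduct.includeLeft : H F →ₐ[k] H F ⊗[k] H F) *
      X.map (Algebra.TensorProduct.includeRight : H F →ₐ[k] H F ⊗[k] H F) := by
  ext i j; simp [H.comulMat, Matrix.mul_apply]

theorem H.isSolution_comul :
    IsSolution F (H.comulMat F (H.u F)) (H.comulMat F (H.v F)) := by
  rw [H.comulMat_eq, H.comulMat_eq]
  refine ((H.isSolution F).map _).mul ((H.isSolution F).map _) ?_ ?_ <;>
  · intro i j i' j'
    simp [Commute, SemiconjBy]

/-- The comultiplication: `Δ(u i j) = ∑ l, u i l ⊗ u l j`, `Δ(v i j) = ∑ l, v i l ⊗ v l j`. -/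
def H.comulHom : H F →ₐ[k] H F ⊗[k] H F :=
  H.lift (H.comulMat F (H.u F)) (H.comulMat F (H.v F)) (H.isSolution_comul F)

/-- The counit: `ε(u i j) = ε(v i j) = δ i j`. -/
def H.counitHom : H F →ₐ[k] k := H.lift 1 1 isSolution_one

theorem sum_one_tmul (X : Matrix (Fin n) (Fin n) (H F)) (i j : Fin n) :
    ∑ l, (1 : Matrix (Fin n) (Fin n) k) i l ⊗ₜ[k] X l j = 1 ⊗ₜ[k] X i j := by
  rw [Finset.sum_eq_single i]
  · simp
  · intro b _ hb; simp [Matrix.one_apply_ne hb.symm]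
  · simp

theorem sum_tmul_one (X : Matrix (Fin n) (Fin n) (H F)) (i j : Fin n) :
    ∑ l, X i l ⊗ₜ[k] (1 : Matrix (Fin n) (Fin n) k) l j = X i j ⊗ₜ[k] 1 := by
  rw [Finset.sum_eq_single j]
  · simp
  · intro b _ hb; simp [Matrix.one_apply_ne hb]
  · simp

theorem sum_comm_tmul (X : Matrix (Fin n) (Fin n) (H F)) (i j : Fin n) :
    (Algebra.TensorProduct.assoc k k k (H F) (H F) (H F))
      (∑ l, (∑ m, X i m ⊗ₜ[k] X m l) ⊗ₜ[k] X l j) =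
      ∑ l, X i l ⊗ₜ[k] (∑ m, X l m ⊗ₜ[k] X m j) := by
  simp only [TensorProduct.sum_tmul, TensorProduct.tmul_sum, map_sum,
    Algebra.TensorProduct.assoc_tmul]
  exact Finset.sum_comm

/-- The bialgebra `H(F)`. -/
instance H.instBialgebra : Bialgebra k (H F) :=
  Bialgebra.ofAlgHom (H.comulHom F) (H.counitHom F)
    (by
      apply H.algHom_ext <;> intro i j
      · simpa [H.comulHom, H.comulMat] using sum_comm_tmul F (H.u F) i j
      · simpa [H.comulHom, H.comulMat] using sum_comm_tmul F (H.v F) i j)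
    (by
      apply H.algHom_ext <;> intro i j
      · simpa [H.comulHom, H.counitHom, H.comulMat] using sum_one_tmul F (H.u F) i j
      · simpa [H.comulHom, H.counitHom, H.comulMat] using sum_one_tmul F (H.v F) i j)
    (by
      apply H.algHom_ext <;> intro i j
      · simpa [H.comulHom, H.counitHom, H.comulMat] using sum_tmul_one F (H.u F) i j
      · simpa [H.comulHom, H.counitHom, H.comulMat] using sum_tmul_one F (H.v F) i j)

/-- The matrix `F ᵗu F⁻¹`. -/
def H.w : Matrix (Fin n) (Fin n) (H F) :=
  scalarMat (H F) F.val * (H.u F).transpose * scalarMat (H F) F⁻¹.val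

theorem map_op_mul {A : Type u} [Ring A] (M N : Matrix (Fin n) (Fin n) A) :
    M.map MulOpposite.op * N.map MulOpposite.op =
      (N.transpose * M.transpose).transpose.map MulOpposite.op := by
  ext i j; simp [Matrix.mul_apply]

theorem transpose_scalarMat_mul {A : Type u} [Ring A] [Algebra k A] (M : Matrix (Fin n) (Fin n) k)
    (N : Matrix (Fin n) (Fin n) A) :
    (scalarMat A M * N).transpose = N.transpose * (scalarMat A M).transpose :=
  transpose_mul_of_commute _ _ fun _ _ _ _ => Algebra.commutes _ _

theorem transpose_mul_scalarMat {A : Type u} [Ring A] [Algebra k A] (M : Matrix (Fin n) (Fin n) k)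
    (N : Matrix (Fin n) (Fin n) A) :
    (N * scalarMat A M).transpose = (scalarMat A M).transpose * N.transpose :=
  transpose_mul_of_commute _ _ fun _ _ _ _ => (Algebra.commutes _ _).symm

theorem scalarMat_op {A : Type u} [Ring A] [Algebra k A] (M : Matrix (Fin n) (Fin n) k) :
    scalarMat Aᵐᵒᵖ M = (scalarMat A M).map MulOpposite.op := by
  ext i j; simp [scalarMat]

theorem H.isSolution_antipode :
    IsSolution F ((H.v F).transpose.map MulOpposite.op) ((H.w F).map MulOpposite.op) where
  u_vt := by
    rw [← Matrix.transpose_map, map_op_mul, Matrix.transpose_transpose, Matrix.transpose_transpose,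
      H.w, (H.isSolution F).ut_v]
    simp
  vt_u := by
    rw [← Matrix.transpose_map, map_op_mul, Matrix.transpose_transpose, Matrix.transpose_transpose,
      H.w, ← Matrix.mul_assoc, ← Matrix.mul_assoc, (H.isSolution F).v_ut]
    simp
  v_ut := by
    have h1 : H.w F * scalarMat (H F) F.val = scalarMat (H F) F.val * (H.u F).transpose := by
      rw [H.w, Matrix.mul_assoc, scalarMat_inv_val, Matrix.mul_one]
    have h2 : (H.w F).map MulOpposite.op * scalarMat (H F)ᵐᵒᵖ F.val *
        ((H.v F).transpose.map MulOpposite.op).transpose = scalarMat (H F)ᵐᵒᵖ F.val := by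
      rw [scalarMat_op, map_op_mul, ← transpose_mul_scalarMat, h1, ← Matrix.transpose_map,
        map_op_mul, Matrix.transpose_transpose, Matrix.transpose_transpose,
        transpose_scalarMat_mul, Matrix.transpose_transpose, ← Matrix.mul_assoc,
        (H.isSolution F).vt_u, Matrix.one_mul, Matrix.transpose_transpose]
    rw [h2, scalarMat_val_inv]
  ut_v := by
    have h1 : scalarMat (H F) F⁻¹.val * H.w F = (H.u F).transpose * scalarMat (H F) F⁻¹.val := by
      rw [H.w, ← Matrix.mul_assoc, ← Matrix.mul_assoc, scalarMat_inv_val, Matrix.one_mul]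
    have h2 : ((H.v F).transpose.map MulOpposite.op).transpose *
        (scalarMat (H F)ᵐᵒᵖ F⁻¹.val * (H.w F).map MulOpposite.op) =
          scalarMat (H F)ᵐᵒᵖ F⁻¹.val := by
      rw [scalarMat_op, map_op_mul, ← transpose_scalarMat_mul, h1, ← Matrix.transpose_map,
        map_op_mul, Matrix.transpose_transpose, Matrix.transpose_transpose,
        transpose_mul_scalarMat, Matrix.transpose_transpose, Matrix.mul_assoc,
        (H.isSolution F).u_vt, Matrix.mul_one, Matrix.transpose_transpose]
    rw [Matrix.mul_assoc, Matrix.mul_assoc, h2, scalarMat_val_inv]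

/-- The antipode as an algebra morphism to the opposite algebra. -/
def H.antipodeHom : H F →ₐ[k] (H F)ᵐᵒᵖ :=
  H.lift ((H.v F).transpose.map MulOpposite.op) ((H.w F).map MulOpposite.op)
    (H.isSolution_antipode F)

/-- The antipode: the antimultiplicative map with `S(u) = ᵗv` and `S(v) = F ᵗu F⁻¹`. -/
def H.antipodeLin : H F →ₗ[k] H F :=
  (MulOpposite.opLinearEquiv k).symm.toLinearMap ∘ₗ (H.antipodeHom F).toLinearMap

theorem H.antipodeLin_mul (x y : H F) :
    H.antipodeLin F (x * y) = H.antipodeLin F y * H.antipodeLin F x := by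
  simp [H.antipodeLin]

theorem H.antipodeLin_algebraMap (c : k) :
    H.antipodeLin F (algebraMap k _ c) = algebraMap k _ c := by
  simp [H.antipodeLin]

theorem H.antipodeLin_one : H.antipodeLin F 1 = 1 := by
  simp [H.antipodeLin]

theorem H.antipodeLin_u (i j : Fin n) : H.antipodeLin F (H.u F i j) = H.v F j i := by
  simp [H.antipodeLin, H.antipodeHom]

theorem H.antipodeLin_v (i j : Fin n) : H.antipodeLin F (H.v F i j) = H.w F i j := by
  simp [H.antipodeLin, H.antipodeHom]

theorem H.comul_u (i j : Fin n) :
    Coalgebra.comul (R := k) (H.u F i j) = ∑ l, H.u F i l ⊗ₜ[k] H.u F l j :=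
  H.lift_u _ _ (H.isSolution_comul F) i j

theorem H.comul_v (i j : Fin n) :
    Coalgebra.comul (R := k) (H.v F i j) = ∑ l, H.v F i l ⊗ₜ[k] H.v F l j :=
  H.lift_v _ _ (H.isSolution_comul F) i j

theorem H.counit_u (i j : Fin n) :
    Coalgebra.counit (R := k) (H.u F i j) = (1 : Matrix (Fin n) (Fin n) k) i j :=
  H.lift_u _ _ isSolution_one i j

theorem H.counit_v (i j : Fin n) :
    Coalgebra.counit (R := k) (H.v F i j) = (1 : Matrix (Fin n) (Fin n) k) i j :=
  H.lift_v _ _ isSolution_one i j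

theorem one_apply_algebraMap {A : Type u} [Ring A] [Algebra k A] (i j : Fin n) :
    algebraMap k A ((1 : Matrix (Fin n) (Fin n) k) i j) = (1 : Matrix (Fin n) (Fin n) A) i j := by
  by_cases h : i = j <;> simp [Matrix.one_apply, h]

theorem H.antipode_left (x : H F) :
    LinearMap.mul' k (H F) ((H.antipodeLin F).rTensor (H F) (Coalgebra.comul (R := k) x)) =
      algebraMap k (H F) (Coalgebra.counit (R := k) x) := by
  induction x using H.induction with
  | hs c => simp [H.antipodeLin_algebraMap, Algebra.TensorProduct.algebraMap_apply]
  | hu i j =>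
    rw [H.comul_u, H.counit_u, one_apply_algebraMap, ← (H.isSolution F).vt_u]
    simp [H.antipodeLin_u, Matrix.mul_apply]
  | hv i j =>
    rw [H.comul_v, H.counit_v, one_apply_algebraMap, ← (H.isSolution F).ut_v, ← H.w]
    simp [H.antipodeLin_v, Matrix.mul_apply]
  | hadd x y hx hy => simp only [map_add, hx, hy]
  | hmul x y hx hy =>
    have key : ∀ s t : H F ⊗[k] H F,
        LinearMap.mul' k (H F) ((H.antipodeLin F).rTensor (H F) s) ∈
          Set.range (algebraMap k (H F)) →
        LinearMap.mul' k (H F) ((H.antipodeLin F).rTensor (H F) (s * t)) =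
          LinearMap.mul' k (H F) ((H.antipodeLin F).rTensor (H F) s) *
          LinearMap.mul' k (H F) ((H.antipodeLin F).rTensor (H F) t) := by
      rintro s t ⟨c, hc⟩
      rw [← hc]
      induction t with
      | zero => simp
      | add t t' ht ht' => rw [mul_add, map_add, map_add, ht, ht', map_add, map_add, mul_add]
      | tmul a b =>
        have : LinearMap.mul' k (H F) ((H.antipodeLin F).rTensor (H F) (s * a ⊗ₜ[k] b)) =
            H.antipodeLin F a * LinearMap.mul' k (H F) ((H.antipodeLin F).rTensor (H F) s) * b := by
          clear hc
          induction s with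
          | zero => simp
          | add s s' hs hs' => simp only [add_mul, mul_add, map_add, hs, hs']
          | tmul p q => simp [H.antipodeLin_mul, mul_assoc]
        rw [this, ← hc, ← Algebra.commutes c]
        simp [mul_assoc]
    rw [Bialgebra.comul_mul, key _ _ ⟨_, hx.symm⟩, hx, hy, Bialgebra.counit_mul, map_mul]

theorem H.antipode_right (x : H F) :
    LinearMap.mul' k (H F) ((H.antipodeLin F).lTensor (H F) (Coalgebra.comul (R := k) x)) =
      algebraMap k (H F) (Coalgebra.counit (R := k) x) := by
  induction x using H.induction with
  | hs c => simp [H.antipodeLin_one, Algebra.TensorProduct.algebraMap_apply]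
  | hu i j =>
    rw [H.comul_u, H.counit_u, one_apply_algebraMap, ← (H.isSolution F).u_vt]
    simp [H.antipodeLin_u, Matrix.mul_apply]
  | hv i j =>
    rw [H.comul_v, H.counit_v, one_apply_algebraMap, ← (H.isSolution F).v_ut, Matrix.mul_assoc,
      Matrix.mul_assoc, ← Matrix.mul_assoc (scalarMat _ _), ← H.w]
    simp [H.antipodeLin_v, Matrix.mul_apply]
  | hadd x y hx hy => simp only [map_add, hx, hy]
  | hmul x y hx hy =>
    have key : ∀ s t : H F ⊗[k] H F,
        LinearMap.mul' k (H F) ((H.antipodeLin F).lTensor (H F) t) ∈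
          Set.range (algebraMap k (H F)) →
        LinearMap.mul' k (H F) ((H.antipodeLin F).lTensor (H F) (s * t)) =
          LinearMap.mul' k (H F) ((H.antipodeLin F).lTensor (H F) s) *
          LinearMap.mul' k (H F) ((H.antipodeLin F).lTensor (H F) t) := by
      rintro s t ⟨c, hc⟩
      rw [← hc]
      induction s with
      | zero => simp
      | add s s' hs hs' => rw [add_mul, map_add, map_add, hs, hs', map_add, map_add, add_mul]
      | tmul a b =>
        have : LinearMap.mul' k (H F) ((H.antipodeLin F).lTensor (H F) (a ⊗ₜ[k] b * t)) =
            a * LinearMap.mul' k (H F) ((H.antipodeLin F).lTensor (H F) t) * H.antipodeLin F b := by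
          clear hc
          induction t with
          | zero => simp
          | add s s' hs hs' => simp only [add_mul, mul_add, map_add, hs, hs']
          | tmul p q => simp [H.antipodeLin_mul, mul_assoc]
        rw [this, ← hc, mul_assoc, Algebra.commutes c]
        simp [mul_assoc]
    rw [Bialgebra.comul_mul, key _ _ ⟨_, hy.symm⟩, hx, hy, Bialgebra.counit_mul, map_mul]

/-- The Hopf algebra `H(F)`. -/
instance H.instHopfAlgebra : HopfAlgebra k (H F) where
  antipode := H.antipodeLin F
  mul_antipode_rTensor_comul := by ext x; exact H.antipode_left F x
  mul_antipode_lTensor_comul := by ext x; exact H.antipode_right F x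

end Algebra


/-- A right comodule over the bialgebra `A`: a vector space `V` with a coassociative and counital
coaction `V → V ⊗ A`. -/
structure Comod (k : Type u) [Field k] (A : Type u) [Ring A] [Bialgebra k A] where
  carrier : ModuleCat.{u} k
  coact : carrier →ₗ[k] carrier ⊗[k] A
  coassoc : (TensorProduct.assoc k carrier A A).toLinearMap ∘ₗ coact.rTensor A ∘ₗ coact =
    (Coalgebra.comul (R := k) (A := A)).lTensor carrier ∘ₗ coact
  counital : (TensorProduct.rid k carrier).toLinearMap ∘ₗ
    (Coalgebra.counit (R := k) (A := A)).lTensor carrier ∘ₗ coact = LinearMap.id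

namespace Comod

variable {k : Type u} [Field k] {A : Type u} [Ring A] [Bialgebra k A]

/-- A morphism of comodules is a linear map that commutes with the coactions. -/
@[ext]
structure Hom (V W : Comod k A) where
  lin : V.carrier →ₗ[k] W.carrier
  comm : lin.rTensor A ∘ₗ V.coact = W.coact ∘ₗ lin

instance : Category (Comod k A) where
  Hom := Hom
  id V := ⟨LinearMap.id, by simp⟩
  comp f g := ⟨g.lin ∘ₗ f.lin, by
    rw [LinearMap.rTensor_comp, LinearMap.comp_assoc, f.comm, ← LinearMap.comp_assoc, g.comm,
      LinearMap.comp_assoc]⟩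

@[ext]
theorem hom_ext {V W : Comod k A} {f g : V ⟶ W} (h : f.lin = g.lin) : f = g := Hom.ext h

@[simp] theorem id_lin (V : Comod k A) : Hom.lin (𝟙 V) = LinearMap.id := rfl

@[simp] theorem comp_lin {V W X : Comod k A} (f : V ⟶ W) (g : W ⟶ X) :
    (f ≫ g).lin = g.lin ∘ₗ f.lin := rfl

/-- Comodule morphisms form a subspace of the space of linear maps. -/
def homSubmodule (V W : Comod k A) : Submodule k (V.carrier →ₗ[k] W.carrier) where
  carrier := {f | f.rTensor A ∘ₗ V.coact = W.coact ∘ₗ f}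
  add_mem' {f g} hf hg := by
    simp only [Set.mem_ofPred_eq] at *
    rw [LinearMap.rTensor_add, LinearMap.add_comp, LinearMap.comp_add, hf, hg]
  zero_mem' := by simp
  smul_mem' c f hf := by
    simp only [Set.mem_ofPred_eq] at *
    rw [LinearMap.rTensor_smul, LinearMap.smul_comp, LinearMap.comp_smul, hf]

/-- Morphisms of comodules, as elements of `homSubmodule`. -/
def homEquiv (V W : Comod k A) : (V ⟶ W) ≃ homSubmodule V W where
  toFun f := ⟨f.lin, f.comm⟩
  invFun f := ⟨f.1, f.2⟩

instance (V W : Comod k A) : AddCommGroup (V ⟶ W) := (homEquiv V W).addCommGroup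
instance (V W : Comod k A) : Module k (V ⟶ W) := (homEquiv V W).module k

@[simp] theorem add_lin {V W : Comod k A} (f g : V ⟶ W) : (f + g).lin = f.lin + g.lin := rfl
@[simp] theorem smul_lin {V W : Comod k A} (c : k) (f : V ⟶ W) : (c • f).lin = c • f.lin := rfl

instance : Preadditive (Comod k A) where
  add_comp _ _ _ f f' g := by ext1; simp [LinearMap.comp_add]
  comp_add _ _ _ f g g' := by ext1; simp [LinearMap.add_comp]

instance : Linear k (Comod k A) where
  smul_comp _ _ _ c f g := by ext1; simp [LinearMap.comp_smul]
  comp_smul _ _ _ f c g := by ext1; simp [LinearMap.smul_comp]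

/-- `(V ⊗ A) ⊗ (W ⊗ A) → (V ⊗ W) ⊗ A`, `(v ⊗ a) ⊗ (w ⊗ b) ↦ (v ⊗ w) ⊗ ab`. -/
def merge (k : Type u) [Field k] (A : Type u) [Ring A] [Bialgebra k A] (V W : Type u)
    [AddCommGroup V] [AddCommGroup W] [Module k V] [Module k W] :
    (V ⊗[k] A) ⊗[k] (W ⊗[k] A) →ₗ[k] (V ⊗[k] W) ⊗[k] A :=
  (LinearMap.mul' k A).lTensor (V ⊗[k] W) ∘ₗ
    (TensorProduct.tensorTensorTensorComm k V A W A).toLinearMap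

@[simp] theorem merge_tmul {V W : Type u}
    [AddCommGroup V] [AddCommGroup W] [Module k V] [Module k W] (v : V) (w : W) (a b : A) :
    merge k A V W ((v ⊗ₜ a) ⊗ₜ (w ⊗ₜ b)) = (v ⊗ₜ w) ⊗ₜ (a * b) := by
  simp [merge]

theorem coassoc_apply (V : Comod k A) (v : V.carrier) :
    TensorProduct.assoc k V.carrier A A (V.coact.rTensor A (V.coact v)) =
      (Coalgebra.comul (R := k) (A := A)).lTensor V.carrier (V.coact v) :=
  LinearMap.congr_fun V.coassoc v

theorem counital_apply (V : Comod k A) (v : V.carrier) :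
    TensorProduct.rid k V.carrier
      ((Coalgebra.counit (R := k) (A := A)).lTensor V.carrier (V.coact v)) = v :=
  LinearMap.congr_fun V.counital v

theorem comm_apply {V W : Comod k A} (f : V ⟶ W) (v : V.carrier) :
    f.lin.rTensor A (V.coact v) = W.coact (f.lin v) :=
  LinearMap.congr_fun f.comm v

/-- The diagonal coaction `v ⊗ w ↦ v₀ ⊗ w₀ ⊗ v₁w₁`. -/
def tensorCoact (V W : Comod k A) :
    V.carrier ⊗[k] W.carrier →ₗ[k] (V.carrier ⊗[k] W.carrier) ⊗[k] A :=
  merge k A V.carrier W.carrier ∘ₗ TensorProduct.map V.coact W.coact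

@[simp] theorem tensorCoact_tmul (V W : Comod k A) (v : V.carrier) (w : W.carrier) :
    tensorCoact V W (v ⊗ₜ w) = merge k A V.carrier W.carrier (V.coact v ⊗ₜ W.coact w) := rfl

/-- Naturality of `merge` in both vector spaces -/
theorem merge_natural {V W V' W' : Type u}
    [AddCommGroup V] [AddCommGroup W] [Module k V] [Module k W]
    [AddCommGroup V'] [AddCommGroup W'] [Module k V'] [Module k W']
    (f : V →ₗ[k] V') (g : W →ₗ[k] W') (x : V ⊗[k] A) (y : W ⊗[k] A) :
    (TensorProduct.map f g).rTensor A (merge k A V W (x ⊗ₜ y)) =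
      merge k A V' W' (f.rTensor A x ⊗ₜ g.rTensor A y) := by
  induction x with
  | zero => simp
  | add x x' hx hx' => simp only [TensorProduct.add_tmul, map_add, hx, hx']
  | tmul v a =>
    induction y with
    | zero => simp
    | add y y' hy hy' => simp only [TensorProduct.tmul_add, map_add, hy, hy']
    | tmul w b => simp

/-- `merge`, followed by the comultiplication of `A`. -/
theorem merge_comul {V W : Type u}
    [AddCommGroup V] [AddCommGroup W] [Module k V] [Module k W] (x : V ⊗[k] A) (y : W ⊗[k] A) :
    (TensorProduct.assoc k (V ⊗[k] W) A A).symm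
      ((Coalgebra.comul (R := k) (A := A)).lTensor (V ⊗[k] W) (merge k A V W (x ⊗ₜ y))) =
    (merge k A V W).rTensor A (merge k A (V ⊗[k] A) (W ⊗[k] A)
      ((TensorProduct.assoc k V A A).symm ((Coalgebra.comul (R := k) (A := A)).lTensor V x) ⊗ₜ
       (TensorProduct.assoc k W A A).symm
          ((Coalgebra.comul (R := k) (A := A)).lTensor W y))) := by
  induction x with
  | zero => simp
  | add x x' hx hx' => simp only [TensorProduct.add_tmul, map_add, hx, hx']
  | tmul v a =>
    induction y with
    | zero => simp
    | add y y' hy hy' => simp only [TensorProduct.tmul_add, map_add, hy, hy']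
    | tmul w b =>
      simp only [merge_tmul, LinearMap.lTensor_tmul, Bialgebra.comul_mul]
      generalize Coalgebra.comul (R := k) a = s
      generalize Coalgebra.comul (R := k) b = t
      induction s with
      | zero => simp
      | add x x' hx hx' =>
        simp only [TensorProduct.add_tmul, TensorProduct.tmul_add, add_mul, map_add, hx, hx']
      | tmul p q =>
        induction t with
        | zero => simp
        | add y y' hy hy' => simp only [TensorProduct.tmul_add, mul_add, map_add, hy, hy']
        | tmul p' q' => simp

theorem merge_counit {V W : Type u}
    [AddCommGroup V] [AddCommGroup W] [Module k V] [Module k W] (x : V ⊗[k] A) (y : W ⊗[k] A) :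
    TensorProduct.rid k (V ⊗[k] W)
      ((Coalgebra.counit (R := k) (A := A)).lTensor (V ⊗[k] W) (merge k A V W (x ⊗ₜ y))) =
    TensorProduct.rid k V ((Coalgebra.counit (R := k) (A := A)).lTensor V x) ⊗ₜ
      TensorProduct.rid k W ((Coalgebra.counit (R := k) (A := A)).lTensor W y) := by
  induction x with
  | zero => simp
  | add x x' hx hx' => simp only [TensorProduct.add_tmul, map_add, hx, hx']
  | tmul v a =>
    induction y with
    | zero => simp
    | add y y' hy hy' => simp only [TensorProduct.tmul_add, map_add, hy, hy']
    | tmul w b => simp [TensorProduct.smul_tmul', mul_smul, TensorProduct.tmul_smul, smul_comm (Coalgebra.counit (R := k) a)]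

/-- The tensor product of comodules. -/
def tensor (V W : Comod k A) : Comod k A where
  carrier := ModuleCat.of k (V.carrier ⊗[k] W.carrier)
  coact := tensorCoact V W
  coassoc := by
    refine TensorProduct.ext' fun v w => ?_
    have h := merge_comul (V.coact v) (W.coact w)
    rw [← coassoc_apply, ← coassoc_apply, LinearEquiv.symm_apply_apply,
      LinearEquiv.symm_apply_apply, ← merge_natural, LinearEquiv.symm_apply_eq] at h
    simp only [LinearMap.comp_apply, tensorCoact_tmul]
    refine Eq.trans ?_ h.symm
    refine congrArg (TensorProduct.assoc k (V.carrier ⊗[k] W.carrier) A A) ?_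
    exact LinearMap.congr_fun (LinearMap.rTensor_comp A (merge k A V.carrier W.carrier)
      (TensorProduct.map V.coact W.coact)) _
  counital := by
    refine TensorProduct.ext' fun v w => ?_
    have h := merge_counit (V.coact v) (W.coact w)
    rw [counital_apply, counital_apply] at h
    exact h

/-- The trivial comodule `k`, with coaction `c ↦ c ⊗ 1`. -/
def unit (k : Type u) [Field k] (A : Type u) [Ring A] [Bialgebra k A] : Comod k A where
  carrier := ModuleCat.of k k
  coact := (TensorProduct.mk k k A).flip 1
  coassoc := by
    refine LinearMap.ext_ring ?_
    simp [Algebra.TensorProduct.one_def]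
  counital := by
    refine LinearMap.ext_ring ?_
    simp

/-- A bijective morphism of comodules is an isomorphism. -/
def isoOfEquiv {V W : Comod k A} (e : V.carrier ≃ₗ[k] W.carrier)
    (h : e.toLinearMap.rTensor A ∘ₗ V.coact = W.coact ∘ₗ e.toLinearMap) : V ≅ W where
  hom := ⟨e.toLinearMap, h⟩
  inv := ⟨e.symm.toLinearMap, by
    have h1 : e.symm.toLinearMap ∘ₗ e.toLinearMap = LinearMap.id := by ext; simp
    have h2 : e.toLinearMap ∘ₗ e.symm.toLinearMap = LinearMap.id := by ext; simp
    calc e.symm.toLinearMap.rTensor A ∘ₗ W.coact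
        = e.symm.toLinearMap.rTensor A ∘ₗ (W.coact ∘ₗ e.toLinearMap) ∘ₗ e.symm.toLinearMap := by
          rw [LinearMap.comp_assoc, h2, LinearMap.comp_id]
      _ = (e.symm.toLinearMap.rTensor A ∘ₗ e.toLinearMap.rTensor A) ∘ₗ V.coact ∘ₗ
            e.symm.toLinearMap := by rw [← h]; simp only [LinearMap.comp_assoc]
      _ = V.coact ∘ₗ e.symm.toLinearMap := by
          rw [← LinearMap.rTensor_comp, h1, LinearMap.rTensor_id, LinearMap.id_comp]⟩
  hom_inv_id := by ext1; ext x; exact e.symm_apply_apply x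
  inv_hom_id := by ext1; ext x; exact e.apply_symm_apply x

/-- The tensor product of morphisms of comodules. -/
def tensorMap {V W V' W' : Comod k A} (f : V ⟶ W) (g : V' ⟶ W') :
    tensor V V' ⟶ tensor W W' where
  lin := TensorProduct.map f.lin g.lin
  comm := by
    refine TensorProduct.ext' fun v w => ?_
    refine (merge_natural f.lin g.lin (V.coact v) (V'.coact w)).trans ?_
    rw [comm_apply, comm_apply]
    rfl

theorem merge_assoc {V W X : Type u} [AddCommGroup V] [AddCommGroup W] [AddCommGroup X]
    [Module k V] [Module k W] [Module k X] (x : V ⊗[k] A) (y : W ⊗[k] A) (z : X ⊗[k] A) :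
    (TensorProduct.assoc k V W X).toLinearMap.rTensor A
      (merge k A (V ⊗[k] W) X (merge k A V W (x ⊗ₜ y) ⊗ₜ z)) =
    merge k A V (W ⊗[k] X) (x ⊗ₜ merge k A W X (y ⊗ₜ z)) := by
  induction x with
  | zero => simp
  | add x x' hx hx' => simp only [TensorProduct.add_tmul, map_add, hx, hx']
  | tmul v a =>
    induction y with
    | zero => simp
    | add y y' hy hy' => simp only [TensorProduct.add_tmul, TensorProduct.tmul_add, map_add, hy, hy']
    | tmul w b =>
      induction z with
      | zero => simp
      | add y y' hy hy' => simp only [TensorProduct.tmul_add, map_add, hy, hy']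
      | tmul x c => simp [mul_assoc]

/-- The associator, that of vector spaces. -/
def assocIso (V W X : Comod k A) : tensor (tensor V W) X ≅ tensor V (tensor W X) :=
  isoOfEquiv (TensorProduct.assoc k V.carrier W.carrier X.carrier) (by
    refine TensorProduct.ext_threefold fun v w x => ?_
    exact merge_assoc (V.coact v) (W.coact w) (X.coact x))

theorem merge_lid {V : Type u} [AddCommGroup V] [Module k V] (x : V ⊗[k] A) (c : k) :
    (TensorProduct.lid k V).toLinearMap.rTensor A (merge k A k V ((c ⊗ₜ 1) ⊗ₜ x)) = c • x := by
  induction x with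
  | zero => simp
  | add x x' hx hx' => simp only [TensorProduct.tmul_add, map_add, hx, hx', smul_add]
  | tmul v a => simp [TensorProduct.smul_tmul']

theorem merge_rid {V : Type u} [AddCommGroup V] [Module k V] (x : V ⊗[k] A) (c : k) :
    (TensorProduct.rid k V).toLinearMap.rTensor A (merge k A V k (x ⊗ₜ (c ⊗ₜ 1))) = c • x := by
  induction x with
  | zero => simp
  | add x x' hx hx' => simp only [TensorProduct.add_tmul, map_add, hx, hx', smul_add]
  | tmul v a => simp [TensorProduct.smul_tmul']

/-- The left unitor, that of vector spaces. -/
def leftUnitIso (V : Comod k A) : tensor (unit k A) V ≅ V :=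
  isoOfEquiv (TensorProduct.lid k V.carrier) (by
    refine TensorProduct.ext' fun c v => ?_
    refine (merge_lid (V.coact v) c).trans ?_
    exact ((V.coact.map_smul c v).symm.trans
      (congrArg V.coact (TensorProduct.lid_tmul (R := k) v c).symm)))

/-- The right unitor, that of vector spaces. -/
def rightUnitIso (V : Comod k A) : tensor V (unit k A) ≅ V :=
  isoOfEquiv (TensorProduct.rid k V.carrier) (by
    refine TensorProduct.ext' fun v c => ?_
    refine (merge_rid (V.coact v) c).trans ?_
    exact ((V.coact.map_smul c v).symm.trans
      (congrArg V.coact (TensorProduct.rid_tmul (R := k) v c).symm)))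

instance : MonoidalCategoryStruct (Comod k A) where
  tensorObj := tensor
  tensorUnit := unit k A
  tensorHom := tensorMap
  whiskerLeft V _ _ f := tensorMap (𝟙 V) f
  whiskerRight f V := tensorMap f (𝟙 V)
  associator := assocIso
  leftUnitor := leftUnitIso
  rightUnitor := rightUnitIso

/-- The forgetful functor to vector spaces. -/
def forget (k : Type u) [Field k] (A : Type u) [Ring A] [Bialgebra k A] :
    Comod k A ⥤ ModuleCat.{u} k where
  obj V := V.carrier
  map f := ModuleCat.ofHom f.lin

instance : (forget k A).Faithful where
  map_injective h := hom_ext (ModuleCat.hom_ext_iff.mp h)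

/-- The monoidal category of right comodules; its constraints are those of vector spaces. -/
instance : MonoidalCategory (Comod k A) :=
  Monoidal.induced (forget k A)
    { μIso _ _ := Iso.refl _
      εIso := Iso.refl _
      whiskerLeft_eq _ _ _ _ := rfl
      whiskerRight_eq _ _ := rfl
      tensorHom_eq _ _ := rfl
      associator_eq _ _ _ := by
        ext1; exact TensorProduct.ext_threefold fun _ _ _ => rfl
      leftUnitor_eq _ := by ext1; exact TensorProduct.ext' fun _ _ => rfl
      rightUnitor_eq _ := by ext1; exact TensorProduct.ext' fun _ _ => rfl }

end Comod

/-- `Comod(A)` and `Comod(B)` are equivalent as `k`-linear monoidal categories: there is an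
equivalence of categories whose functor is `k`-linear and (strong) monoidal. -/
def MonoidallyEquivalent (k : Type u) [Field k] (A B : Type u) [Ring A] [Ring B] [Bialgebra k A]
    [Bialgebra k B] : Prop :=
  ∃ (e : Comod k A ≌ Comod k B) (_ : e.functor.Monoidal) (_ : e.functor.Additive),
    e.functor.Linear k

section Matrices

variable {k : Type u} [Field k] {n : ℕ}

/-- `tr(F) = tr(F⁻¹)`. -/
def IsNormalized (F : GL (Fin n) k) : Prop :=
  F.val.trace = F⁻¹.val.trace

/-- Some non-zero scalar multiple of `F` is normalized. -/
def IsNormalizable (F : GL (Fin n) k) : Prop :=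
  ∃ c : kˣ, IsNormalized (c • F)

/-- `F_q = diag(q⁻¹, q)`. -/
def Fq (q : kˣ) : GL (Fin 2) k where
  val := !![(q⁻¹ : kˣ), 0; 0, (q : k)]
  inv := !![(q : k), 0; 0, (q⁻¹ : kˣ)]
  val_inv := by simp [Matrix.one_fin_two]
  inv_val := by simp [Matrix.one_fin_two]

end Matrices

end CosovHopf
end

/-!
The bialgebras `H(F)` and `H(E)`, for `E` of size `m` and `F` of size `n`, are linked by the algebra
generated by the entries of two `m × n` matrices `U`, `V` subject to `U ᵗV = ᵗV U = I` and `V F ᵗU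
E⁻¹ = F ᵗU E⁻¹ V = I` (`RectSolution`, `RectAlg`). Together with `H(E)`, `H(F)` and the mirror image
in which `E` and `F` are exchanged, it forms a cogroupoid with two objects. If the rectangular
algebras are non-zero, cotensoring with them is a monoidal equivalence between the categories of
comodules: the antipode followed by a functional that sends `1` to `1` pairs the two algebras so
that the counits are recovered (`exists_ev`), and with such pairings (`BiGalois`) the cotensor
functors are inverse to each other (`BiGalois.unitIso`) and the multiplication makes them monoidal
(`BiGalois.coreMonoidal`). No flatness or exactness argument is needed, since every cotensor product
is a retract of the tensor product (`BiGalois.proj_eq_self`).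

The rectangular algebra is non-zero when `tr E = tr F` and `tr E⁻¹ = tr F⁻¹`
(`IsUniversal.nontrivial`). The matrix `E` defines evaluations and coevaluations between the
alternating tensor powers of `kᵐ` and its dual; these satisfy the relations of the Temperley-Lieb
category, and `tr E` and `tr E⁻¹` are the values of the two oriented circles. When the circles for
`E` and `F` have the same values, the identity in degree `0` extends to a family of linear maps
between the tensor powers that commutes with all evaluations and coevaluations
(`exists_intertwining_family`). The extension, two degrees at a time, rests on the fact that
compatible prescriptions on the images of all coevaluations can be realized by a single map
(`exists_comp_cup`), and dually for evaluations (`exists_cap_comp`); this is where `m, n ≥ 2` is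
used. Removing the first letter makes the spaces of even and of odd families a solution of the
relations by operators `M ⇄ N`, and passing to infinitely many copies identifies `M` with `N`, so
that the rectangular algebra acts on a non-zero space.

It remains to match traces. The bialgebra `H(F)` is unchanged when `F` is multiplied by a scalar
(`IsUniversalBialgebra.smul`) or replaced by `ᵗF⁻¹` (`IsUniversalBialgebra.contragredient`). A
normalized `F` has the traces of `F_q` when `q` is a root of `q² - tr(F) q + 1`, and `F` fails to be
normalizable exactly when one of `tr F`, `tr F⁻¹` vanishes and the other does not.
-/

noncomputable section

namespace CosovHopf

universe u

/-! ### Tensors as functions on words, insertions and contractions -/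

section Words

/-- Words of length `d` in the alphabet `ι`. Functions `Word ι d → k` model tensors of degree `d`
over `k ^ ι`. -/
def Word (ι : Type) : ℕ → Type
  | 0 => Unit
  | d + 1 => ι × Word ι d

variable {k : Type u} [Field k] {ι : Type}

/-- Fixing the first letter of the argument of a function on words. -/
def fiber (j : ι) (d : ℕ) : (Word ι (d + 1) → k) →ₗ[k] (Word ι d → k) where
  toFun x := fun w => x (j, w)
  map_add' _ _ := rfl
  map_smul' _ _ := rfl

/-- Assembling a function on words of length `d + 1` from its fibers. -/
def glue {d : ℕ} {Z : Type*} [AddCommGroup Z] [Module k Z] (f : ι → (Z →ₗ[k] (Word ι d → k))) :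
    Z →ₗ[k] (Word ι (d + 1) → k) where
  toFun z := fun w => f w.1 z w.2
  map_add' _ _ := by funext w; simp
  map_smul' _ _ := by funext w; simp

@[simp] theorem fiber_glue {d : ℕ} {Z : Type*} [AddCommGroup Z] [Module k Z]
    (f : ι → (Z →ₗ[k] (Word ι d → k))) (j : ι) (z : Z) : fiber j d (glue f z) = f j z := rfl

theorem fiber_ext {d : ℕ} {x y : Word ι (d + 1) → k} (h : ∀ j, fiber j d x = fiber j d y) :
    x = y := by
  funext w
  exact congrFun (h w.1) w.2

variable (G : ℕ → Matrix ι ι k)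

/-- Inserting the tensor `∑ (G r) i j • e i ⊗ e j` at position `p` of a tensor of degree `d`, where
`r = d - p` is the number of letters to the right of position `p`. It is zero for `p > d`. -/
def cup : ∀ _ d : ℕ, (Word ι d → k) →ₗ[k] (Word ι (d + 2) → k)
  | 0, d => glue fun i => glue fun j => G d i j • LinearMap.id
  | _ + 1, 0 => 0
  | p + 1, d + 1 => glue fun j => cup p d ∘ₗ fiber j d

theorem fiber_fiber_cup_zero (d : ℕ) (x : Word ι d → k) (i j : ι) :
    fiber j d (fiber i (d + 1) (cup G 0 d x)) = G d i j • x := rfl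

theorem fiber_cup_succ (p d : ℕ) (x : Word ι (d + 1) → k) (j : ι) :
    fiber j (d + 2) (cup G (p + 1) (d + 1) x) = cup G p d (fiber j d x) := rfl

theorem cup_eq_zero {p d : ℕ} (h : d < p) : cup G p d = 0 := by
  induction p generalizing d with
  | zero => omega
  | succ p ih =>
    cases d with
    | zero => rfl
    | succ d =>
      ext1 x
      refine fiber_ext fun j => ?_
      rw [fiber_cup_succ, ih (by omega)]
      simp

theorem cup_cup (hG : ∀ d, G (d + 2) = G d) {p q : ℕ} (h : p ≤ q) (d : ℕ) (x : Word ι d → k) :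
    cup G p (d + 2) (cup G q d x) = cup G (q + 2) (d + 2) (cup G p d x) := by
  induction p generalizing q d with
  | zero =>
    refine fiber_ext fun i => fiber_ext fun j => ?_
    rw [fiber_fiber_cup_zero, fiber_cup_succ, fiber_cup_succ, fiber_fiber_cup_zero, map_smul, hG]
  | succ p ih =>
    obtain ⟨q, rfl⟩ : ∃ q', q = q' + 1 := ⟨q - 1, by omega⟩
    cases d with
    | zero => simp [cup]
    | succ d =>
      refine fiber_ext fun i => ?_
      rw [fiber_cup_succ, fiber_cup_succ, fiber_cup_succ, fiber_cup_succ, ih (by omega)]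

variable [Fintype ι] (C : ℕ → Matrix ι ι k)

/-- Contracting the positions `p` and `p + 1` of a tensor of degree `d + 2` against the form
`C r`, where `r = d - p` is the number of letters to the right of these positions. It is zero for
`p > d`. -/
def cap : ∀ _ d : ℕ, (Word ι (d + 2) → k) →ₗ[k] (Word ι d → k)
  | 0, d => ∑ i, ∑ j, C d i j • (fiber j d ∘ₗ fiber i (d + 1))
  | _ + 1, 0 => 0
  | p + 1, d + 1 => glue fun j => cap p d ∘ₗ fiber j (d + 2)

theorem cap_zero_apply (d : ℕ) (x : Word ι (d + 2) → k) :
    cap C 0 d x = ∑ i, ∑ j, C d i j • fiber j d (fiber i (d + 1) x) := by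
  simp [cap]

theorem fiber_cap_succ (p d : ℕ) (x : Word ι (d + 3) → k) (j : ι) :
    fiber j d (cap C (p + 1) (d + 1) x) = cap C p d (fiber j (d + 2) x) := rfl

theorem cap_eq_zero {p d : ℕ} (h : d < p) : cap C p d = 0 := by
  induction p generalizing d with
  | zero => omega
  | succ p ih =>
    cases d with
    | zero => rfl
    | succ d =>
      ext1 x
      refine fiber_ext fun j => ?_
      rw [fiber_cap_succ, ih (by omega)]
      simp

theorem cap_cap (hC : ∀ d, C (d + 2) = C d) {p q : ℕ} (h : p ≤ q) (d : ℕ) (x : Word ι (d + 4) → k) :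
    cap C p d (cap C (q + 2) (d + 2) x) = cap C q d (cap C p (d + 2) x) := by
  induction p generalizing q d with
  | zero =>
    rw [cap_zero_apply, cap_zero_apply]
    simp only [map_sum, map_smul, hC]
    rfl
  | succ p ih =>
    obtain ⟨q, rfl⟩ : ∃ q', q = q' + 1 := ⟨q - 1, by omega⟩
    cases d with
    | zero => simp [cap]
    | succ d =>
      refine fiber_ext fun i => ?_
      rw [fiber_cap_succ, fiber_cap_succ, fiber_cap_succ, fiber_cap_succ, ih (by omega)]

theorem cap_cup_far_right (hC : ∀ d, C (d + 2) = C d) {p q : ℕ} (h : p ≤ q) (d : ℕ)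
    (x : Word ι (d + 2) → k) :
    cap C p (d + 2) (cup G (q + 2) (d + 2) x) = cup G q d (cap C p d x) := by
  induction p generalizing q d with
  | zero =>
    rw [cap_zero_apply, cap_zero_apply]
    simp only [map_sum, map_smul, hC]
    rfl
  | succ p ih =>
    obtain ⟨q, rfl⟩ : ∃ q', q = q' + 1 := ⟨q - 1, by omega⟩
    cases d with
    | zero => rw [cup_eq_zero G (by omega), cup_eq_zero G (by omega)]; simp
    | succ d =>
      refine fiber_ext fun i => ?_
      rw [fiber_cap_succ, fiber_cup_succ, fiber_cup_succ, fiber_cap_succ, ih (by omega)]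

theorem cap_cup_far_left (hG : ∀ d, G (d + 2) = G d) {p q : ℕ} (h : p ≤ q) (d : ℕ)
    (x : Word ι (d + 2) → k) :
    cap C (q + 2) (d + 2) (cup G p (d + 2) x) = cup G p d (cap C q d x) := by
  induction p generalizing q d with
  | zero =>
    refine fiber_ext fun i => fiber_ext fun j => ?_
    rw [fiber_cap_succ, fiber_cap_succ, fiber_fiber_cup_zero, fiber_fiber_cup_zero, map_smul, hG]
  | succ p ih =>
    obtain ⟨q, rfl⟩ : ∃ q', q = q' + 1 := ⟨q - 1, by omega⟩
    cases d with
    | zero => rw [cap_eq_zero C (by omega), cap_eq_zero C (by omega)]; simp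
    | succ d =>
      refine fiber_ext fun i => ?_
      rw [fiber_cap_succ, fiber_cup_succ, fiber_cup_succ, fiber_cap_succ, ih (by omega)]

theorem cap_cup_self {p d : ℕ} (h : p ≤ d) (x : Word ι d → k) :
    cap C p d (cup G p d x) = (∑ i, ∑ j, C (d - p) i j * G (d - p) i j) • x := by
  induction p generalizing d with
  | zero =>
    rw [cap_zero_apply]
    simp only [fiber_fiber_cup_zero, smul_smul, Finset.sum_smul, Nat.sub_zero]
  | succ p ih =>
    obtain ⟨d, rfl⟩ : ∃ d', d = d' + 1 := ⟨d - 1, by omega⟩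
    refine fiber_ext fun i => ?_
    rw [fiber_cap_succ, fiber_cup_succ, ih (by omega), Nat.add_sub_add_right, map_smul]

variable [DecidableEq ι]

theorem sum_smul_fiber {d : ℕ} (j : ι) (x : Word ι (d + 1) → k) :
    ∑ i, (1 : Matrix ι ι k) j i • fiber i d x = fiber j d x := by
  simp [Matrix.one_apply]

theorem cap_cup_succ (h₁ : ∀ d, C (d + 1) * G d = 1) {p d : ℕ} (h : p + 1 ≤ d)
    (x : Word ι d → k) : cap C p d (cup G (p + 1) d x) = x := by
  induction p generalizing d with
  | zero =>
    obtain ⟨d, rfl⟩ : ∃ d', d = d' + 1 := ⟨d - 1, by omega⟩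
    refine fiber_ext fun i => ?_
    have h₂ : ∀ a b : ι, fiber i d (fiber b (d + 1) (fiber a (d + 2) (cup G (0 + 1) (d + 1) x))) =
        G d b i • fiber a d x := fun _ _ => rfl
    rw [cap_zero_apply]
    simp only [map_sum, map_smul, h₂, smul_smul]
    rw [← sum_smul_fiber i x]
    refine Finset.sum_congr rfl fun a _ => ?_
    rw [← Finset.sum_smul, ← Matrix.mul_apply, h₁, Matrix.one_apply, Matrix.one_apply]
    simp only [eq_comm]
  | succ p ih =>
    obtain ⟨d, rfl⟩ : ∃ d', d = d' + 1 := ⟨d - 1, by omega⟩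
    refine fiber_ext fun i => ?_
    rw [fiber_cap_succ, fiber_cup_succ, ih (by omega)]

theorem cap_succ_cup (h₁ : ∀ d, G (d + 1) * C d = 1) {p d : ℕ} (h : p + 1 ≤ d)
    (x : Word ι d → k) : cap C (p + 1) d (cup G p d x) = x := by
  induction p generalizing d with
  | zero =>
    obtain ⟨d, rfl⟩ : ∃ d', d = d' + 1 := ⟨d - 1, by omega⟩
    refine fiber_ext fun i => ?_
    have h₂ : ∀ a b : ι, fiber b d (fiber a (d + 1) (fiber i (d + 2) (cup G 0 (d + 1) x))) =
        G (d + 1) i a • fiber b d x := fun _ _ => rfl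
    rw [fiber_cap_succ, cap_zero_apply]
    simp only [h₂, smul_smul]
    rw [Finset.sum_comm, ← sum_smul_fiber i x]
    refine Finset.sum_congr rfl fun b _ => ?_
    rw [← Finset.sum_smul]
    congr 1
    rw [← h₁ d, Matrix.mul_apply]
    exact Finset.sum_congr rfl fun a _ => mul_comm _ _
  | succ p ih =>
    obtain ⟨d, rfl⟩ : ∃ d', d = d' + 1 := ⟨d - 1, by omega⟩
    refine fiber_ext fun i => ?_
    rw [fiber_cap_succ, fiber_cup_succ, ih (by omega)]

end Words

/-! ### Extending and lifting linear maps along insertions and contractions -/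

section Extension

variable {k : Type u} [Field k] {ι : Type} (G : ℕ → Matrix ι ι k)

/-- The span of the images of all insertions `cup G p` in the tensors of degree `d`. -/
def cupSpan : ∀ d : ℕ, Submodule k (Word ι d → k)
  | 0 => ⊥
  | 1 => ⊥
  | d + 2 => ⨆ p, LinearMap.range (cup G p d)

/-- The tensors of degree `d` killed by all contractions `cap C p`. -/
def capKer [Fintype ι] (C : ℕ → Matrix ι ι k) : ∀ d : ℕ, Submodule k (Word ι d → k)
  | 0 => ⊤
  | 1 => ⊤
  | d + 2 => ⨅ p, LinearMap.ker (cap C p d)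

theorem cup_mem_cupSpan (p d : ℕ) (x : Word ι d → k) : cup G p d x ∈ cupSpan G (d + 2) :=
  Submodule.mem_iSup_of_mem p ⟨x, rfl⟩

/-- The tensor `a ⊗ x`. -/
def consTensor (a : ι → k) {d : ℕ} : (Word ι d → k) →ₗ[k] (Word ι (d + 1) → k) :=
  glue fun j => a j • LinearMap.id

theorem fiber_consTensor (a : ι → k) {d : ℕ} (x : Word ι d → k) (j : ι) :
    fiber j d (consTensor a x) = a j • x := rfl

theorem consTensor_cup (a : ι → k) (p d : ℕ) (x : Word ι d → k) :
    consTensor a (cup G p d x) = cup G (p + 1) (d + 1) (consTensor a x) := by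
  refine fiber_ext fun j => ?_
  rw [fiber_cup_succ, fiber_consTensor, fiber_consTensor, map_smul]

theorem consTensor_mem_cupSpan (a : ι → k) : ∀ {d : ℕ} {x : Word ι d → k}, x ∈ cupSpan G d →
    consTensor a x ∈ cupSpan G (d + 1)
  | 0, x, h => by
    have : x = 0 := h
    rw [this, map_zero]
    exact zero_mem _
  | 1, x, h => by
    have : x = 0 := h
    rw [this, map_zero]
    exact zero_mem _
  | d + 2, x, h => by
    have h' : x ∈ ⨆ p, LinearMap.range (cup G p d) := h
    induction h' using Submodule.iSup_induction' with
    | mem p x hx =>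
      obtain ⟨y, rfl⟩ := hx
      rw [consTensor_cup]
      exact cup_mem_cupSpan G _ _ _
    | zero => simp
    | add x y hx hy hx' hy' => rw [map_add]; exact add_mem (hx' hx) (hy' hy)

variable [Fintype ι]

/-- Vectors `ξ r`, `η r` with `ξ r ⬝ G r ⬝ η r = 1` and `ξ (r + 1) ⬝ G (r + 1) ⬝ ξ r = 0`; they give
retractions of the insertions modulo `cupSpan`. -/
structure Splitting (G : ℕ → Matrix ι ι k) where
  ξ : ℕ → ι → k
  η : ℕ → ι → k
  pair_one : ∀ d, ∑ i, ∑ j, G d i j * (ξ d i * η d j) = 1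
  pair_zero : ∀ d, ∑ i, ∑ j, G (d + 1) i j * (ξ (d + 1) i * ξ d j) = 0

variable {G} (s : Splitting G)

/-- Contraction of the first letter with a covector. -/
def headContract (a : ι → k) (d : ℕ) : (Word ι (d + 1) → k) →ₗ[k] (Word ι d → k) :=
  ∑ j, a j • fiber j d

theorem headContract_apply (a : ι → k) {d : ℕ} (x : Word ι (d + 1) → k) :
    headContract a d x = ∑ j, a j • fiber j d x := by
  simp [headContract]

theorem headContract_cup_succ (G : ℕ → Matrix ι ι k) (a : ι → k) (p d : ℕ)
    (x : Word ι (d + 1) → k) :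
    headContract a (d + 2) (cup G (p + 1) (d + 1) x) = cup G p d (headContract a d x) := by
  simp only [headContract_apply, map_sum, map_smul]
  rfl

theorem headContract_cap_succ (C : ℕ → Matrix ι ι k) (a : ι → k) (p d : ℕ)
    (x : Word ι (d + 3) → k) :
    headContract a d (cap C (p + 1) (d + 1) x) = cap C p d (headContract a (d + 2) x) := by
  simp only [headContract_apply, map_sum, map_smul]
  rfl

namespace Splitting

/-- The vector `ᵗ(G d) η (d + 1)`. -/
def a (d : ℕ) (j : ι) : k := ∑ i, G d i j * s.η (d + 1) i

/-- A map from tensors of degree `d + 1` to tensors of degree `d` that kills `cup G 0` and maps the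
images of all other insertions to `cupSpan`. -/
def ret : ∀ d : ℕ, (Word ι (d + 1) → k) →ₗ[k] (Word ι d → k)
  | 0 => headContract (s.η 0) 0
  | d + 1 => headContract (s.η (d + 1)) (d + 1) -
      consTensor (s.a d) ∘ₗ (∑ j, s.ξ d j • (ret d ∘ₗ fiber j (d + 1)))

/-- The map `x ↦ ∑ j, ξ j • ret (x j)`, where `x j` is the fiber of `x` at the letter `j`. It is a
retraction of `cup G 0`, and maps the images of all other insertions to `cupSpan`. -/
def ret₂ (d : ℕ) : (Word ι (d + 2) → k) →ₗ[k] (Word ι d → k) :=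
  ∑ j, s.ξ d j • (s.ret d ∘ₗ fiber j (d + 1))

theorem ret₂_apply (d : ℕ) (x : Word ι (d + 2) → k) :
    s.ret₂ d x = ∑ j, s.ξ d j • s.ret d (fiber j (d + 1) x) := by
  simp [ret₂]

theorem ret_succ (d : ℕ) (x : Word ι (d + 2) → k) :
    s.ret (d + 1) x = headContract (s.η (d + 1)) (d + 1) x - consTensor (s.a d) (s.ret₂ d x) := rfl

theorem ret₂_cup_zero (d : ℕ) (x : Word ι d → k) : s.ret₂ d (cup G 0 d x) = x := by
  rw [ret₂_apply]
  cases d with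
  | zero =>
    simp only [ret, headContract_apply, fiber_fiber_cup_zero, smul_smul, ← Finset.sum_smul]
    conv_rhs => rw [← one_smul k x, ← s.pair_one 0]
    congr 1
    simp only [Finset.mul_sum]
    exact Finset.sum_congr rfl fun i _ => Finset.sum_congr rfl fun j _ => by ring
  | succ d =>
    have h1 : ∀ i, s.ret₂ d (fiber i (d + 1 + 1) (cup G 0 (d + 1) x)) =
        (∑ j, G (d + 1) i j * s.ξ d j) • s.ret d x := by
      intro i
      rw [ret₂_apply]
      simp only [fiber_fiber_cup_zero, map_smul, smul_smul, Finset.sum_smul]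
      exact Finset.sum_congr rfl fun j _ => by rw [mul_comm]
    simp only [ret_succ, h1, headContract_apply, fiber_fiber_cup_zero, map_smul, smul_smul,
      smul_sub, Finset.smul_sum, Finset.sum_sub_distrib]
    simp only [← Finset.sum_smul]
    have h2 : ∑ i, s.ξ (d + 1) i * ∑ j, G (d + 1) i j * s.ξ d j = 0 := by
      rw [← s.pair_zero d]
      simp only [Finset.mul_sum]
      exact Finset.sum_congr rfl fun i _ => Finset.sum_congr rfl fun j _ => by ring
    rw [h2, zero_smul, sub_zero]
    conv_rhs => rw [← one_smul k x, ← s.pair_one (d + 1)]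
    congr 1
    exact Finset.sum_congr rfl fun i _ => Finset.sum_congr rfl fun j _ => by ring

theorem ret_cup_mem (p d : ℕ) (x : Word ι d → k) :
    s.ret (d + 1) (cup G p d x) ∈ cupSpan G (d + 1) := by
  induction p generalizing d with
  | zero =>
    have : s.ret (d + 1) (cup G 0 d x) = 0 := by
      rw [ret_succ, ret₂_cup_zero, sub_eq_zero]
      refine fiber_ext fun j => ?_
      simp only [headContract_apply, map_sum, map_smul, fiber_fiber_cup_zero, fiber_consTensor, a,
        smul_smul, ← Finset.sum_smul]
      congr 1
      exact Finset.sum_congr rfl fun i _ => mul_comm _ _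
    rw [this]
    exact zero_mem _
  | succ p ih =>
    cases d with
    | zero => simp [cup]
    | succ d =>
      rw [ret_succ, headContract_cup_succ]
      refine sub_mem (cup_mem_cupSpan G _ _ _) (consTensor_mem_cupSpan G _ ?_)
      rw [ret₂_apply]
      exact sum_mem fun j _ => Submodule.smul_mem _ _ (ih d (fiber j d x))

theorem ret₂_cup_succ_mem (p d : ℕ) (x : Word ι d → k) :
    s.ret₂ d (cup G (p + 1) d x) ∈ cupSpan G d := by
  cases d with
  | zero => simp [cup]
  | succ d =>
    rw [ret₂_apply]
    exact sum_mem fun j _ => Submodule.smul_mem _ _ (s.ret_cup_mem p d (fiber j d x))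

end Splitting

/-- The compatibility that a family `f p` has to satisfy to be of the form `S ∘ cup G p`. -/
def CupCompat (G : ℕ → Matrix ι ι k) {Y : Type*} [AddCommGroup Y] [Module k Y] :
    ∀ d : ℕ, (ℕ → ((Word ι d → k) →ₗ[k] Y)) → Prop
  | 0, _ => True
  | 1, _ => True
  | d + 2, f => ∀ p q, p ≤ q → ∀ x, f p (cup G q d x) = f (q + 2) (cup G p d x)

/-- A compatible family of linear maps extends along the insertions. The insertions at positions
`p ≥ 1` are treated fiberwise by induction, and the error at position `0` vanishes on `cupSpan`, so
that it is corrected by `ret₂` without disturbing the other positions. -/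
theorem exists_comp_cup (s : Splitting G) (hG : ∀ d, G (d + 2) = G d) [DecidableEq ι]
    {Y : Type*} [AddCommGroup Y] [Module k Y]
    (d : ℕ) (f : ℕ → ((Word ι d → k) →ₗ[k] Y)) (hf : CupCompat G d f) :
    ∃ S : (Word ι (d + 2) → k) →ₗ[k] Y, ∀ p ≤ d, ∀ x, S (cup G p d x) = f p x := by
  induction d with
  | zero =>
    refine ⟨f 0 ∘ₗ s.ret₂ 0, fun p hp x => ?_⟩
    obtain rfl : p = 0 := by omega
    simp [s.ret₂_cup_zero]
  | succ d ih =>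
    have h1 : ∀ j : ι, ∃ S : (Word ι (d + 2) → k) →ₗ[k] Y, ∀ p ≤ d, ∀ x,
        S (cup G p d x) = f (p + 1) (consTensor (Pi.single j 1) x) := by
      intro j
      refine ih (fun p => f (p + 1) ∘ₗ consTensor (Pi.single j 1)) ?_
      rcases d with _ | _ | d
      · trivial
      · trivial
      · intro p q hpq x
        have := hf (p + 1) (q + 1) (by omega) (consTensor (Pi.single j 1) x)
        rw [← consTensor_cup, ← consTensor_cup] at this
        exact this
    choose S hS using h1
    let S₁ : (Word ι (d + 3) → k) →ₗ[k] Y := ∑ j, S j ∘ₗ fiber j (d + 2)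
    have hdec : ∀ x : Word ι (d + 1) → k, ∑ j, consTensor (Pi.single j 1) (fiber j d x) = x := by
      intro x
      refine fiber_ext fun i => ?_
      simp [fiber_consTensor, Pi.single_apply]
    have hS₁ : ∀ p ≤ d, ∀ x, S₁ (cup G (p + 1) (d + 1) x) = f (p + 1) x := by
      intro p hp x
      simp only [S₁, LinearMap.sum_apply, LinearMap.comp_apply, fiber_cup_succ, hS _ p hp]
      rw [← map_sum, hdec]
    let δ : (Word ι (d + 1) → k) →ₗ[k] Y := f 0 - S₁ ∘ₗ cup G 0 (d + 1)
    have hδ : ∀ x ∈ cupSpan G (d + 1), δ x = 0 := by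
      intro x hx
      rcases d with _ | d
      · have : x = 0 := hx
        rw [this, map_zero]
      · have h' : x ∈ ⨆ p, LinearMap.range (cup G p d) := hx
        clear hx
        induction h' using Submodule.iSup_induction' with
        | mem q x hx =>
          obtain ⟨y, rfl⟩ := hx
          by_cases hq : q ≤ d
          · simp only [δ, LinearMap.sub_apply, LinearMap.comp_apply]
            rw [cup_cup G hG (Nat.zero_le q), hS₁ (q + 1) (by omega), hf 0 q (Nat.zero_le q),
              sub_self]
          · rw [cup_eq_zero G (by omega)]; simp
        | zero => simp
        | add x y hx hy hx' hy' => rw [map_add, hx', hy', add_zero]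
    refine ⟨S₁ + δ ∘ₗ s.ret₂ (d + 1), fun p hp x => ?_⟩
    cases p with
    | zero => simp [s.ret₂_cup_zero, δ]
    | succ p =>
      simp [hS₁ p (by omega), hδ _ (s.ret₂_cup_succ_mem p (d + 1) x)]

/-- The compatibility that a family `f p` has to satisfy to be of the form `cap C p ∘ T`. -/
def CapCompat (C : ℕ → Matrix ι ι k) {Z : Type*} [AddCommGroup Z] [Module k Z] :
    ∀ d : ℕ, (ℕ → (Z →ₗ[k] (Word ι d → k))) → Prop
  | 0, _ => True
  | 1, _ => True
  | d + 2, f => ∀ p q, p ≤ q → ∀ z, cap C p d (f (q + 2) z) = cap C q d (f p z)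

theorem mem_capKer (C : ℕ → Matrix ι ι k) {d : ℕ} {x : Word ι (d + 2) → k} :
    x ∈ capKer C (d + 2) ↔ ∀ p, cap C p d x = 0 := by
  simp [capKer, Submodule.mem_iInf]

theorem headContract_mem_capKer (C : ℕ → Matrix ι ι k) (a : ι → k) :
    ∀ {d : ℕ} {x : Word ι (d + 1) → k}, x ∈ capKer C (d + 1) → headContract a d x ∈ capKer C d
  | 0, _, _ => trivial
  | 1, _, _ => trivial
  | d + 2, x, h => by
    rw [mem_capKer] at h ⊢
    intro p
    rw [← headContract_cap_succ, h, map_zero]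

namespace Splitting

variable {C : ℕ → Matrix ι ι k} (s : Splitting C)

/-- A map from tensors of degree `d` to tensors of degree `d + 1`, dual to `ret`. -/
def sec : ∀ d : ℕ, (Word ι d → k) →ₗ[k] (Word ι (d + 1) → k)
  | 0 => consTensor (s.η 0)
  | d + 1 => consTensor (s.η (d + 1)) -
      consTensor (s.ξ d) ∘ₗ sec d ∘ₗ headContract (s.a d) d

/-- The map `x ↦ ξ ⊗ sec x`, a section of `cap C 0`. -/
def sec₂ (d : ℕ) : (Word ι d → k) →ₗ[k] (Word ι (d + 2) → k) :=
  consTensor (s.ξ d) ∘ₗ s.sec d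

theorem sec_succ (d : ℕ) (x : Word ι (d + 1) → k) :
    s.sec (d + 1) x = consTensor (s.η (d + 1)) x - s.sec₂ d (headContract (s.a d) d x) := rfl

theorem cap_zero_consTensor_consTensor (b c : ι → k) (d : ℕ) (x : Word ι d → k) :
    cap C 0 d (consTensor b (consTensor c x)) = (∑ i, ∑ j, C d i j * (b i * c j)) • x := by
  simp only [cap_zero_apply, fiber_consTensor, map_smul, smul_smul, Finset.sum_smul]

theorem cap_zero_consTensor (b : ι → k) (d : ℕ) (x : Word ι (d + 1) → k) :
    cap C 0 d (consTensor b x) = headContract (fun j => ∑ i, C d i j * b i) d x := by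
  simp only [cap_zero_apply, fiber_consTensor, map_smul, smul_smul, headContract_apply,
    Finset.sum_smul]
  exact Finset.sum_comm

theorem cap_zero_sec₂ (d : ℕ) (x : Word ι d → k) : cap C 0 d (s.sec₂ d x) = x := by
  cases d with
  | zero =>
    refine (cap_zero_consTensor_consTensor _ _ 0 x).trans ?_
    rw [s.pair_one, one_smul]
  | succ d =>
    rw [sec₂, LinearMap.comp_apply, sec_succ, map_sub, map_sub, cap_zero_consTensor_consTensor,
      s.pair_one, one_smul, sec₂, LinearMap.comp_apply, cap_zero_consTensor_consTensor,
      s.pair_zero, zero_smul, sub_zero]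

theorem cap_sec (p d : ℕ) (x : Word ι (d + 1) → k) (hx : x ∈ capKer C (d + 1)) :
    cap C p d (s.sec (d + 1) x) = 0 := by
  induction p generalizing d with
  | zero =>
    rw [sec_succ, map_sub, cap_zero_sec₂, cap_zero_consTensor, sub_eq_zero]
    rfl
  | succ p ih =>
    cases d with
    | zero => simp [cap]
    | succ d =>
      rw [sec_succ]
      refine fiber_ext fun j => ?_
      rw [fiber_cap_succ, map_sub, fiber_consTensor, sec₂, LinearMap.comp_apply, fiber_consTensor,
        map_sub, map_smul, map_smul, ih d _ (headContract_mem_capKer C _ hx),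
        (mem_capKer C).1 hx p]
      simp

theorem cap_succ_sec₂ (p d : ℕ) (x : Word ι d → k) (hx : x ∈ capKer C d) :
    cap C (p + 1) d (s.sec₂ d x) = 0 := by
  cases d with
  | zero => simp [cap]
  | succ d =>
    refine fiber_ext fun j => ?_
    rw [fiber_cap_succ, sec₂, LinearMap.comp_apply, fiber_consTensor, map_smul, s.cap_sec p d x hx]
    simp

end Splitting

/-- A compatible family of linear maps lifts along the contractions. -/
theorem exists_cap_comp {C : ℕ → Matrix ι ι k} (s : Splitting C) (hC : ∀ d, C (d + 2) = C d)
    {Z : Type*} [AddCommGroup Z] [Module k Z]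
    (d : ℕ) (f : ℕ → (Z →ₗ[k] (Word ι d → k))) (hf : CapCompat C d f) :
    ∃ T : Z →ₗ[k] (Word ι (d + 2) → k), ∀ p ≤ d, ∀ z, cap C p d (T z) = f p z := by
  induction d with
  | zero =>
    refine ⟨s.sec₂ 0 ∘ₗ f 0, fun p hp z => ?_⟩
    obtain rfl : p = 0 := by omega
    simp [s.cap_zero_sec₂]
  | succ d ih =>
    have h1 : ∀ j : ι, ∃ T : Z →ₗ[k] (Word ι (d + 2) → k), ∀ p ≤ d, ∀ z,
        cap C p d (T z) = fiber j d (f (p + 1) z) := by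
      intro j
      refine ih (fun p => fiber j d ∘ₗ f (p + 1)) ?_
      rcases d with _ | _ | d
      · trivial
      · trivial
      · intro p q hpq z
        exact congrArg (fiber j d) (hf (p + 1) (q + 1) (by omega) z)
    choose T hT using h1
    have hT₁ : ∀ p ≤ d, ∀ z, cap C (p + 1) (d + 1) (glue T z) = f (p + 1) z := by
      intro p hp z
      refine fiber_ext fun j => ?_
      rw [fiber_cap_succ, fiber_glue, hT j p hp]
    let δ : Z →ₗ[k] (Word ι (d + 1) → k) := f 0 - cap C 0 (d + 1) ∘ₗ glue T
    have hδ : ∀ z, δ z ∈ capKer C (d + 1) := by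
      intro z
      rcases d with _ | d
      · trivial
      · rw [mem_capKer]
        intro q
        by_cases hq : q ≤ d
        · simp only [δ, LinearMap.sub_apply, LinearMap.comp_apply]
          rw [map_sub, ← cap_cap C hC (Nat.zero_le q), hT₁ (q + 1) (by omega),
            hf 0 q (Nat.zero_le q), sub_self]
        · rw [cap_eq_zero C (by omega)]; simp
    refine ⟨glue T + s.sec₂ (d + 1) ∘ₗ δ, fun p hp z => ?_⟩
    cases p with
    | zero =>
      rw [LinearMap.add_apply, map_add, LinearMap.comp_apply, s.cap_zero_sec₂]
      simp [δ]
    | succ p =>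
      rw [LinearMap.add_apply, map_add, LinearMap.comp_apply, s.cap_succ_sec₂ p _ _ (hδ z),
        hT₁ p (by omega), add_zero]

end Extension

/-! ### Linear maps between tensor powers that commute with insertions and contractions -/

section Naturality

variable {k : Type u} [Field k] {ι κ : Type} [Fintype ι] [Fintype κ] [DecidableEq ι] [DecidableEq κ]

/-- The matrices `G`, `C` of the insertions and contractions, subject to the zigzag identities. -/
structure Zigzag (k : Type u) [Field k] (ι : Type) [Fintype ι] [DecidableEq ι] where
  G : ℕ → Matrix ι ι k
  C : ℕ → Matrix ι ι k
  G_add_two : ∀ d, G (d + 2) = G d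
  C_add_two : ∀ d, C (d + 2) = C d
  C_mul_G : ∀ d, C (d + 1) * G d = 1
  G_mul_C : ∀ d, G (d + 1) * C d = 1

/-- The value of a closed loop. -/
def Zigzag.loop (P : Zigzag k ι) (d : ℕ) : k := ∑ i, ∑ j, P.C d i j * P.G d i j

variable (P : Zigzag k ι) (Q : Zigzag k κ)

/-- `t` and `t'` commute with the insertions and contractions between degrees `d` and `d + 2`. -/
structure Intertwines (d : ℕ) (t : (Word ι d → k) →ₗ[k] (Word κ d → k))
    (t' : (Word ι (d + 2) → k) →ₗ[k] (Word κ (d + 2) → k)) : Prop where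
  cup : ∀ p x, t' (cup P.G p d x) = cup Q.G p d (t x)
  cap : ∀ p x, cap Q.C p d (t' x) = t (cap P.C p d x)

/-- `t` is the upper end of an intertwining pair, if its degree is at least `2`. -/
def Extendable : ∀ d : ℕ, ((Word ι d → k) →ₗ[k] (Word κ d → k)) → Prop
  | 0, _ => True
  | 1, _ => True
  | d + 2, t => ∃ t', Intertwines P Q d t' t

variable {P Q}

/-- An insertion followed by a contraction is a loop, an identity, or an insertion after a
contraction; in all cases it commutes with `t`. -/
theorem Extendable.cap_cup (hloop : ∀ d, P.loop d = Q.loop d) {d : ℕ}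
    {t : (Word ι d → k) →ₗ[k] (Word κ d → k)} (ht : Extendable P Q d t) {p q : ℕ}
    (hp : p ≤ d) (hq : q ≤ d) (x : Word ι d → k) :
    cap Q.C q d (cup Q.G p d (t x)) =
      t (cap P.C q d (cup P.G p d x)) := by
  have hcase : q = p ∨ q = p + 1 ∨ p = q + 1 ∨ (∃ e p', d = e + 2 ∧ p = p' + 2 ∧ q ≤ p') ∨
      (∃ e q', d = e + 2 ∧ q = q' + 2 ∧ p ≤ q') := by
    rcases lt_trichotomy p q with h | h | h
    · by_cases h' : q = p + 1
      · simp [h']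
      · exact Or.inr (Or.inr (Or.inr (Or.inr ⟨d - 2, q - 2, by omega, by omega, by omega⟩)))
    · simp [h]
    · by_cases h' : p = q + 1
      · simp [h']
      · exact Or.inr (Or.inr (Or.inr (Or.inl ⟨d - 2, p - 2, by omega, by omega, by omega⟩)))
  rcases hcase with rfl | rfl | rfl | ⟨e, p, rfl, rfl, h⟩ | ⟨e, q, rfl, rfl, h⟩
  · rw [cap_cup_self _ _ hp, cap_cup_self _ _ hp, map_smul]
    exact congrArg (· • t x) (hloop (d - q)).symm
  · rw [cap_succ_cup _ _ Q.G_mul_C hq, cap_succ_cup _ _ P.G_mul_C hq]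
  · rw [cap_cup_succ _ _ Q.C_mul_G hp, cap_cup_succ _ _ P.C_mul_G hp]
  · obtain ⟨t', h'⟩ := ht
    rw [cap_cup_far_right _ _ Q.C_add_two h, cap_cup_far_right _ _ P.C_add_two h, h'.cup, h'.cap]
  · obtain ⟨t', h'⟩ := ht
    rw [cap_cup_far_left _ _ Q.G_add_two h, cap_cup_far_left _ _ P.G_add_two h, h'.cup, h'.cap]

/-- An intertwining pair can be continued two degrees further. -/
theorem Extendable.exists_intertwines (sP : Splitting P.G) (sQ : Splitting Q.C)
    (hloop : ∀ d, P.loop d = Q.loop d) {d : ℕ}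
    {t : (Word ι d → k) →ₗ[k] (Word κ d → k)} (ht : Extendable P Q d t) :
    ∃ t', Intertwines P Q d t t' := by
  obtain ⟨T, hT⟩ : ∃ T : (Word ι (d + 2) → k) →ₗ[k] (Word κ (d + 2) → k), ∀ p ≤ d, ∀ z,
      cap Q.C p d (T z) = t (cap P.C p d z) := by
    refine exists_cap_comp sQ Q.C_add_two d (fun p => t ∘ₗ cap P.C p d) ?_
    rcases d with _ | _ | d
    · trivial
    · trivial
    · obtain ⟨t', h⟩ := ht
      intro p q hpq z
      simp only [LinearMap.comp_apply]
      rw [h.cap, h.cap, cap_cap _ P.C_add_two hpq]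
  have hmem : ∀ p x, cup Q.G p d (t x) - T (cup P.G p d x) ∈
      capKer Q.C (d + 2) := by
    intro p x
    rw [mem_capKer]
    intro q
    by_cases hq : q ≤ d
    · by_cases hp : p ≤ d
      · rw [map_sub, hT q hq, ht.cap_cup hloop hp hq, sub_self]
      · rw [cup_eq_zero Q.G (by omega), cup_eq_zero P.G (by omega)]; simp
    · rw [cap_eq_zero _ (by omega)]; simp
  -- `T` is compatible with the contractions; its defect on the insertions takes values in `capKer`
  -- and is corrected by a map into `capKer`.
  let f : ℕ → ((Word ι d → k) →ₗ[k] capKer Q.C (d + 2)) := fun p =>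
    LinearMap.codRestrict _ (cup Q.G p d ∘ₗ t - T ∘ₗ cup P.G p d) (hmem p)
  obtain ⟨S, hS⟩ := exists_comp_cup sP P.G_add_two d f (by
    rcases d with _ | _ | d
    · trivial
    · trivial
    · obtain ⟨t', h⟩ := ht
      intro p q hpq x
      refine Subtype.ext ?_
      simp only [f, LinearMap.codRestrict_apply, LinearMap.sub_apply, LinearMap.comp_apply]
      rw [h.cup, h.cup, cup_cup _ P.G_add_two hpq, cup_cup _ Q.G_add_two hpq])
  refine ⟨T + (capKer Q.C (d + 2)).subtype ∘ₗ S, fun p x => ?_, fun p x => ?_⟩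
  · by_cases hp : p ≤ d
    · simp [hS p hp, f]
    · rw [cup_eq_zero Q.G (by omega), cup_eq_zero P.G (by omega)]; simp
  · by_cases hp : p ≤ d
    · rw [LinearMap.add_apply, map_add, hT p hp, LinearMap.comp_apply,
        Submodule.subtype_apply, (mem_capKer Q.C).1 (S x).2 p, add_zero]
    · rw [cap_eq_zero Q.C (by omega), cap_eq_zero P.C (by omega)]; simp

/-- There is a family of linear maps, commuting with all insertions and contractions, that is
non-zero in degree `0` and vanishes in odd degrees. -/
theorem exists_intertwining_family (sP : Splitting P.G) (sQ : Splitting Q.C)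
    (hloop : ∀ d, P.loop d = Q.loop d) :
    ∃ T : ∀ d, (Word ι d → k) →ₗ[k] (Word κ d → k),
      (∀ d, Intertwines P Q d (T d) (T (d + 2))) ∧ (∀ d, ¬ Even d → T d = 0) ∧ T 0 ≠ 0 := by
  let E : ∀ d, {t : (Word ι d → k) →ₗ[k] (Word κ d → k) // Extendable P Q d t} :=
    Nat.twoStepInduction ⟨LinearMap.id (M := Unit → k), trivial⟩ ⟨0, trivial⟩
      fun d t _ => ⟨(t.2.exists_intertwines sP sQ hloop).choose, t.1,
        (t.2.exists_intertwines sP sQ hloop).choose_spec⟩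
  have hE : ∀ d, Intertwines P Q d (E d).1 (E (d + 2)).1 := fun d =>
    ((E d).2.exists_intertwines sP sQ hloop).choose_spec
  have h0 : (E 0).1 ≠ 0 := by
    intro h
    have := congrFun (LinearMap.congr_fun h (fun _ => (1 : k))) ()
    exact one_ne_zero this
  refine ⟨fun d => if Even d then (E d).1 else 0, fun d => ?_, fun d hd => by simp [hd], ?_⟩
  · by_cases hd : Even d
    · have hd' : Even (d + 2) := by simpa [Nat.even_add] using hd
      simp only [hd, hd', if_true]
      exact hE d
    · have hd' : ¬ Even (d + 2) := by simpa [Nat.even_add] using hd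
      simp only [hd, hd', if_false]
      exact ⟨by simp, by simp⟩
  · simpa using h0

end Naturality

section SplittingExistence

theorem exists_orthogonal_ne_zero {k : Type u} [Field k] {ι : Type} [Fintype ι]
    (hι : 2 ≤ Fintype.card ι) (w : ι → k) :
    ∃ x : ι → k, x ≠ 0 ∧ x ⬝ᵥ w = 0 := by
  let φ : (ι → k) →ₗ[k] k :=
    { toFun x := x ⬝ᵥ w
      map_add' _ _ := add_dotProduct _ _ _
      map_smul' _ _ := smul_dotProduct _ _ _ }
  have h : LinearMap.ker φ ≠ ⊥ := by
    apply LinearMap.ker_ne_bot_of_finrank_lt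
    simp; omega
  obtain ⟨x, hx, hx0⟩ := (Submodule.ne_bot_iff _).1 h
  exact ⟨x, hx0, hx⟩

variable {k : Type u} [Field k] [IsAlgClosed k] {ι : Type} [Fintype ι] [DecidableEq ι]

/-- If `G` takes two invertible values alternately, there are vectors as in `Splitting`: one takes
for `ξ 0` an eigenvector of `ᵗ(G 0)⁻¹ (G 1)`, so that a single linear condition on `ξ 1` remains. -/
theorem exists_splitting (hι : 2 ≤ Fintype.card ι) (A B : GL ι k) :
    Nonempty (Splitting fun d : ℕ => if Even d then A.val else B.val) := by
  have hne : Nonempty ι := Fintype.card_pos_iff.1 (by omega)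
  obtain ⟨μ, hμ⟩ := Module.End.exists_eigenvalue (Matrix.toLin' ((A⁻¹.val).transpose * B.val))
  obtain ⟨x, hx⟩ := hμ.exists_hasEigenvector
  have hx0 : x ≠ 0 := hx.2
  have hx1 : B.val.mulVec x = μ • A.val.transpose.mulVec x := by
    have h1 := hx.apply_eq_smul
    rw [Matrix.toLin'_apply] at h1
    have h2 := congrArg (A.val.transpose.mulVec) h1
    rw [Matrix.mulVec_mulVec, ← Matrix.mul_assoc, ← Matrix.transpose_mul, ← Units.val_mul,
      inv_mul_cancel, Units.val_one, Matrix.transpose_one, Matrix.one_mul, Matrix.mulVec_smul] at h2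
    exact h2
  obtain ⟨y, hy0, hy⟩ := exists_orthogonal_ne_zero hι (A.val.transpose.mulVec x)
  have hη : ∀ (M : GL ι k) (z : ι → k), z ≠ 0 → ∃ w : ι → k, z ⬝ᵥ M.val.mulVec w = 1 := by
    intro M z hz
    have : ∃ j, Matrix.vecMul z M.val j ≠ 0 := by
      by_contra! hcon
      apply hz
      have h3 : Matrix.vecMul z M.val = 0 := funext hcon
      have h4 := congrArg (fun v => Matrix.vecMul v M⁻¹.val) h3
      simpa [Matrix.vecMul_vecMul, ← Units.val_mul] using h4
    obtain ⟨j, hj⟩ := this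
    refine ⟨Pi.single j (Matrix.vecMul z M.val j)⁻¹, ?_⟩
    rw [Matrix.dotProduct_mulVec, dotProduct_single, mul_inv_cancel₀ hj]
  obtain ⟨wx, hwx⟩ := hη A x hx0
  obtain ⟨wy, hwy⟩ := hη B y hy0
  have hform : ∀ (M : Matrix ι ι k) (z w : ι → k),
      ∑ i, ∑ j, M i j * (z i * w j) = z ⬝ᵥ M.mulVec w := by
    intro M z w
    simp only [dotProduct, Matrix.mulVec, Finset.mul_sum]
    exact Finset.sum_congr rfl fun i _ => Finset.sum_congr rfl fun j _ => by ring
  refine ⟨⟨fun d => if Even d then x else y, fun d => if Even d then wx else wy, fun d => ?_,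
    fun d => ?_⟩⟩
  · by_cases hd : Even d
    · simp only [hd, if_true, hform, hwx]
    · simp only [hd, if_false, hform, hwy]
  · by_cases hd : Even d
    · have hd' : ¬ Even (d + 1) := by simpa [Nat.even_add_one] using hd
      simp only [hd, hd', if_true, if_false, hform, hx1, dotProduct_smul, hy, smul_zero]
    · have hd' : Even (d + 1) := by simpa [Nat.even_add_one] using hd
      simp only [hd, hd', if_true, if_false, hform]
      rw [Matrix.dotProduct_mulVec, ← Matrix.mulVec_transpose, dotProduct_comm, hy]

end SplittingExistence

/-! ### The rectangular relations and their universal algebra -/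

open scoped TensorProduct

section Universal

variable {k : Type u} [Field k] {m n p : ℕ}

/-- The relations of `H(F)` for rectangular matrices: `U ᵗV = ᵗV U = I` and
`V F ᵗU E⁻¹ = F ᵗU E⁻¹ V = I`. -/
structure RectSolution (E : GL (Fin m) k) (F : GL (Fin n) k) {A : Type u} [Ring A] [Algebra k A]
    (U V : Matrix (Fin m) (Fin n) A) : Prop where
  u_vt : U * V.transpose = 1
  vt_u : V.transpose * U = 1
  v_ut : V * scalarMat A F.val * U.transpose * scalarMat A E⁻¹.val = 1
  ut_v : scalarMat A F.val * U.transpose * scalarMat A E⁻¹.val * V = 1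

/-- `A` is the universal algebra carrying a solution of the rectangular relations. -/
structure IsUniversal (E : GL (Fin m) k) (F : GL (Fin n) k) (A : Type u) [Ring A] [Algebra k A]
    (U V : Matrix (Fin m) (Fin n) A) : Prop where
  sol : RectSolution E F U V
  exists_lift : ∀ {B : Type u} [Ring B] [Algebra k B] {U' V' : Matrix (Fin m) (Fin n) B},
    RectSolution E F U' V' → ∃ f : A →ₐ[k] B, U.map f = U' ∧ V.map f = V'
  hom_ext : ∀ {B : Type u} [Ring B] [Algebra k B] {f g : A →ₐ[k] B},
    U.map f = U.map g → V.map f = V.map g → f = g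

theorem rect_transpose_mul {l : ℕ} {A : Type u} [Ring A]
    (M : Matrix (Fin m) (Fin n) A) (N : Matrix (Fin n) (Fin l) A)
    (h : ∀ i j i' j', Commute (M i j) (N i' j')) :
    (M * N).transpose = N.transpose * M.transpose := by
  ext i j
  simp only [Matrix.transpose_apply, Matrix.mul_apply]
  exact Finset.sum_congr rfl fun l _ => h _ _ _ _

theorem rect_transpose_scalarMat_mul {A : Type u} [Ring A] [Algebra k A]
    (M : Matrix (Fin m) (Fin m) k) (N : Matrix (Fin m) (Fin n) A) :
    (scalarMat A M * N).transpose = N.transpose * (scalarMat A M).transpose :=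
  rect_transpose_mul _ _ fun _ _ _ _ => Algebra.commutes _ _

theorem rect_transpose_mul_scalarMat {A : Type u} [Ring A] [Algebra k A]
    (M : Matrix (Fin n) (Fin n) k) (N : Matrix (Fin m) (Fin n) A) :
    (N * scalarMat A M).transpose = (scalarMat A M).transpose * N.transpose :=
  rect_transpose_mul _ _ fun _ _ _ _ => (Algebra.commutes _ _).symm

theorem rect_map_op_mul {l : ℕ} {A : Type u} [Ring A] (M : Matrix (Fin m) (Fin n) A)
    (N : Matrix (Fin n) (Fin l) A) :
    M.map MulOpposite.op * N.map MulOpposite.op =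
      (N.transpose * M.transpose).transpose.map MulOpposite.op := by
  ext i j; simp [Matrix.mul_apply]

namespace RectSolution

variable {E : GL (Fin m) k} {F : GL (Fin n) k} {G : GL (Fin p) k} {A B : Type u} [Ring A]
  [Algebra k A] [Ring B] [Algebra k B]

theorem map {U V : Matrix (Fin m) (Fin n) A} (h : RectSolution E F U V) (f : A →ₐ[k] B) :
    RectSolution E F (U.map f) (V.map f) where
  u_vt := by
    simpa only [Matrix.map_mul, Matrix.transpose_map, scalarMat_map, Matrix.map_one, map_zero,
      map_one] using congrArg (fun M => M.map f) h.u_vt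
  vt_u := by
    simpa only [Matrix.map_mul, Matrix.transpose_map, scalarMat_map, Matrix.map_one, map_zero,
      map_one] using congrArg (fun M => M.map f) h.vt_u
  v_ut := by
    simpa only [Matrix.map_mul, Matrix.transpose_map, scalarMat_map, Matrix.map_one, map_zero,
      map_one] using congrArg (fun M => M.map f) h.v_ut
  ut_v := by
    simpa only [Matrix.map_mul, Matrix.transpose_map, scalarMat_map, Matrix.map_one, map_zero,
      map_one] using congrArg (fun M => M.map f) h.ut_v

theorem mul {U V : Matrix (Fin m) (Fin n) A} {U' V' : Matrix (Fin n) (Fin p) A}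
    (h : RectSolution E F U V) (h' : RectSolution F G U' V')
    (hU : ∀ i j i' j', Commute (U i j) (U' i' j')) (hV : ∀ i j i' j', Commute (V i j) (V' i' j')) :
    RectSolution E G (U * U') (V * V') where
  u_vt := by
    rw [rect_transpose_mul _ _ hV, Matrix.mul_assoc, ← Matrix.mul_assoc U', h'.u_vt,
      Matrix.one_mul, h.u_vt]
  vt_u := by
    rw [rect_transpose_mul _ _ hV, Matrix.mul_assoc, ← Matrix.mul_assoc _ U, h.vt_u,
      Matrix.one_mul, h'.vt_u]
  v_ut := by
    rw [rect_transpose_mul _ _ hU]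
    calc V * V' * scalarMat A G.val * (U'.transpose * U.transpose) * scalarMat A E⁻¹.val
        = V * (V' * scalarMat A G.val * U'.transpose * (scalarMat A F⁻¹.val * scalarMat A F.val))
            * U.transpose * scalarMat A E⁻¹.val := by
          rw [scalarMat_inv_val]; simp only [Matrix.mul_assoc, Matrix.mul_one]
      _ = V * (V' * scalarMat A G.val * U'.transpose * scalarMat A F⁻¹.val) * scalarMat A F.val
            * U.transpose * scalarMat A E⁻¹.val := by simp only [Matrix.mul_assoc]
      _ = 1 := by rw [h'.v_ut, Matrix.mul_one, h.v_ut]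
  ut_v := by
    rw [rect_transpose_mul _ _ hU]
    calc scalarMat A G.val * (U'.transpose * U.transpose) * scalarMat A E⁻¹.val * (V * V')
        = scalarMat A G.val * U'.transpose * (scalarMat A F⁻¹.val * scalarMat A F.val) *
            U.transpose * scalarMat A E⁻¹.val * (V * V') := by
          rw [scalarMat_inv_val]; simp only [Matrix.mul_assoc, Matrix.mul_one]
      _ = scalarMat A G.val * U'.transpose * scalarMat A F⁻¹.val * (scalarMat A F.val *
            U.transpose * scalarMat A E⁻¹.val * V) * V' := by simp only [Matrix.mul_assoc]
      _ = 1 := by rw [h.ut_v, Matrix.mul_one, h'.ut_v]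

/-- The solution in the opposite algebra that defines the antipode. -/
theorem antipode {U V : Matrix (Fin m) (Fin n) A} (h : RectSolution E F U V) :
    RectSolution F E (V.transpose.map MulOpposite.op)
      ((scalarMat A F.val * U.transpose * scalarMat A E⁻¹.val).map MulOpposite.op) where
  u_vt := by
    rw [← Matrix.transpose_map, rect_map_op_mul, Matrix.transpose_transpose,
      Matrix.transpose_transpose, h.ut_v]
    simp
  vt_u := by
    rw [← Matrix.transpose_map, rect_map_op_mul, Matrix.transpose_transpose,
      Matrix.transpose_transpose, ← Matrix.mul_assoc, ← Matrix.mul_assoc, h.v_ut]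
    simp
  v_ut := by
    have h1 : scalarMat A F.val * U.transpose * scalarMat A E⁻¹.val * scalarMat A E.val =
        scalarMat A F.val * U.transpose := by
      rw [Matrix.mul_assoc, scalarMat_inv_val, Matrix.mul_one]
    have h2 : (scalarMat A F.val * U.transpose * scalarMat A E⁻¹.val).map MulOpposite.op *
        scalarMat Aᵐᵒᵖ E.val * (V.transpose.map MulOpposite.op).transpose =
          scalarMat Aᵐᵒᵖ F.val := by
      rw [scalarMat_op, scalarMat_op, rect_map_op_mul, ← rect_transpose_mul_scalarMat, h1,
        ← Matrix.transpose_map, rect_map_op_mul, Matrix.transpose_transpose,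
        Matrix.transpose_transpose, rect_transpose_scalarMat_mul, Matrix.transpose_transpose,
        ← Matrix.mul_assoc, h.vt_u, Matrix.one_mul, Matrix.transpose_transpose]
    rw [h2, scalarMat_val_inv]
  ut_v := by
    have h1 : scalarMat A F⁻¹.val * (scalarMat A F.val * U.transpose * scalarMat A E⁻¹.val) =
        U.transpose * scalarMat A E⁻¹.val := by
      rw [← Matrix.mul_assoc, ← Matrix.mul_assoc, scalarMat_inv_val, Matrix.one_mul]
    have h2 : (V.transpose.map MulOpposite.op).transpose * (scalarMat Aᵐᵒᵖ F⁻¹.val *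
        (scalarMat A F.val * U.transpose * scalarMat A E⁻¹.val).map MulOpposite.op) =
          scalarMat Aᵐᵒᵖ E⁻¹.val := by
      rw [scalarMat_op, scalarMat_op, rect_map_op_mul, ← rect_transpose_scalarMat_mul, h1,
        ← Matrix.transpose_map, rect_map_op_mul, Matrix.transpose_transpose,
        Matrix.transpose_transpose, rect_transpose_mul_scalarMat, Matrix.transpose_transpose,
        Matrix.mul_assoc, h.u_vt, Matrix.mul_one, Matrix.transpose_transpose]
    rw [Matrix.mul_assoc, Matrix.mul_assoc, h2, scalarMat_val_inv]

end RectSolution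

section Existence

variable (k m n) in
/-- The matrices of generators of the free algebra: `b = false` gives `u` and `b = true`
gives `v`. -/
def freeMat (b : Bool) : Matrix (Fin m) (Fin n) (FreeAlgebra k (Bool × Fin m × Fin n)) :=
  Matrix.of fun i j => FreeAlgebra.ι k (b, i, j)

/-- The defining relations of the rectangular analogue of `H(F)`: every identity that holds for
all solutions of the relations. -/
def RectRel (E : GL (Fin m) k) (F : GL (Fin n) k)
    (x y : FreeAlgebra k (Bool × Fin m × Fin n)) : Prop :=
  ∀ (A : Type u) [Ring A] [Algebra k A] (f : FreeAlgebra k (Bool × Fin m × Fin n) →ₐ[k] A),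
    RectSolution E F ((freeMat k m n false).map f) ((freeMat k m n true).map f) → f x = f y

/-- The universal algebra with a solution of the rectangular relations. -/
def RectAlg (E : GL (Fin m) k) (F : GL (Fin n) k) : Type u := RingQuot (RectRel E F)

instance (E : GL (Fin m) k) (F : GL (Fin n) k) : Ring (RectAlg E F) :=
  inferInstanceAs (Ring (RingQuot (RectRel E F)))
instance (E : GL (Fin m) k) (F : GL (Fin n) k) : Algebra k (RectAlg E F) :=
  inferInstanceAs (Algebra k (RingQuot (RectRel E F)))

variable (E : GL (Fin m) k) (F : GL (Fin n) k)

/-- The quotient map. -/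
def RectAlg.mk : FreeAlgebra k (Bool × Fin m × Fin n) →ₐ[k] RectAlg E F :=
  RingQuot.mkAlgHom k (RectRel E F)

/-- The matrices `u` (for `b = false`) and `v` (for `b = true`) over `RectAlg E F`. -/
def RectAlg.gen (b : Bool) : Matrix (Fin m) (Fin n) (RectAlg E F) :=
  (freeMat k m n b).map (RectAlg.mk E F)

theorem RectAlg.mk_matrix_eq {l : ℕ}
    {M N : Matrix (Fin l) (Fin l) (FreeAlgebra k (Bool × Fin m × Fin n))}
    (h : ∀ (A : Type u) [Ring A] [Algebra k A]
      (f : FreeAlgebra k (Bool × Fin m × Fin n) →ₐ[k] A),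
      RectSolution E F ((freeMat k m n false).map f) ((freeMat k m n true).map f) →
        M.map f = N.map f) :
    M.map (RectAlg.mk E F) = N.map (RectAlg.mk E F) := by
  ext i j
  exact RingQuot.mkAlgHom_rel k fun A _ _ f hf => congrFun (congrFun (h A f hf) i) j

theorem RectAlg.isUniversal :
    IsUniversal E F (RectAlg E F) (RectAlg.gen E F false) (RectAlg.gen E F true) where
  sol := by
    constructor
    · have := RectAlg.mk_matrix_eq E F (l := m)
        (M := freeMat k m n false * (freeMat k m n true).transpose) (N := 1)
        fun A _ _ f hf => by simpa [Matrix.map_mul, Matrix.transpose_map] using hf.u_vt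
      simpa [Matrix.map_mul, Matrix.transpose_map, RectAlg.gen] using this
    · have := RectAlg.mk_matrix_eq E F (l := n)
        (M := (freeMat k m n true).transpose * freeMat k m n false) (N := 1)
        fun A _ _ f hf => by simpa [Matrix.map_mul, Matrix.transpose_map] using hf.vt_u
      simpa [Matrix.map_mul, Matrix.transpose_map, RectAlg.gen] using this
    · have := RectAlg.mk_matrix_eq E F (l := m)
        (M := freeMat k m n true * scalarMat (FreeAlgebra k (Bool × Fin m × Fin n)) F.val *
          (freeMat k m n false).transpose *
          scalarMat (FreeAlgebra k (Bool × Fin m × Fin n)) E⁻¹.val) (N := 1)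
        fun A _ _ f hf => by
          simpa only [Matrix.map_mul, Matrix.transpose_map, scalarMat_map, Matrix.map_one, map_zero,
            map_one] using hf.v_ut
      simpa only [Matrix.map_mul, Matrix.transpose_map, scalarMat_map, Matrix.map_one, map_zero,
        map_one, RectAlg.gen] using this
    · have := RectAlg.mk_matrix_eq E F (l := n)
        (M := scalarMat (FreeAlgebra k (Bool × Fin m × Fin n)) F.val *
          (freeMat k m n false).transpose *
          scalarMat (FreeAlgebra k (Bool × Fin m × Fin n)) E⁻¹.val * freeMat k m n true) (N := 1)
        fun A _ _ f hf => by
          simpa only [Matrix.map_mul, Matrix.transpose_map, scalarMat_map, Matrix.map_one, map_zero,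
            map_one] using hf.ut_v
      simpa only [Matrix.map_mul, Matrix.transpose_map, scalarMat_map, Matrix.map_one, map_zero,
        map_one, RectAlg.gen] using this
  exists_lift {B _ _ U V} h := by
    let g : FreeAlgebra k (Bool × Fin m × Fin n) →ₐ[k] B :=
      FreeAlgebra.lift k fun x => cond x.1 (V x.2.1 x.2.2) (U x.2.1 x.2.2)
    have hU : (freeMat k m n false).map g = U := by ext i j; simp [freeMat, g]
    have hV : (freeMat k m n true).map g = V := by ext i j; simp [freeMat, g]
    refine ⟨RingQuot.liftAlgHom k ⟨g, fun x y hxy => hxy B g (by rw [hU, hV]; exact h)⟩, ?_, ?_⟩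
    · conv_rhs => rw [← hU]
      ext i j
      exact RingQuot.liftAlgHom_mkAlgHom_apply k _ _ _
    · conv_rhs => rw [← hV]
      ext i j
      exact RingQuot.liftAlgHom_mkAlgHom_apply k _ _ _
  hom_ext {B _ _ f g} hU hV := by
    apply RingQuot.ringQuot_ext'
    apply FreeAlgebra.hom_ext
    funext x
    rcases x with ⟨_ | _, i, j⟩
    exacts [congrFun (congrFun hU i) j, congrFun (congrFun hV i) j]

end Existence

namespace IsUniversal

variable {E : GL (Fin m) k} {F : GL (Fin n) k} {A : Type u} [Ring A] [Algebra k A]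
  {U V : Matrix (Fin m) (Fin n) A}

/-- The generators generate. -/
theorem induction (h : IsUniversal E F A U V) {q : A → Prop} (hs : ∀ c : k, q (algebraMap k _ c))
    (hu : ∀ i j, q (U i j)) (hv : ∀ i j, q (V i j))
    (hadd : ∀ x y, q x → q y → q (x + y)) (hmul : ∀ x y, q x → q y → q (x * y)) (x : A) : q x := by
  let S : Subalgebra k A :=
    { carrier := {x | q x}
      mul_mem' := fun {a b} ha hb => hmul a b ha hb
      add_mem' := fun {a b} ha hb => hadd a b ha hb
      algebraMap_mem' := hs }
  let U' : Matrix (Fin m) (Fin n) S := Matrix.of fun i j => ⟨U i j, hu i j⟩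
  let V' : Matrix (Fin m) (Fin n) S := Matrix.of fun i j => ⟨V i j, hv i j⟩
  have hU' : U'.map S.val = U := rfl
  have hV' : V'.map S.val = V := rfl
  have hinj : ∀ {l : ℕ} {M N : Matrix (Fin l) (Fin l) S}, M.map S.val = N.map S.val → M = N := by
    intro l M N hMN
    ext i j
    exact congrFun (congrFun hMN i) j
  have hsol : RectSolution E F U' V' := by
    constructor <;> apply hinj <;> simp only [Matrix.map_mul, Matrix.transpose_map, hU', hV',
      scalarMat_map, Matrix.map_one, map_zero, map_one]
    exacts [h.sol.u_vt, h.sol.vt_u, h.sol.v_ut, h.sol.ut_v]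
  obtain ⟨f, hfU, hfV⟩ := h.exists_lift hsol
  have hid : S.val.comp f = AlgHom.id k A := by
    apply h.hom_ext
    · change (U.map f).map S.val = U.map id
      rw [hfU, hU', Matrix.map_id]
    · change (V.map f).map S.val = V.map id
      rw [hfV, hV', Matrix.map_id]
  have := (f x).2
  rwa [show ((f x : S) : A) = x from DFunLike.congr_fun hid x] at this

end IsUniversal

end Universal

/-! ### The universal algebra is non-zero -/

section Nontrivial

variable {k : Type u} [Field k]

/-- The transpose of an invertible matrix. -/
def transposeGL {n : ℕ} (E : GL (Fin n) k) : GL (Fin n) k where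
  val := E.val.transpose
  inv := E⁻¹.val.transpose
  val_inv := by rw [← Matrix.transpose_mul, ← Units.val_mul]; simp
  inv_val := by rw [← Matrix.transpose_mul, ← Units.val_mul]; simp

/-- The insertions and contractions on the tensor powers of `kⁿ` defined by the matrix `E`. A letter
stands for `kⁿ` or its dual according to the parity of the number of letters to its right. -/
def zigzag {n : ℕ} (E : GL (Fin n) k) : Zigzag k (Fin n) where
  G d := if Even d then (1 : GL (Fin n) k).val else (transposeGL E)⁻¹.val
  C d := if Even d then (transposeGL E).val else (1 : GL (Fin n) k).val
  G_add_two d := by simp [Nat.even_add]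
  C_add_two d := by simp [Nat.even_add]
  C_mul_G d := by
    by_cases h : Even d
    · simp [h, Nat.even_add_one]
    · simp only [h, Nat.even_add_one, not_false_eq_true, if_true, if_false]
      rw [← Units.val_mul, mul_inv_cancel, Units.val_one]
  G_mul_C d := by
    by_cases h : Even d
    · simp only [h, Nat.even_add_one, not_true_eq_false, if_true, if_false]
      rw [← Units.val_mul, inv_mul_cancel, Units.val_one]
    · simp [h, Nat.even_add_one]

theorem zigzag_loop {n : ℕ} (E : GL (Fin n) k) (d : ℕ) :
    (zigzag E).loop d = if Even d then E.val.trace else E⁻¹.val.trace := by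
  by_cases h : Even d
  · simp [Zigzag.loop, zigzag, h, Matrix.one_apply, transposeGL, Matrix.trace]
  · have : ((transposeGL E)⁻¹).val = E⁻¹.val.transpose := rfl
    simp only [Zigzag.loop, zigzag, h, if_false, this]
    simp [Matrix.one_apply, Matrix.trace]

variable {ι κ : Type} [DecidableEq ι]

/-- The operator on families that fixes the first letters of source and target. -/
def stripHead (i : ι) (a : κ) : (∀ d, (Word ι d → k) →ₗ[k] (Word κ d → k)) →ₗ[k]
    (∀ d, (Word ι d → k) →ₗ[k] (Word κ d → k)) where
  toFun T := fun d => fiber a d ∘ₗ T (d + 1) ∘ₗ consTensor (Pi.single i 1)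
  map_add' _ _ := by funext d; ext1 x; simp
  map_smul' _ _ := by funext d; ext1 x; simp

theorem stripHead_apply (i : ι) (a : κ) (T : ∀ d, (Word ι d → k) →ₗ[k] (Word κ d → k)) (d : ℕ)
    (x : Word ι d → k) :
    stripHead i a T d x = fiber a d (T (d + 1) (consTensor (Pi.single i 1) x)) := rfl

variable [Fintype ι] [Fintype κ] [DecidableEq κ]

/-- The families that commute with all insertions and contractions and vanish in the degrees whose
parity is not `b`. -/
def intertwiningFamilies (P : Zigzag k ι) (Q : Zigzag k κ) (b : Bool) :
    Submodule k (∀ d, (Word ι d → k) →ₗ[k] (Word κ d → k)) where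
  carrier := {T | (∀ d, Intertwines P Q d (T d) (T (d + 2))) ∧ ∀ d, d.bodd ≠ b → T d = 0}
  add_mem' {S T} hS hT := ⟨fun d => ⟨fun p x => by
      simp [(hS.1 d).cup, (hT.1 d).cup], fun p x => by simp [(hS.1 d).cap, (hT.1 d).cap]⟩,
    fun d hd => by simp [hS.2 d hd, hT.2 d hd]⟩
  zero_mem' := ⟨fun d => ⟨by simp, by simp⟩, fun d hd => rfl⟩
  smul_mem' c T hT := ⟨fun d => ⟨fun p x => by simp [(hT.1 d).cup],
    fun p x => by simp [(hT.1 d).cap]⟩, fun d hd => by simp [hT.2 d hd]⟩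

variable {P : Zigzag k ι} {Q : Zigzag k κ} {b : Bool}

theorem stripHead_mem (i : ι) (a : κ) {T : ∀ d, (Word ι d → k) →ₗ[k] (Word κ d → k)}
    (hT : T ∈ intertwiningFamilies P Q b) : stripHead i a T ∈ intertwiningFamilies P Q (!b) := by
  refine ⟨fun d => ⟨fun p x => ?_, fun p x => ?_⟩, fun d hd => ?_⟩
  · rw [stripHead_apply, consTensor_cup]
    erw [(hT.1 (d + 1)).cup]
    rfl
  · rw [stripHead_apply, stripHead_apply, ← fiber_cap_succ]
    erw [(hT.1 (d + 1)).cap]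
    congr 2
    refine fiber_ext fun j => ?_
    rw [fiber_cap_succ, fiber_consTensor, fiber_consTensor, map_smul]
  · have : T (d + 1) = 0 := hT.2 (d + 1) (by
      rw [Nat.bodd_succ]
      revert hd
      cases d.bodd <;> cases b <;> simp)
    ext1 x
    rw [stripHead_apply, this]
    simp

theorem sum_smul_consTensor_consTensor (M : ℕ → Matrix ι ι k) (d : ℕ) (x : Word ι d → k) :
    ∑ i, ∑ j, M d i j • consTensor (Pi.single i 1) (consTensor (Pi.single j 1) x) =
      cup M 0 d x := by
  refine fiber_ext fun a => fiber_ext fun c => ?_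
  rw [fiber_fiber_cup_zero]
  simp [fiber_consTensor, Pi.single_apply]

/-- Commutation with the insertions at position `0`, in terms of `stripHead`. -/
theorem sum_stripHead_left (T : intertwiningFamilies P Q b) (a c : κ) (d : ℕ) :
    ∑ i, ∑ j, P.G d i j • stripHead j c (stripHead i a T.1) d = Q.G d a c • T.1 d := by
  ext1 x
  have h := congrArg (fun y => fiber c d (fiber a (d + 1) y)) ((T.2.1 d).cup 0 x)
  simp only [fiber_fiber_cup_zero, ← sum_smul_consTensor_consTensor P.G, map_sum, map_smul] at h
  simpa [stripHead_apply] using h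

/-- Commutation with the contractions at position `0`, in terms of `stripHead`. -/
theorem sum_stripHead_right (T : intertwiningFamilies P Q b) (i j : ι) (d : ℕ) :
    ∑ a, ∑ c, Q.C d a c • stripHead j c (stripHead i a T.1) d = P.C d i j • T.1 d := by
  ext1 x
  have h := (T.2.1 d).cap 0 (consTensor (Pi.single i 1) (consTensor (Pi.single j 1) x))
  rw [Splitting.cap_zero_consTensor_consTensor, cap_zero_apply] at h
  simpa [stripHead_apply, Pi.single_apply] using h

variable (P Q b) in
/-- `stripHead` as a map from the families of parity `b` to those of the other parity. -/
def strip (i : ι) (a : κ) : intertwiningFamilies P Q b →ₗ[k] intertwiningFamilies P Q (!b) :=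
  (stripHead i a).restrict fun _ hT => stripHead_mem i a hT

theorem family_ext {S T : intertwiningFamilies P Q b} (h : ∀ d, d.bodd = b → S.1 d = T.1 d) :
    S = T := by
  refine Subtype.ext (funext fun d => ?_)
  by_cases hd : d.bodd = b
  · exact h d hd
  · rw [S.2.2 d hd, T.2.2 d hd]

end Nontrivial

section Doubling

variable {k : Type u} [Field k] {m n : ℕ}

/-- A solution of the rectangular relations by operators `u i a : M → N` and `v i a : N → M`. -/
structure OperatorSolution (E : GL (Fin m) k) (F : GL (Fin n) k) {M N : Type u} [AddCommGroup M]
    [AddCommGroup N] [Module k M] [Module k N] (u : Fin m → Fin n → M →ₗ[k] N)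
    (v : Fin m → Fin n → N →ₗ[k] M) : Prop where
  u_vt : ∀ i j x, ∑ a, u i a (v j a x) = (1 : Matrix (Fin m) (Fin m) k) i j • x
  vt_u : ∀ a c x, ∑ i, v i a (u i c x) = (1 : Matrix (Fin n) (Fin n) k) a c • x
  v_ut : ∀ i j x, ∑ a, ∑ c, F.val a c • v i a (u j c x) = E.val i j • x
  ut_v : ∀ a c x, ∑ i, ∑ j, E⁻¹.val i j • u i a (v j c x) = F⁻¹.val a c • x

theorem matrix_eq_one_of_mul_scalarMat {A : Type u} [Ring A] [Algebra k A]
    {M : Matrix (Fin n) (Fin n) A} {F : GL (Fin n) k} (h : M = scalarMat A F.val) :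
    M * scalarMat A F⁻¹.val = 1 := by rw [h, scalarMat_val_inv]

theorem OperatorSolution.rectSolution {E : GL (Fin m) k} {F : GL (Fin n) k} {M : Type u}
    [AddCommGroup M] [Module k M] {u v : Fin m → Fin n → M →ₗ[k] M}
    (h : OperatorSolution E F u v) :
    RectSolution E F (A := Module.End k M) (Matrix.of u) (Matrix.of v) where
  u_vt := by
    ext i j x
    have := h.u_vt i j x
    simp only [Matrix.mul_apply, Matrix.transpose_apply, Matrix.of_apply, LinearMap.sum_apply,
      Module.End.mul_apply, this, Matrix.one_apply]
    split_ifs <;> simp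
  vt_u := by
    ext i j x
    have := h.vt_u i j x
    simp only [Matrix.mul_apply, Matrix.transpose_apply, Matrix.of_apply, LinearMap.sum_apply,
      Module.End.mul_apply, this, Matrix.one_apply]
    split_ifs <;> simp
  v_ut := by
    refine matrix_eq_one_of_mul_scalarMat ?_
    ext i j x
    have := h.v_ut i j x
    rw [Finset.sum_comm] at this
    simpa [Matrix.mul_apply, scalarMat, LinearMap.sum_apply, Finset.sum_mul, mul_assoc,
      Module.algebraMap_end_apply] using this
  ut_v := by
    have : (Matrix.of u).transpose * scalarMat (Module.End k M) E⁻¹.val * Matrix.of v =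
        scalarMat (Module.End k M) F⁻¹.val := by
      ext i j x
      have := h.ut_v i j x
      rw [Finset.sum_comm] at this
      simpa [Matrix.mul_apply, scalarMat, LinearMap.sum_apply, Finset.sum_mul, mul_assoc,
        Module.algebraMap_end_apply] using this
    rw [Matrix.mul_assoc, Matrix.mul_assoc, ← Matrix.mul_assoc _ (scalarMat _ _), this,
      scalarMat_val_inv]

theorem OperatorSolution.rank_eq {E : GL (Fin m) k} {F : GL (Fin n) k} {M N : Type u}
    [AddCommGroup M] [AddCommGroup N] [Module k M] [Module k N] {u : Fin m → Fin n → M →ₗ[k] N}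
    {v : Fin m → Fin n → N →ₗ[k] M} (h : OperatorSolution E F u v) :
    (n : Cardinal.{u}) * Module.rank k M = m * Module.rank k N := by
  let e : (Fin n → M) ≃ₗ[k] (Fin m → N) :=
    LinearEquiv.ofLinearMap
      (LinearMap.pi fun i => ∑ a, u i a ∘ₗ LinearMap.proj a)
      (LinearMap.pi fun a => ∑ i, v i a ∘ₗ LinearMap.proj i)
      (by
        refine LinearMap.ext fun x => funext fun i => ?_
        have : ∑ a, ∑ j, u i a (v j a (x j)) = x i := by
          rw [Finset.sum_comm]
          simp [h.u_vt, Matrix.one_apply]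
        simpa [LinearMap.sum_apply] using this)
      (by
        refine LinearMap.ext fun x => funext fun a => ?_
        have : ∑ i, ∑ c, v i a (u i c (x c)) = x a := by
          rw [Finset.sum_comm]
          simp [h.vt_u, Matrix.one_apply]
        simpa [LinearMap.sum_apply] using this)
  have := e.rank_eq
  simpa [rank_pi] using this

/-- Operators between `M` and `N` that satisfy the relations give a solution in a non-zero algebra:
the relations force `n * dim M = m * dim N`, so that direct sums of countably many copies of `M` and
of `N` are isomorphic. -/
theorem OperatorSolution.exists_rectSolution {E : GL (Fin m) k} {F : GL (Fin n) k} (hm : m ≠ 0)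
    (hn : n ≠ 0) {M N : Type u}
    [AddCommGroup M] [AddCommGroup N] [Module k M] [Module k N] [Nontrivial M]
    {u : Fin m → Fin n → M →ₗ[k] N}
    {v : Fin m → Fin n → N →ₗ[k] M} (h : OperatorSolution E F u v) :
    ∃ (A : Type u) (_ : Ring A) (_ : Algebra k A) (U V : Matrix (Fin m) (Fin n) A),
      Nontrivial A ∧ RectSolution E F U V := by
  have hrank : Module.rank k (ℕ →₀ M) = Module.rank k (ℕ →₀ N) := by
    have hmul : ∀ {l : ℕ}, l ≠ 0 → Cardinal.aleph0.{u} * (l : Cardinal.{u}) = Cardinal.aleph0 :=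
      fun hl => Cardinal.aleph0_mul_nat hl
    rw [rank_finsupp, rank_finsupp]
    simp only [Cardinal.mk_nat, Cardinal.lift_aleph0, Cardinal.lift_uzero]
    rw [← hmul hn, mul_assoc, h.rank_eq, ← mul_assoc, hmul hn, hmul hm, ← hmul hm]
  obtain ⟨e⟩ := nonempty_linearEquiv_of_rank_eq hrank
  let u' : Fin m → Fin n → (ℕ →₀ M) →ₗ[k] (ℕ →₀ M) := fun i a =>
    e.symm.toLinearMap ∘ₗ Finsupp.mapRange.linearMap (u i a)
  let v' : Fin m → Fin n → (ℕ →₀ M) →ₗ[k] (ℕ →₀ M) := fun i a =>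
    Finsupp.mapRange.linearMap (v i a) ∘ₗ e.toLinearMap
  have h' : OperatorSolution E F u' v' := by
    constructor
    · intro i j x
      apply e.injective
      ext l
      have := h.u_vt i j (e x l)
      simpa [u', v', Finsupp.finsetSum_apply] using this
    · intro a c x
      ext l
      have := h.vt_u a c (x l)
      simpa [u', v', Finsupp.finsetSum_apply] using this
    · intro i j x
      ext l
      have := h.v_ut i j (x l)
      simpa [u', v', Finsupp.finsetSum_apply] using this
    · intro a c x
      apply e.injective
      ext l
      have := h.ut_v a c (e x l)
      simpa [u', v', Finsupp.finsetSum_apply] using this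
  exact ⟨Module.End k (ℕ →₀ M), inferInstance, inferInstance, _, _, inferInstance, h'.rectSolution⟩

end Doubling

section

variable {k : Type u} [Field k] [IsAlgClosed k] {m n : ℕ}

/-- The universal algebra of the rectangular relations is non-zero if the traces agree. -/
theorem IsUniversal.nontrivial {E : GL (Fin m) k} {F : GL (Fin n) k} {A : Type u} [Ring A]
    [Algebra k A] {U V : Matrix (Fin m) (Fin n) A} (h : IsUniversal E F A U V) (hm : 2 ≤ m)
    (hn : 2 ≤ n) (htr : E.val.trace = F.val.trace) (htr' : E⁻¹.val.trace = F⁻¹.val.trace) :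
    Nontrivial A := by
  let P := zigzag E
  let Q := zigzag F
  obtain ⟨sP⟩ : Nonempty (Splitting P.G) := exists_splitting (by simpa using hm) _ _
  obtain ⟨sQ⟩ : Nonempty (Splitting Q.C) := exists_splitting (by simpa using hn) _ _
  obtain ⟨T, hT, hodd, h0⟩ := exists_intertwining_family sP sQ fun d => by
    rw [zigzag_loop, zigzag_loop, htr, htr']
  have hmem : T ∈ intertwiningFamilies P Q false := ⟨hT, fun d hd => hodd d (by
    rw [Nat.even_iff, Nat.mod_two_of_bodd]
    revert hd
    cases d.bodd <;> simp)⟩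
  have : Nontrivial (intertwiningFamilies P Q false) :=
    ⟨⟨⟨T, hmem⟩, 0, fun h => h0 (congrFun (congrArg Subtype.val h) 0)⟩⟩
  have hpar : ∀ {d : ℕ}, d.bodd = false → Even d := fun {d} h => by
    rw [Nat.even_iff, Nat.mod_two_of_bodd, h]; rfl
  have hpar' : ∀ {d : ℕ}, d.bodd = true → ¬ Even d := fun {d} h => by
    rw [Nat.even_iff, Nat.mod_two_of_bodd, h]; simp
  let u : Fin m → Fin n → intertwiningFamilies P Q false →ₗ[k] intertwiningFamilies P Q true :=
    strip P Q false
  let v : Fin m → Fin n → intertwiningFamilies P Q true →ₗ[k] intertwiningFamilies P Q false :=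
    strip P Q true
  have hu : ∀ i a x, (u i a x).1 = stripHead i a x.1 := fun _ _ _ => rfl
  have hv : ∀ i a x, (v i a x).1 = stripHead i a x.1 := fun _ _ _ => rfl
  have hsum : ∀ {b : Bool} {α : Type} (t : Finset α) (f : α → intertwiningFamilies P Q b) (d : ℕ),
      (∑ x ∈ t, f x).1 d = ∑ x ∈ t, (f x).1 d := fun t f d => by
    rw [AddSubmonoidClass.coe_finsetSum, Finset.sum_apply]
  have hone : ∀ {l : ℕ} (i j : Fin l), (1 : Matrix (Fin l) (Fin l) k) i j =
      if j = i then 1 else 0 := fun i j => by simp [Matrix.one_apply, eq_comm]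
  have hGe : ∀ {l : ℕ} (E : GL (Fin l) k) {d : ℕ}, d.bodd = false → (zigzag E).G d = 1 :=
    fun E d hd => by simp [zigzag, hpar hd]
  have hCe : ∀ {l : ℕ} (E : GL (Fin l) k) {d : ℕ}, d.bodd = false →
      (zigzag E).C d = E.val.transpose := fun E d hd => by simp [zigzag, hpar hd, transposeGL]
  have hGo : ∀ {l : ℕ} (E : GL (Fin l) k) {d : ℕ}, d.bodd = true →
      (zigzag E).G d = E⁻¹.val.transpose := fun E d hd => by
    simp only [zigzag, hpar' hd, if_false]; rfl
  have hCo : ∀ {l : ℕ} (E : GL (Fin l) k) {d : ℕ}, d.bodd = true → (zigzag E).C d = 1 :=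
    fun E d hd => by simp [zigzag, hpar' hd]
  have hsol : OperatorSolution (M := intertwiningFamilies P Q false)
      (N := intertwiningFamilies P Q true) E F u v := by
    constructor
    · intro i j x
      refine family_ext fun d hd => ?_
      have h := sum_stripHead_right x j i d
      rw [hCo F hd, hCo E hd, hone j i] at h
      simp only [hone, ite_smul, one_smul, zero_smul, Finset.sum_ite_eq', Finset.mem_univ,
        if_true] at h
      rw [hsum, Matrix.one_apply, Submodule.coe_smul, Pi.smul_apply, ite_smul, one_smul, zero_smul]
      exact h
    · intro a c x
      refine family_ext fun d hd => ?_
      have h := sum_stripHead_left x c a d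
      rw [hGe F hd, hGe E hd, hone c a] at h
      simp only [hone, ite_smul, one_smul, zero_smul, Finset.sum_ite_eq', Finset.mem_univ,
        if_true] at h
      rw [hsum, Matrix.one_apply, Submodule.coe_smul, Pi.smul_apply, ite_smul, one_smul, zero_smul]
      exact h
    · intro i j x
      refine family_ext fun d hd => ?_
      have h := sum_stripHead_right x j i d
      rw [hCe F hd, hCe E hd, Finset.sum_comm] at h
      simp only [hsum]
      exact h
    · intro a c x
      refine family_ext fun d hd => ?_
      have h := sum_stripHead_left x c a d
      rw [hGo F hd, hGo E hd, Finset.sum_comm] at h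
      simp only [hsum]
      exact h
  obtain ⟨B, _, _, U', V', hB, hsol'⟩ :=
    hsol.exists_rectSolution (by omega) (by omega)
  obtain ⟨f, -, -⟩ := h.exists_lift hsol'
  exact f.toRingHom.domain_nontrivial

end

/-! ### Coactions on tensor products, retracts and cofree comodules -/

open CategoryTheory MonoidalCategory

section

variable {k : Type u} [Field k]

namespace Comod

section Calculus

variable {A : Type u} [Ring A] [Bialgebra k A] (V : Comod k A)
  (X : Type u) [AddCommGroup X] [Module k X] {Y : Type u} [AddCommGroup Y] [Module k Y]

/-- The coaction of `V` on `V ⊗ X`, as a map `V ⊗ X → V ⊗ (A ⊗ X)`. -/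
def extCoact : V.carrier ⊗[k] X →ₗ[k] V.carrier ⊗[k] (A ⊗[k] X) :=
  (TensorProduct.assoc k V.carrier A X).toLinearMap ∘ₗ V.coact.rTensor X

variable {X}

theorem extCoact_tmul (v : V.carrier) (x : X) :
    V.extCoact X (v ⊗ₜ x) = TensorProduct.assoc k V.carrier A X (V.coact v ⊗ₜ x) := rfl

theorem extCoact_natural (f : X →ₗ[k] Y) (z : V.carrier ⊗[k] X) :
    V.extCoact Y (f.lTensor V.carrier z) = (f.lTensor A).lTensor V.carrier (V.extCoact X z) := by
  induction z with
  | zero => simp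
  | add x y hx hy => simp only [map_add, hx, hy]
  | tmul v x =>
    rw [LinearMap.lTensor_tmul, extCoact_tmul, extCoact_tmul]
    induction V.coact v with
    | zero => simp
    | add x y hx hy => simp only [TensorProduct.add_tmul, map_add, hx, hy]
    | tmul v a => simp

theorem extCoact_extCoact (z : V.carrier ⊗[k] X) :
    V.extCoact (A ⊗[k] X) (V.extCoact X z) =
      ((TensorProduct.assoc k A A X).toLinearMap ∘ₗ
        (Coalgebra.comul (R := k) (A := A)).rTensor X).lTensor V.carrier (V.extCoact X z) := by
  induction z with
  | zero => simp
  | add x y hx hy => simp only [map_add, hx, hy]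
  | tmul v x =>
    have h1 : ∀ s : V.carrier ⊗[k] A,
        V.extCoact (A ⊗[k] X) (TensorProduct.assoc k V.carrier A X (s ⊗ₜ x)) =
          (TensorProduct.assoc k A A X).toLinearMap.lTensor V.carrier
            (TensorProduct.assoc k V.carrier (A ⊗[k] A) X
              (TensorProduct.assoc k V.carrier A A (V.coact.rTensor A s) ⊗ₜ x)) := by
      intro s
      induction s with
      | zero => simp
      | add x y hx hy => simp only [TensorProduct.add_tmul, map_add, hx, hy]
      | tmul v a =>
        rw [TensorProduct.assoc_tmul, extCoact_tmul, LinearMap.rTensor_tmul]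
        induction V.coact v with
        | zero => simp
        | add x y hx hy => simp only [TensorProduct.add_tmul, map_add, hx, hy]
        | tmul v a => simp
    have h2 : ∀ s : V.carrier ⊗[k] A,
        TensorProduct.assoc k V.carrier (A ⊗[k] A) X
            ((Coalgebra.comul (R := k) (A := A)).lTensor V.carrier s ⊗ₜ x) =
          ((Coalgebra.comul (R := k) (A := A)).rTensor X).lTensor V.carrier
            (TensorProduct.assoc k V.carrier A X (s ⊗ₜ x)) := by
      intro s
      induction s with
      | zero => simp
      | add x y hx hy => simp only [TensorProduct.add_tmul, map_add, hx, hy]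
      | tmul v a => simp
    rw [extCoact_tmul, h1, coassoc_apply, h2, LinearMap.lTensor_comp, LinearMap.comp_apply]

theorem extCoact_map {W : Comod k A} (f : V ⟶ W) (z : V.carrier ⊗[k] X) :
    W.extCoact X (f.lin.rTensor X z) = f.lin.rTensor (A ⊗[k] X) (V.extCoact X z) := by
  induction z with
  | zero => simp
  | add x y hx hy => simp only [map_add, hx, hy]
  | tmul v x =>
    rw [LinearMap.rTensor_tmul, extCoact_tmul, extCoact_tmul, ← comm_apply]
    induction V.coact v with
    | zero => simp
    | add x y hx hy => simp only [TensorProduct.add_tmul, map_add, hx, hy]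
    | tmul v a => simp

end Calculus

section Retract

variable {B : Type u} [Ring B] [Bialgebra k B]

/-- A linear retract of a comodule, on which a compatible coaction is given, is a comodule. -/
def ofRetract (T : Comod k B) (N : ModuleCat.{u} k) (i : N →ₗ[k] T.carrier) (r : T.carrier →ₗ[k] N)
    (hr : r ∘ₗ i = LinearMap.id) (c : N →ₗ[k] N ⊗[k] B)
    (hc : i.rTensor B ∘ₗ c = T.coact ∘ₗ i) : Comod k B where
  carrier := N
  coact := c
  coassoc := by
    have hinj : Function.Injective (i.rTensor (B ⊗[k] B)) := by
      apply Function.LeftInverse.injective (g := r.rTensor (B ⊗[k] B))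
      intro x
      rw [← LinearMap.rTensor_comp_apply, hr, LinearMap.rTensor_id, LinearMap.id_apply]
    refine LinearMap.ext fun x => hinj ?_
    have h1 : ∀ y : N ⊗[k] B, i.rTensor (B ⊗[k] B) (TensorProduct.assoc k N B B
        (c.rTensor B y)) = TensorProduct.assoc k T.carrier B B
          (T.coact.rTensor B (i.rTensor B y)) := by
      intro y
      rw [← LinearMap.rTensor_comp_apply, ← hc, LinearMap.rTensor_comp_apply]
      induction c.rTensor B y with
      | zero => simp
      | add x y hx hy => simp only [map_add, hx, hy]
      | tmul s b =>
        induction s with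
        | zero => simp
        | add x y hx hy => simp only [TensorProduct.add_tmul, map_add, hx, hy]
        | tmul v a => simp
    have h2 : ∀ y : N ⊗[k] B, i.rTensor (B ⊗[k] B)
        ((Coalgebra.comul (R := k) (A := B)).lTensor N y) =
          (Coalgebra.comul (R := k) (A := B)).lTensor T.carrier (i.rTensor B y) := by
      intro y
      rw [← LinearMap.comp_apply, ← LinearMap.comp_apply, LinearMap.rTensor_comp_lTensor,
        LinearMap.lTensor_comp_rTensor]
    have h3 : i.rTensor B (c x) = T.coact (i x) := LinearMap.congr_fun hc x
    refine (h1 (c x)).trans (Eq.trans ?_ (h2 (c x)).symm)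
    rw [h3]
    exact coassoc_apply T (i x)
  counital := by
    have hinj : Function.Injective i :=
      Function.LeftInverse.injective (g := r) fun x => LinearMap.congr_fun hr x
    refine LinearMap.ext fun x => hinj ?_
    have h1 : ∀ y : N ⊗[k] B, i (TensorProduct.rid k N
        ((Coalgebra.counit (R := k) (A := B)).lTensor N y)) =
          TensorProduct.rid k T.carrier
            ((Coalgebra.counit (R := k) (A := B)).lTensor T.carrier (i.rTensor B y)) := by
      intro y
      induction y with
      | zero => simp
      | add x y hx hy => simp only [map_add, hx, hy]
      | tmul v a => simp
    have h3 : i.rTensor B (c x) = T.coact (i x) := LinearMap.congr_fun hc x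
    refine (h1 (c x)).trans ?_
    rw [h3]
    exact counital_apply T (i x)

/-- The comodule `V ⊗ P` for a vector space `V` and a comodule `P`. -/
def cofree (V : Type u) [AddCommGroup V] [Module k V] {P : Type u} [AddCommGroup P] [Module k P]
    (β : P →ₗ[k] P ⊗[k] B)
    (hcoassoc : ∀ p, TensorProduct.assoc k P B B (β.rTensor B (β p)) =
      (Coalgebra.comul (R := k) (A := B)).lTensor P (β p))
    (hcounit : ∀ p,
      TensorProduct.rid k P ((Coalgebra.counit (R := k) (A := B)).lTensor P (β p)) = p) :
    Comod k B where
  carrier := ModuleCat.of k (V ⊗[k] P)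
  coact := (TensorProduct.assoc k V P B).symm.toLinearMap ∘ₗ β.lTensor V
  coassoc := by
    refine TensorProduct.ext' fun v p => ?_
    have h1 : ∀ y : P ⊗[k] B,
        TensorProduct.assoc k (V ⊗[k] P) B B
          (((TensorProduct.assoc k V P B).symm.toLinearMap ∘ₗ β.lTensor V).rTensor B
            ((TensorProduct.assoc k V P B).symm (v ⊗ₜ y))) =
        (TensorProduct.assoc k V P (B ⊗[k] B)).symm
          (v ⊗ₜ TensorProduct.assoc k P B B (β.rTensor B y)) := by
      intro y
      induction y with
      | zero => simp
      | add x y hx hy => simp only [TensorProduct.tmul_add, map_add, hx, hy]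
      | tmul p b =>
        simp only [TensorProduct.assoc_symm_tmul, LinearMap.rTensor_tmul, LinearMap.comp_apply,
          LinearMap.lTensor_tmul, LinearEquiv.coe_coe]
        induction β p with
        | zero => simp
        | add x y hx hy =>
          simp only [TensorProduct.tmul_add, TensorProduct.add_tmul, map_add, hx, hy]
        | tmul p b => simp
    have h2 : ∀ y : P ⊗[k] B,
        (Coalgebra.comul (R := k) (A := B)).lTensor (V ⊗[k] P)
          ((TensorProduct.assoc k V P B).symm (v ⊗ₜ y)) =
        (TensorProduct.assoc k V P (B ⊗[k] B)).symm
          (v ⊗ₜ (Coalgebra.comul (R := k) (A := B)).lTensor P y) := by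
      intro y
      induction y with
      | zero => simp
      | add x y hx hy => simp only [TensorProduct.tmul_add, map_add, hx, hy]
      | tmul p b => simp
    refine (h1 (β p)).trans (Eq.trans ?_ (h2 (β p)).symm)
    rw [hcoassoc]
  counital := by
    refine TensorProduct.ext' fun v p => ?_
    have h1 : ∀ y : P ⊗[k] B, TensorProduct.rid k (V ⊗[k] P)
        ((Coalgebra.counit (R := k) (A := B)).lTensor (V ⊗[k] P)
          ((TensorProduct.assoc k V P B).symm (v ⊗ₜ y))) =
        v ⊗ₜ TensorProduct.rid k P ((Coalgebra.counit (R := k) (A := B)).lTensor P y) := by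
      intro y
      induction y with
      | zero => simp
      | add x y hx hy => simp only [TensorProduct.tmul_add, map_add, hx, hy]
      | tmul p b => simp
    refine (h1 (β p)).trans ?_
    rw [hcounit]
    rfl

end Retract

end Comod

end

/-! ### Bi-Galois data and the cotensor functor -/

/-- Two bialgebras `A`, `B` joined by algebras `P`, `Q` as in a connected cogroupoid with two
objects: `A = C(1,1)`, `P = C(1,2)`, `Q = C(2,1)`, `B = C(2,2)`, with its coassociative
comultiplications `C(x,y) → C(x,z) ⊗ C(z,y)`. Instead of antipodes there are functionals on `P ⊗ Q`
and `Q ⊗ P` that restrict to the counits. -/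
structure BiGalois (k : Type u) [Field k] (A B P Q : Type u) [Ring A] [Ring B] [Ring P] [Ring Q]
    [Bialgebra k A] [Bialgebra k B] [Algebra k P] [Algebra k Q] where
  left : P →ₐ[k] A ⊗[k] P
  right : P →ₐ[k] P ⊗[k] B
  left' : Q →ₐ[k] B ⊗[k] Q
  right' : Q →ₐ[k] Q ⊗[k] A
  split : A →ₐ[k] P ⊗[k] Q
  split' : B →ₐ[k] Q ⊗[k] P
  ev : P ⊗[k] Q →ₗ[k] k
  ev' : Q ⊗[k] P →ₗ[k] k
  ev_split : ∀ a, ev (split a) = Coalgebra.counit (R := k) a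
  ev_split' : ∀ b, ev' (split' b) = Coalgebra.counit (R := k) b
  right_coassoc : ∀ p, TensorProduct.assoc k P B B (right.toLinearMap.rTensor B (right p)) =
    (Coalgebra.comul (R := k) (A := B)).lTensor P (right p)
  right_coassoc' : ∀ q, TensorProduct.assoc k Q A A (right'.toLinearMap.rTensor A (right' q)) =
    (Coalgebra.comul (R := k) (A := A)).lTensor Q (right' q)
  right_counit : ∀ p, TensorProduct.rid k P
    ((Coalgebra.counit (R := k) (A := B)).lTensor P (right p)) = p
  right_counit' : ∀ q, TensorProduct.rid k Q
    ((Coalgebra.counit (R := k) (A := A)).lTensor Q (right' q)) = q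
  left_right : ∀ p, TensorProduct.assoc k A P B (left.toLinearMap.rTensor B (right p)) =
    right.toLinearMap.lTensor A (left p)
  left_right' : ∀ q, TensorProduct.assoc k B Q A (left'.toLinearMap.rTensor A (right' q)) =
    right'.toLinearMap.lTensor B (left' q)
  split_left : ∀ p, TensorProduct.assoc k P Q P (split.toLinearMap.rTensor P (left p)) =
    split'.toLinearMap.lTensor P (right p)
  split_left' : ∀ q, TensorProduct.assoc k Q P Q (split'.toLinearMap.rTensor Q (left' q)) =
    split.toLinearMap.lTensor Q (right' q)
  left_split : ∀ a, TensorProduct.assoc k A P Q (left.toLinearMap.rTensor Q (split a)) =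
    split.toLinearMap.lTensor A (Coalgebra.comul (R := k) a)
  left_split' : ∀ b, TensorProduct.assoc k B Q P (left'.toLinearMap.rTensor P (split' b)) =
    split'.toLinearMap.lTensor B (Coalgebra.comul (R := k) b)
  right_split : ∀ a, TensorProduct.assoc k P B Q (right.toLinearMap.rTensor Q (split a)) =
    left'.toLinearMap.lTensor P (split a)
  right_split' : ∀ b, TensorProduct.assoc k Q A P (right'.toLinearMap.rTensor P (split' b)) =
    left.toLinearMap.lTensor Q (split' b)
  split_right : ∀ a, TensorProduct.assoc k P Q A
    (split.toLinearMap.rTensor A (Coalgebra.comul (R := k) a)) =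
      right'.toLinearMap.lTensor P (split a)
  split_right' : ∀ b, TensorProduct.assoc k Q P B
    (split'.toLinearMap.rTensor B (Coalgebra.comul (R := k) b)) =
      right.toLinearMap.lTensor Q (split' b)

namespace BiGalois

variable {k : Type u} [Field k] {A B P Q : Type u} [Ring A] [Ring B] [Ring P] [Ring Q]
    [Bialgebra k A] [Bialgebra k B] [Algebra k P] [Algebra k Q]

/-- Exchanging the two objects. -/
def symm (D : BiGalois k A B P Q) : BiGalois k B A Q P where
  left := D.left'
  right := D.right'
  left' := D.left
  right' := D.right
  split := D.split'
  split' := D.split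
  ev := D.ev'
  ev' := D.ev
  ev_split := D.ev_split'
  ev_split' := D.ev_split
  right_coassoc := D.right_coassoc'
  right_coassoc' := D.right_coassoc
  right_counit := D.right_counit'
  right_counit' := D.right_counit
  left_right := D.left_right'
  left_right' := D.left_right
  split_left := D.split_left'
  split_left' := D.split_left
  left_split := D.left_split'
  left_split' := D.left_split
  right_split := D.right_split'
  right_split' := D.right_split
  split_right := D.split_right'
  split_right' := D.split_right

variable (D : BiGalois k A B P Q)

/-- The map `P ⊗ Q → P`, `p' ⊗ q ↦ ev' (q ⊗ p) p'`. -/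
def contract (p : P) : P ⊗[k] Q →ₗ[k] P :=
  (TensorProduct.rid k P).toLinearMap ∘ₗ D.ev'.lTensor P ∘ₗ
    (TensorProduct.assoc k P Q P).toLinearMap ∘ₗ (TensorProduct.mk k (P ⊗[k] Q) P).flip p

theorem contract_tmul (p p' : P) (q : Q) : D.contract p (p' ⊗ₜ q) = D.ev' (q ⊗ₜ p) • p' := by
  simp [contract]

/-- The retraction `A ⊗ P → P` of the left coaction, `a ⊗ p ↦ a₁ ev' (a₂ ⊗ p)`. -/
def ret : A ⊗[k] P →ₗ[k] P :=
  (TensorProduct.rid k P).toLinearMap ∘ₗ D.ev'.lTensor P ∘ₗ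
    (TensorProduct.assoc k P Q P).toLinearMap ∘ₗ D.split.toLinearMap.rTensor P

theorem ret_tmul (a : A) (p : P) : D.ret (a ⊗ₜ p) = D.contract p (D.split a) := rfl

theorem ret_left (p : P) : D.ret (D.left p) = p := by
  have h : D.ev' ∘ₗ D.split'.toLinearMap = Coalgebra.counit (R := k) (A := B) :=
    LinearMap.ext D.ev_split'
  simp only [ret, LinearMap.comp_apply, LinearEquiv.coe_coe]
  rw [D.split_left, ← LinearMap.lTensor_comp_apply, h, D.right_counit]

theorem left_contract (p : P) (y : P ⊗[k] Q) :
    D.left (D.contract p y) = (D.contract p).lTensor A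
      (TensorProduct.assoc k A P Q (D.left.toLinearMap.rTensor Q y)) := by
  induction y with
  | zero => simp
  | add x y hx hy => simp only [map_add, hx, hy]
  | tmul p' q =>
    rw [contract_tmul, map_smul, LinearMap.rTensor_tmul, AlgHom.toLinearMap_apply]
    induction D.left p' with
    | zero => simp
    | add x y hx hy => simp only [TensorProduct.add_tmul, map_add, smul_add, hx, hy]
    | tmul a p'' => simp [contract_tmul]

theorem left_ret (z : A ⊗[k] P) :
    D.left (D.ret z) = D.ret.lTensor A (TensorProduct.assoc k A A P
      ((Coalgebra.comul (R := k) (A := A)).rTensor P z)) := by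
  induction z with
  | zero => simp
  | add x y hx hy => simp only [map_add, hx, hy]
  | tmul a p =>
    have h : ∀ t : A ⊗[k] A, D.ret.lTensor A (TensorProduct.assoc k A A P (t ⊗ₜ p)) =
        (D.contract p).lTensor A (D.split.toLinearMap.lTensor A t) := by
      intro t
      induction t with
      | zero => simp
      | add x y hx hy => simp only [TensorProduct.add_tmul, map_add, hx, hy]
      | tmul a b => simp [ret_tmul]
    rw [ret_tmul, left_contract, D.left_split, LinearMap.rTensor_tmul, h]

section Cotensor

variable (V : Comod k A)

/-- The cotensor product `V □ P`, a subspace of `V ⊗ P`. -/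
def cotensor : Submodule k (V.carrier ⊗[k] P) :=
  LinearMap.eqLocus (V.extCoact P) (D.left.toLinearMap.lTensor V.carrier)

theorem mem_cotensor {z : V.carrier ⊗[k] P} :
    z ∈ D.cotensor V ↔ V.extCoact P z = D.left.toLinearMap.lTensor V.carrier z := Iff.rfl

/-- The projection `v ⊗ p ↦ v₀ ⊗ ret (v₁ ⊗ p)` of `V ⊗ P` onto the cotensor product. -/
def proj : V.carrier ⊗[k] P →ₗ[k] V.carrier ⊗[k] P :=
  D.ret.lTensor V.carrier ∘ₗ V.extCoact P

theorem proj_mem (z : V.carrier ⊗[k] P) : D.proj V z ∈ D.cotensor V := by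
  have h : D.left.toLinearMap ∘ₗ D.ret = D.ret.lTensor A ∘ₗ
      (TensorProduct.assoc k A A P).toLinearMap ∘ₗ (Coalgebra.comul (R := k) (A := A)).rTensor P :=
    LinearMap.ext D.left_ret
  rw [mem_cotensor, proj, LinearMap.comp_apply, V.extCoact_natural, V.extCoact_extCoact,
    ← LinearMap.lTensor_comp_apply, ← LinearMap.lTensor_comp_apply, h]

theorem proj_eq_self {z : V.carrier ⊗[k] P} (hz : z ∈ D.cotensor V) : D.proj V z = z := by
  have h : D.ret ∘ₗ D.left.toLinearMap = LinearMap.id := LinearMap.ext D.ret_left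
  rw [proj, LinearMap.comp_apply, (D.mem_cotensor V).1 hz, ← LinearMap.lTensor_comp_apply, h,
    LinearMap.lTensor_id, LinearMap.id_apply]

/-- The projection onto the cotensor product. -/
def toCotensor : V.carrier ⊗[k] P →ₗ[k] D.cotensor V :=
  (D.proj V).codRestrict _ (D.proj_mem V)

theorem toCotensor_comp_subtype : D.toCotensor V ∘ₗ (D.cotensor V).subtype = LinearMap.id :=
  LinearMap.ext fun z => Subtype.ext (D.proj_eq_self V z.2)

variable (X : Type u) [AddCommGroup X] [Module k X]

/-- The inclusion `(V □ P) ⊗ X → V ⊗ (P ⊗ X)`. -/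
def incl : D.cotensor V ⊗[k] X →ₗ[k] V.carrier ⊗[k] (P ⊗[k] X) :=
  (TensorProduct.assoc k V.carrier P X).toLinearMap ∘ₗ (D.cotensor V).subtype.rTensor X

/-- The projection `V ⊗ (P ⊗ X) → (V □ P) ⊗ X`. -/
def inclRet : V.carrier ⊗[k] (P ⊗[k] X) →ₗ[k] D.cotensor V ⊗[k] X :=
  (D.toCotensor V).rTensor X ∘ₗ (TensorProduct.assoc k V.carrier P X).symm.toLinearMap

variable {X}

theorem incl_tmul (z : D.cotensor V) (x : X) :
    D.incl V X (z ⊗ₜ x) = TensorProduct.assoc k V.carrier P X (z.1 ⊗ₜ x) := rfl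

theorem inclRet_incl (z : D.cotensor V ⊗[k] X) : D.inclRet V X (D.incl V X z) = z := by
  simp only [incl, inclRet, LinearMap.comp_apply, LinearEquiv.coe_coe,
    LinearEquiv.symm_apply_apply]
  rw [← LinearMap.rTensor_comp_apply, toCotensor_comp_subtype, LinearMap.rTensor_id,
    LinearMap.id_apply]

theorem incl_injective : Function.Injective (D.incl V X) :=
  Function.LeftInverse.injective (D.inclRet_incl V)

theorem extCoact_incl (z : D.cotensor V ⊗[k] X) :
    V.extCoact (P ⊗[k] X) (D.incl V X z) =
      ((TensorProduct.assoc k A P X).toLinearMap ∘ₗ D.left.toLinearMap.rTensor X).lTensor V.carrier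
        (D.incl V X z) := by
  induction z with
  | zero => simp
  | add x y hx hy => simp only [map_add, hx, hy]
  | tmul z x =>
    rw [incl_tmul]
    have h1 : ∀ y : V.carrier ⊗[k] P,
        V.extCoact (P ⊗[k] X) (TensorProduct.assoc k V.carrier P X (y ⊗ₜ x)) =
          (TensorProduct.assoc k A P X).toLinearMap.lTensor V.carrier
            (TensorProduct.assoc k V.carrier (A ⊗[k] P) X (V.extCoact P y ⊗ₜ x)) := by
      intro y
      induction y with
      | zero => simp
      | add x y hx hy => simp only [TensorProduct.add_tmul, map_add, hx, hy]
      | tmul v p =>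
        rw [TensorProduct.assoc_tmul, Comod.extCoact_tmul, Comod.extCoact_tmul]
        induction V.coact v with
        | zero => simp
        | add x y hx hy => simp only [TensorProduct.add_tmul, map_add, hx, hy]
        | tmul v a => simp
    have h2 : ∀ y : V.carrier ⊗[k] P,
        TensorProduct.assoc k V.carrier (A ⊗[k] P) X
          (D.left.toLinearMap.lTensor V.carrier y ⊗ₜ x) =
        (D.left.toLinearMap.rTensor X).lTensor V.carrier
          (TensorProduct.assoc k V.carrier P X (y ⊗ₜ x)) := by
      intro y
      induction y with
      | zero => simp
      | add x y hx hy => simp only [TensorProduct.add_tmul, map_add, hx, hy]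
      | tmul v p => simp
    rw [h1, (D.mem_cotensor V).1 z.2, h2, LinearMap.lTensor_comp_apply]

/-- The image of `incl` consists of the elements on which the coaction of `V` and that of `P`
agree. -/
theorem incl_inclRet {y : V.carrier ⊗[k] (P ⊗[k] X)}
    (hy : V.extCoact (P ⊗[k] X) y =
      ((TensorProduct.assoc k A P X).toLinearMap ∘ₗ D.left.toLinearMap.rTensor X).lTensor V.carrier
        y) : D.incl V X (D.inclRet V X y) = y := by
  have h1 : ∀ y : V.carrier ⊗[k] (P ⊗[k] X), D.incl V X (D.inclRet V X y) =
      (D.ret.rTensor X ∘ₗ (TensorProduct.assoc k A P X).symm.toLinearMap).lTensor V.carrier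
        (V.extCoact (P ⊗[k] X) y) := by
    intro y
    obtain ⟨y, rfl⟩ := (TensorProduct.assoc k V.carrier P X).surjective y
    simp only [incl, inclRet, LinearMap.comp_apply, LinearEquiv.coe_coe,
      LinearEquiv.symm_apply_apply]
    rw [← LinearMap.rTensor_comp_apply]
    have h2 : (D.cotensor V).subtype ∘ₗ D.toCotensor V = D.proj V := rfl
    rw [h2]
    induction y with
    | zero => simp
    | add x y hx hy => simp only [map_add, hx, hy]
    | tmul z x =>
      induction z with
      | zero => simp
      | add x y hx hy => simp only [TensorProduct.add_tmul, map_add, hx, hy]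
      | tmul v p =>
        rw [LinearMap.rTensor_tmul, proj, LinearMap.comp_apply, TensorProduct.assoc_tmul,
          Comod.extCoact_tmul, Comod.extCoact_tmul]
        induction V.coact v with
        | zero => simp
        | add x y hx hy => simp only [TensorProduct.add_tmul, map_add, hx, hy]
        | tmul v a => simp
  have h3 : (D.ret.rTensor X ∘ₗ (TensorProduct.assoc k A P X).symm.toLinearMap) ∘ₗ
      ((TensorProduct.assoc k A P X).toLinearMap ∘ₗ D.left.toLinearMap.rTensor X) =
        LinearMap.id := by
    have h : D.ret ∘ₗ D.left.toLinearMap = LinearMap.id := LinearMap.ext D.ret_left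
    refine LinearMap.ext fun z => ?_
    simp only [LinearMap.comp_apply, LinearEquiv.coe_coe, LinearEquiv.symm_apply_apply]
    rw [← LinearMap.rTensor_comp_apply, h, LinearMap.rTensor_id]
  rw [h1, hy, ← LinearMap.lTensor_comp_apply, h3, LinearMap.lTensor_id, LinearMap.id_apply]

end Cotensor

section Functor

variable (V : Comod k A)

/-- The coaction of `B` on `V □ P`. -/
def cotensorCoact : D.cotensor V →ₗ[k] D.cotensor V ⊗[k] B :=
  D.inclRet V B ∘ₗ D.right.toLinearMap.lTensor V.carrier ∘ₗ (D.cotensor V).subtype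

theorem incl_cotensorCoact (z : D.cotensor V) :
    D.incl V B (D.cotensorCoact V z) = D.right.toLinearMap.lTensor V.carrier z.1 := by
  refine D.incl_inclRet V ?_
  have h : D.right.toLinearMap.lTensor A ∘ₗ D.left.toLinearMap =
      ((TensorProduct.assoc k A P B).toLinearMap ∘ₗ D.left.toLinearMap.rTensor B) ∘ₗ
        D.right.toLinearMap := LinearMap.ext fun p => (D.left_right p).symm
  change V.extCoact (P ⊗[k] B) (D.right.toLinearMap.lTensor V.carrier z.1) =
    LinearMap.lTensor _ _ (D.right.toLinearMap.lTensor V.carrier z.1)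
  rw [V.extCoact_natural, (D.mem_cotensor V).1 z.2, ← LinearMap.lTensor_comp_apply, h,
    LinearMap.lTensor_comp_apply]

/-- The `B`-comodule `V □ P`. -/
def obj : Comod k B :=
  Comod.ofRetract (Comod.cofree V.carrier D.right.toLinearMap D.right_coassoc D.right_counit)
    (ModuleCat.of k (D.cotensor V)) (D.cotensor V).subtype (D.toCotensor V)
    (D.toCotensor_comp_subtype V) (D.cotensorCoact V) (by
      refine LinearMap.ext fun z => (TensorProduct.assoc k V.carrier P B).injective ?_
      refine (D.incl_cotensorCoact V z).trans ?_
      exact ((TensorProduct.assoc k V.carrier P B).apply_symm_apply _).symm)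

variable {V} {W : Comod k A}

theorem rTensor_mem_cotensor (f : V ⟶ W) {z : V.carrier ⊗[k] P} (hz : z ∈ D.cotensor V) :
    f.lin.rTensor P z ∈ D.cotensor W := by
  rw [mem_cotensor, Comod.extCoact_map, (D.mem_cotensor V).1 hz, ← LinearMap.comp_apply,
    ← LinearMap.comp_apply, LinearMap.rTensor_comp_lTensor, LinearMap.lTensor_comp_rTensor]

/-- `f □ P` as a linear map. -/
def mapLin (f : V ⟶ W) : D.cotensor V →ₗ[k] D.cotensor W :=
  (f.lin.rTensor P).restrict fun _ hz => D.rTensor_mem_cotensor f hz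

theorem incl_mapLin (f : V ⟶ W) {X : Type u} [AddCommGroup X] [Module k X]
    (y : D.cotensor V ⊗[k] X) : D.incl W X ((D.mapLin f).rTensor X y) =
      f.lin.rTensor (P ⊗[k] X) (D.incl V X y) := by
  induction y with
  | zero => simp
  | add x y hx hy => simp only [map_add, hx, hy]
  | tmul z x =>
    rw [LinearMap.rTensor_tmul, incl_tmul, incl_tmul]
    change TensorProduct.assoc k _ P X (f.lin.rTensor P z.1 ⊗ₜ x) = _
    induction z.1 with
    | zero => simp
    | add x y hx hy => simp only [TensorProduct.add_tmul, map_add, hx, hy]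
    | tmul v p => simp

theorem mapLin_comm (f : V ⟶ W) :
    (D.mapLin f).rTensor B ∘ₗ D.cotensorCoact V = D.cotensorCoact W ∘ₗ D.mapLin f := by
  refine LinearMap.ext fun z => D.incl_injective W ?_
  rw [LinearMap.comp_apply, incl_mapLin, incl_cotensorCoact, LinearMap.comp_apply,
    incl_cotensorCoact]
  change _ = D.right.toLinearMap.lTensor W.carrier (f.lin.rTensor P z.1)
  rw [← LinearMap.comp_apply, ← LinearMap.comp_apply, LinearMap.rTensor_comp_lTensor,
    LinearMap.lTensor_comp_rTensor]

/-- The functor `V ↦ V □ P`. -/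
def functor : Comod k A ⥤ Comod k B where
  obj V := D.obj V
  map f := ⟨D.mapLin f, D.mapLin_comm f⟩
  map_id V := by
    ext1
    refine LinearMap.ext fun z => Subtype.ext ?_
    change (LinearMap.id).rTensor P z.1 = z.1
    rw [LinearMap.rTensor_id, LinearMap.id_apply]
  map_comp f g := by
    ext1
    refine LinearMap.ext fun z => Subtype.ext ?_
    exact LinearMap.rTensor_comp_apply P g.lin f.lin z.1

instance : D.functor.Additive where
  map_add {V W f g} := by
    ext1
    refine LinearMap.ext fun z => Subtype.ext ?_
    exact LinearMap.congr_fun (LinearMap.rTensor_add P f.lin g.lin) z.1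

instance : D.functor.Linear k where
  map_smul f c := by
    ext1
    refine LinearMap.ext fun z => Subtype.ext ?_
    exact LinearMap.congr_fun (LinearMap.rTensor_smul P c f.lin) z.1

end Functor

end BiGalois

/-! ### The cotensor functor is an equivalence -/

namespace BiGalois

variable {k : Type u} [Field k] {A B P Q : Type u} [Ring A] [Ring B] [Ring P] [Ring Q]
    [Bialgebra k A] [Bialgebra k B] [Algebra k P] [Algebra k Q] (D : BiGalois k A B P Q)

section Unit

variable (V : Comod k A)

theorem incl_lTensor {X Y : Type u} [AddCommGroup X] [Module k X] [AddCommGroup Y] [Module k Y]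
    (f : X →ₗ[k] Y) (y : D.cotensor V ⊗[k] X) :
    D.incl V Y (f.lTensor (D.cotensor V) y) =
      (f.lTensor P).lTensor V.carrier (D.incl V X y) := by
  induction y with
  | zero => simp
  | add x y hx hy => simp only [map_add, hx, hy]
  | tmul z x =>
    rw [LinearMap.lTensor_tmul, incl_tmul, incl_tmul]
    induction z.1 with
    | zero => simp
    | add x y hx hy => simp only [TensorProduct.add_tmul, map_add, hx, hy]
    | tmul v p => simp

theorem incl_assoc {X Y : Type u} [AddCommGroup X] [Module k X] [AddCommGroup Y] [Module k Y]
    (y : D.cotensor V ⊗[k] X) (x : Y) :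
    D.incl V (X ⊗[k] Y) (TensorProduct.assoc k (D.cotensor V) X Y (y ⊗ₜ x)) =
      (TensorProduct.assoc k P X Y).toLinearMap.lTensor V.carrier
        (TensorProduct.assoc k V.carrier (P ⊗[k] X) Y (D.incl V X y ⊗ₜ x)) := by
  induction y with
  | zero => simp
  | add x y hx hy => simp only [TensorProduct.add_tmul, map_add, hx, hy]
  | tmul z x =>
    rw [TensorProduct.assoc_tmul, incl_tmul, incl_tmul]
    induction z.1 with
    | zero => simp
    | add x y hx hy => simp only [TensorProduct.add_tmul, map_add, hx, hy]
    | tmul v p => simp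

theorem incl_extCoact {X : Type u} [AddCommGroup X] [Module k X] (y : D.cotensor V ⊗[k] X) :
    D.incl V (B ⊗[k] X) ((D.obj V).extCoact X y) =
      ((TensorProduct.assoc k P B X).toLinearMap ∘ₗ
        D.right.toLinearMap.rTensor X).lTensor V.carrier (D.incl V X y) := by
  have h : D.incl V (B ⊗[k] X) ∘ₗ ((TensorProduct.assoc k (D.cotensor V) B X).toLinearMap ∘ₗ
      (D.cotensorCoact V).rTensor X) = ((TensorProduct.assoc k P B X).toLinearMap ∘ₗ
        D.right.toLinearMap.rTensor X).lTensor V.carrier ∘ₗ D.incl V X := by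
    refine TensorProduct.ext' fun z x => ?_
    refine (D.incl_assoc V (D.cotensorCoact V z) x).trans ?_
    rw [incl_cotensorCoact, LinearMap.comp_apply, incl_tmul]
    induction z.1 with
    | zero => simp
    | add x y hx hy => simp only [TensorProduct.add_tmul, map_add, hx, hy]
    | tmul v p => simp
  exact LinearMap.congr_fun h y

/-- The map `v ↦ v₀ ⊗ split v₁` from `V` to `(V □ P) ⊗ Q`. -/
def coev : V.carrier →ₗ[k] D.cotensor V ⊗[k] Q :=
  D.inclRet V Q ∘ₗ D.split.toLinearMap.lTensor V.carrier ∘ₗ V.coact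

theorem incl_coev (v : V.carrier) :
    D.incl V Q (D.coev V v) = D.split.toLinearMap.lTensor V.carrier (V.coact v) := by
  refine D.incl_inclRet V ?_
  have h : D.split.toLinearMap.lTensor A ∘ₗ Coalgebra.comul (R := k) (A := A) =
      ((TensorProduct.assoc k A P Q).toLinearMap ∘ₗ D.left.toLinearMap.rTensor Q) ∘ₗ
        D.split.toLinearMap := LinearMap.ext fun a => (D.left_split a).symm
  have h' : V.extCoact A (V.coact v) =
      (Coalgebra.comul (R := k) (A := A)).lTensor V.carrier (V.coact v) :=
    Comod.coassoc_apply V v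
  rw [LinearMap.comp_apply, V.extCoact_natural, h', ← LinearMap.lTensor_comp_apply, h,
    LinearMap.lTensor_comp_apply]

theorem coev_mem (v : V.carrier) : D.coev V v ∈ D.symm.cotensor (D.obj V) := by
  refine (mem_cotensor _ _).2 (D.incl_injective V ?_)
  have h : ((TensorProduct.assoc k P B Q).toLinearMap ∘ₗ D.right.toLinearMap.rTensor Q) ∘ₗ
      D.split.toLinearMap = D.left'.toLinearMap.lTensor P ∘ₗ D.split.toLinearMap :=
    LinearMap.ext D.right_split
  refine (D.incl_extCoact V (D.coev V v)).trans (Eq.trans ?_ (D.incl_lTensor V _ _).symm)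
  rw [incl_coev, ← LinearMap.lTensor_comp_apply, h, LinearMap.lTensor_comp_apply]
  rfl

/-- The inverse of the unit, `v ⊗ p ⊗ q ↦ ev (p ⊗ q) v`. -/
def unitInv : D.symm.cotensor (D.obj V) →ₗ[k] V.carrier :=
  (TensorProduct.rid k V.carrier).toLinearMap ∘ₗ D.ev.lTensor V.carrier ∘ₗ
    D.incl V Q ∘ₗ (D.symm.cotensor (D.obj V)).subtype

theorem unitInv_apply (x : D.symm.cotensor (D.obj V)) : D.unitInv V x =
    TensorProduct.rid k V.carrier (D.ev.lTensor V.carrier (D.incl V Q x.1)) := rfl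

theorem unitInv_coev (v : V.carrier) : D.unitInv V ⟨D.coev V v, D.coev_mem V v⟩ = v := by
  have h : D.ev ∘ₗ D.split.toLinearMap = Coalgebra.counit (R := k) (A := A) :=
    LinearMap.ext D.ev_split
  rw [unitInv_apply, incl_coev, ← LinearMap.lTensor_comp_apply, h]
  exact Comod.counital_apply V v

/-- Both sides agree after `incl`: `split_left` turns `split` of the coaction into `split'`, and the
cotensor condition over `B` turns the result into `ret_left` for `Q`. -/
theorem coev_unitInv (x : D.symm.cotensor (D.obj V)) : D.coev V (D.unitInv V x) = x.1 := by
  apply D.incl_injective V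
  rw [incl_coev, unitInv_apply]
  set y := D.incl V Q x.1 with hy
  have h1 : V.extCoact (P ⊗[k] Q) y = ((TensorProduct.assoc k A P Q).toLinearMap ∘ₗ
      D.left.toLinearMap.rTensor Q).lTensor V.carrier y := D.extCoact_incl V x.1
  have h2 : ((TensorProduct.assoc k P B Q).toLinearMap ∘ₗ
        D.right.toLinearMap.rTensor Q).lTensor V.carrier y =
      (D.left'.toLinearMap.lTensor P).lTensor V.carrier y := by
    have hx : (D.obj V).extCoact Q x.1 = D.left'.toLinearMap.lTensor (D.cotensor V) x.1 := x.2
    exact (D.incl_extCoact V x.1).symm.trans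
      ((congrArg (D.incl V (B ⊗[k] Q)) hx).trans (D.incl_lTensor V _ x.1))
  let K : A ⊗[k] (P ⊗[k] Q) →ₗ[k] P ⊗[k] Q :=
    (TensorProduct.rid k (P ⊗[k] Q)).toLinearMap ∘ₗ TensorProduct.map D.split.toLinearMap D.ev
  have h3 : D.split.toLinearMap.lTensor V.carrier
      (V.coact (TensorProduct.rid k V.carrier (D.ev.lTensor V.carrier y))) =
        K.lTensor V.carrier (V.extCoact (P ⊗[k] Q) y) := by
    clear_value y
    clear h1 h2 hy
    induction y with
    | zero => simp
    | add x y hx hy => simp only [map_add, hx, hy]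
    | tmul v z =>
      rw [Comod.extCoact_tmul, LinearMap.lTensor_tmul, TensorProduct.rid_tmul, map_smul]
      induction V.coact v with
      | zero => simp
      | add x y hx hy => simp only [TensorProduct.add_tmul, map_add, smul_add, hx, hy]
      | tmul v a => simp [K]
  have h4 : K ∘ₗ ((TensorProduct.assoc k A P Q).toLinearMap ∘ₗ D.left.toLinearMap.rTensor Q) =
      D.symm.ret.lTensor P ∘ₗ
        ((TensorProduct.assoc k P B Q).toLinearMap ∘ₗ D.right.toLinearMap.rTensor Q) := by
    refine TensorProduct.ext' fun p q => ?_
    let ψ : P ⊗[k] (Q ⊗[k] P) →ₗ[k] P ⊗[k] Q :=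
      (D.symm.contract q).lTensor P
    have h5 : ∀ t : A ⊗[k] P, K (TensorProduct.assoc k A P Q (t ⊗ₜ q)) =
        ψ (TensorProduct.assoc k P Q P (D.split.toLinearMap.rTensor P t)) := by
      intro t
      induction t with
      | zero => simp
      | add x y hx hy => simp only [TensorProduct.add_tmul, map_add, hx, hy]
      | tmul a p =>
        simp only [TensorProduct.assoc_tmul, LinearMap.rTensor_tmul, K, LinearMap.comp_apply,
          TensorProduct.map_tmul, AlgHom.toLinearMap_apply, LinearEquiv.coe_coe,
          TensorProduct.rid_tmul]
        induction D.split a with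
        | zero => simp
        | add x y hx hy => simp only [TensorProduct.add_tmul, map_add, smul_add, hx, hy]
        | tmul p' q' =>
          simp [ψ, contract_tmul, symm]
    have h6 : ∀ t : P ⊗[k] B, D.symm.ret.lTensor P (TensorProduct.assoc k P B Q (t ⊗ₜ q)) =
        ψ (D.split'.toLinearMap.lTensor P t) := by
      intro t
      induction t with
      | zero => simp
      | add x y hx hy => simp only [TensorProduct.add_tmul, map_add, hx, hy]
      | tmul p b =>
        simp [ψ, ret_tmul, symm]
    exact (h5 (D.left p)).trans ((congrArg ψ (D.split_left p)).trans (h6 (D.right p)).symm)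
  have h7 : D.symm.ret ∘ₗ D.left'.toLinearMap = LinearMap.id := LinearMap.ext D.symm.ret_left
  rw [h3, h1, ← LinearMap.lTensor_comp_apply, h4, LinearMap.lTensor_comp_apply, h2,
    ← LinearMap.lTensor_comp_apply, ← LinearMap.lTensor_comp, h7]
  simp

/-- The unit `V ≃ (V □ P) □ Q`. -/
def unitEquiv : V.carrier ≃ₗ[k] D.symm.cotensor (D.obj V) :=
  LinearEquiv.ofLinearMap ((D.coev V).codRestrict _ (D.coev_mem V)) (D.unitInv V)
    (LinearMap.ext fun x => Subtype.ext (D.coev_unitInv V x))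
    (LinearMap.ext fun v => D.unitInv_coev V v)

theorem unitEquiv_comm : (D.unitEquiv V).toLinearMap.rTensor A ∘ₗ V.coact =
    (D.symm.obj (D.obj V)).coact ∘ₗ (D.unitEquiv V).toLinearMap := by
  refine LinearMap.ext fun v => D.symm.incl_injective (D.obj V) (D.incl_injective V ?_)
  have h1 : ∀ s : V.carrier ⊗[k] A, D.incl V (Q ⊗[k] A) (D.symm.incl (D.obj V) A
      ((D.unitEquiv V).toLinearMap.rTensor A s)) =
        ((TensorProduct.assoc k P Q A).toLinearMap ∘ₗ
          D.split.toLinearMap.rTensor A).lTensor V.carrier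
            (TensorProduct.assoc k V.carrier A A (V.coact.rTensor A s)) := by
    intro s
    induction s with
    | zero => simp only [map_zero]; exact map_zero _
    | add x y hx hy =>
      rw [map_add, map_add, map_add, map_add]
      refine (map_add _ _ _).trans ?_
      rw [map_add]
      exact congrArg₂ (· + ·) hx hy
    | tmul v a =>
      refine (D.incl_assoc V (D.coev V v) a).trans ?_
      rw [incl_coev, LinearMap.rTensor_tmul]
      induction V.coact v with
      | zero => simp
      | add x y hx hy => simp only [TensorProduct.add_tmul, map_add, hx, hy]
      | tmul v a => simp
  have h2 : ((TensorProduct.assoc k P Q A).toLinearMap ∘ₗ D.split.toLinearMap.rTensor A) ∘ₗ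
      Coalgebra.comul (R := k) (A := A) = D.right'.toLinearMap.lTensor P ∘ₗ D.split.toLinearMap :=
    LinearMap.ext D.split_right
  refine (h1 (V.coact v)).trans ?_
  rw [Comod.coassoc_apply, ← LinearMap.lTensor_comp_apply, h2, LinearMap.lTensor_comp_apply,
    ← incl_coev]
  refine (D.incl_lTensor V _ _).symm.trans (congrArg (D.incl V (Q ⊗[k] A)) ?_)
  exact (D.symm.incl_cotensorCoact (D.obj V) (D.unitEquiv V v)).symm

/-- The natural isomorphism `V ≅ (V □ P) □ Q`. -/
def unitIso : 𝟭 (Comod k A) ≅ D.functor ⋙ D.symm.functor :=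
  NatIso.ofComponents (fun V => Comod.isoOfEquiv (V := V) (W := D.symm.obj (D.obj V))
      (D.unitEquiv V) (D.unitEquiv_comm V)) fun {V W} f => by
    ext1
    refine LinearMap.ext fun v => Subtype.ext (D.incl_injective W ?_)
    change D.incl W Q (D.coev W (f.lin v)) = D.incl W Q ((D.mapLin f).rTensor Q (D.coev V v))
    have h : ∀ s, D.split.toLinearMap.lTensor W.carrier (f.lin.rTensor A s) =
        f.lin.rTensor (P ⊗[k] Q) (D.split.toLinearMap.lTensor V.carrier s) := fun s => by
      rw [← LinearMap.comp_apply, ← LinearMap.comp_apply, LinearMap.rTensor_comp_lTensor,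
        LinearMap.lTensor_comp_rTensor]
    rw [incl_mapLin, incl_coev, incl_coev, ← Comod.comm_apply, h]

/-- Cotensoring with `P` and with `Q` are inverse equivalences. -/
def equivalence : Comod k A ≌ Comod k B :=
  CategoryTheory.Equivalence.mk D.functor D.symm.functor D.unitIso D.symm.unitIso.symm

end Unit

end BiGalois

/-! ### The cotensor functor is monoidal -/

section

variable {k : Type u} [Field k]

section Merge

variable (k) (R : Type u) [Ring R] [Algebra k R] (V W : Type u)
    [AddCommGroup V] [AddCommGroup W] [Module k V] [Module k W]

/-- The map `(V ⊗ R) ⊗ (W ⊗ R) → (V ⊗ W) ⊗ R`, `(v ⊗ a) ⊗ (w ⊗ b) ↦ (v ⊗ w) ⊗ ab`, for an algebra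
`R`. -/
def mergeAlg : (V ⊗[k] R) ⊗[k] (W ⊗[k] R) →ₗ[k] (V ⊗[k] W) ⊗[k] R :=
  (LinearMap.mul' k R).lTensor (V ⊗[k] W) ∘ₗ
    (TensorProduct.tensorTensorTensorComm k V R W R).toLinearMap

variable {k R V W}

@[simp] theorem mergeAlg_tmul (v : V) (w : W) (a b : R) :
    mergeAlg k R V W ((v ⊗ₜ a) ⊗ₜ (w ⊗ₜ b)) = (v ⊗ₜ w) ⊗ₜ (a * b) := by
  simp [mergeAlg]

theorem mergeAlg_map {S : Type u} [Ring S] [Algebra k S] (f : R →ₐ[k] S) (x : V ⊗[k] R)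
    (y : W ⊗[k] R) :
    f.toLinearMap.lTensor (V ⊗[k] W) (mergeAlg k R V W (x ⊗ₜ y)) =
      mergeAlg k S V W (f.toLinearMap.lTensor V x ⊗ₜ f.toLinearMap.lTensor W y) := by
  induction x with
  | zero => simp
  | add x x' hx hx' => simp only [TensorProduct.add_tmul, map_add, hx, hx']
  | tmul v a =>
    induction y with
    | zero => simp
    | add y y' hy hy' => simp only [TensorProduct.tmul_add, map_add, hy, hy']
    | tmul w b => simp

theorem mergeAlg_natural {V' W' : Type u} [AddCommGroup V'] [AddCommGroup W'] [Module k V']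
    [Module k W'] (f : V →ₗ[k] V') (g : W →ₗ[k] W') (x : V ⊗[k] R) (y : W ⊗[k] R) :
    (TensorProduct.map f g).rTensor R (mergeAlg k R V W (x ⊗ₜ y)) =
      mergeAlg k R V' W' (f.rTensor R x ⊗ₜ g.rTensor R y) := by
  induction x with
  | zero => simp
  | add x x' hx hx' => simp only [TensorProduct.add_tmul, map_add, hx, hx']
  | tmul v a =>
    induction y with
    | zero => simp
    | add y y' hy hy' => simp only [TensorProduct.tmul_add, map_add, hy, hy']
    | tmul w b => simp

theorem mergeAlg_assoc {X : Type u} [AddCommGroup X] [Module k X] (x : V ⊗[k] R) (y : W ⊗[k] R)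
    (z : X ⊗[k] R) :
    (TensorProduct.assoc k V W X).toLinearMap.rTensor R
      (mergeAlg k R (V ⊗[k] W) X (mergeAlg k R V W (x ⊗ₜ y) ⊗ₜ z)) =
    mergeAlg k R V (W ⊗[k] X) (x ⊗ₜ mergeAlg k R W X (y ⊗ₜ z)) := by
  induction x with
  | zero => simp
  | add x x' hx hx' => simp only [TensorProduct.add_tmul, map_add, hx, hx']
  | tmul v a =>
    induction y with
    | zero => simp
    | add y y' hy hy' =>
      simp only [TensorProduct.add_tmul, TensorProduct.tmul_add, map_add, hy, hy']
    | tmul w b =>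
      induction z with
      | zero => simp
      | add y y' hy hy' => simp only [TensorProduct.tmul_add, map_add, hy, hy']
      | tmul x c => simp [mul_assoc]

theorem mergeAlg_lid (x : V ⊗[k] R) (c : k) :
    (TensorProduct.lid k V).toLinearMap.rTensor R (mergeAlg k R k V ((c ⊗ₜ 1) ⊗ₜ x)) = c • x := by
  induction x with
  | zero => simp
  | add x x' hx hx' => simp only [TensorProduct.tmul_add, map_add, hx, hx', smul_add]
  | tmul v a => simp [TensorProduct.smul_tmul']

theorem mergeAlg_rid (x : V ⊗[k] R) (c : k) :
    (TensorProduct.rid k V).toLinearMap.rTensor R (mergeAlg k R V k (x ⊗ₜ (c ⊗ₜ 1))) = c • x := by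
  induction x with
  | zero => simp
  | add x x' hx hx' => simp only [TensorProduct.add_tmul, map_add, hx, hx', smul_add]
  | tmul v a => simp [TensorProduct.smul_tmul']

/-- Maps `V → V' ⊗ S` and `W → W' ⊗ S` can be multiplied before or after tensoring with `R`. -/
theorem assoc_rTensor_mergeAlg {S V' W' : Type u} [Ring S] [Algebra k S] [AddCommGroup V']
    [Module k V'] [AddCommGroup W'] [Module k W'] (f : V →ₗ[k] V' ⊗[k] S) (g : W →ₗ[k] W' ⊗[k] S)
    (x : V ⊗[k] R) (y : W ⊗[k] R) :
    TensorProduct.assoc k (V' ⊗[k] W') S R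
      ((mergeAlg k S V' W' ∘ₗ TensorProduct.map f g).rTensor R (mergeAlg k R V W (x ⊗ₜ y))) =
    mergeAlg k (S ⊗[k] R) V' W' (TensorProduct.assoc k V' S R (f.rTensor R x) ⊗ₜ
      TensorProduct.assoc k W' S R (g.rTensor R y)) := by
  induction x with
  | zero => simp
  | add x x' hx hx' => simp only [TensorProduct.add_tmul, map_add, hx, hx']
  | tmul v a =>
    induction y with
    | zero => simp
    | add y y' hy hy' => simp only [TensorProduct.tmul_add, map_add, hy, hy']
    | tmul w b =>
      rw [mergeAlg_tmul, LinearMap.rTensor_tmul, LinearMap.rTensor_tmul, LinearMap.rTensor_tmul,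
        LinearMap.comp_apply, TensorProduct.map_tmul]
      induction f v with
      | zero => simp
      | add x x' hx hx' => simp only [TensorProduct.add_tmul, map_add, hx, hx']
      | tmul v a =>
        induction g w with
        | zero => simp
        | add x x' hx hx' =>
          simp only [TensorProduct.add_tmul, TensorProduct.tmul_add, map_add, hx, hx']
        | tmul w b => simp

/-- The coaction of `V ⊗ W` on `(V ⊗ W) ⊗ R` is multiplicative in `R`. -/
theorem extCoact_mergeAlg {A : Type u} [Ring A] [Bialgebra k A] (V W : Comod k A)
    (x : V.carrier ⊗[k] R) (y : W.carrier ⊗[k] R) :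
    (Comod.tensor V W).extCoact R (mergeAlg k R V.carrier W.carrier (x ⊗ₜ y)) =
      mergeAlg k (A ⊗[k] R) V.carrier W.carrier (V.extCoact R x ⊗ₜ W.extCoact R y) :=
  assoc_rTensor_mergeAlg V.coact W.coact x y

end Merge

namespace BiGalois

variable {A B P Q : Type u} [Ring A] [Ring B] [Ring P] [Ring Q]
    [Bialgebra k A] [Bialgebra k B] [Algebra k P] [Algebra k Q] (D : BiGalois k A B P Q)

section Tensorator

variable (V W : Comod k A)

theorem mergeAlg_mem {x : V.carrier ⊗[k] P} {y : W.carrier ⊗[k] P} (hx : x ∈ D.cotensor V)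
    (hy : y ∈ D.cotensor W) :
    mergeAlg k P V.carrier W.carrier (x ⊗ₜ y) ∈ D.cotensor (Comod.tensor V W) := by
  refine (D.mem_cotensor (Comod.tensor V W)).2 ((extCoact_mergeAlg V W x y).trans ?_)
  rw [(D.mem_cotensor V).1 hx, (D.mem_cotensor W).1 hy]
  exact (mergeAlg_map D.left x y).symm

/-- The map `(V □ P) ⊗ (W □ P) → (V ⊗ W) □ P` given by the multiplication of `P`. -/
def muLin : D.cotensor V ⊗[k] D.cotensor W →ₗ[k] D.cotensor (Comod.tensor V W) :=
  (mergeAlg k P V.carrier W.carrier ∘ₗ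
    TensorProduct.map (D.cotensor V).subtype (D.cotensor W).subtype).codRestrict _ fun z => by
      induction z with
      | zero => rw [map_zero]; exact Submodule.zero_mem _
      | add x y hx hy => rw [map_add]; exact Submodule.add_mem _ hx hy
      | tmul x y => exact D.mergeAlg_mem V W x.2 y.2

/-- The tensorator, tensored with an algebra, is the multiplication of `P ⊗ R`. -/
theorem incl_mergeAlg {R : Type u} [Ring R] [Algebra k R] (s : D.cotensor V ⊗[k] R)
    (t : D.cotensor W ⊗[k] R) :
    D.incl (Comod.tensor V W) R ((D.muLin V W).rTensor R (mergeAlg k R _ _ (s ⊗ₜ t))) =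
      mergeAlg k (P ⊗[k] R) V.carrier W.carrier (D.incl V R s ⊗ₜ D.incl W R t) := by
  refine Eq.trans ?_ (assoc_rTensor_mergeAlg (D.cotensor V).subtype (D.cotensor W).subtype s t)
  exact congrArg (TensorProduct.assoc k (V.carrier ⊗[k] W.carrier) P R)
    (LinearMap.rTensor_comp_apply R (D.cotensor (Comod.tensor V W)).subtype (D.muLin V W) _).symm

theorem muLin_comm : (D.muLin V W).rTensor B ∘ₗ Comod.tensorCoact (D.obj V) (D.obj W) =
    D.cotensorCoact (Comod.tensor V W) ∘ₗ D.muLin V W := by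
  refine TensorProduct.ext' fun x y => D.incl_injective (Comod.tensor V W) ?_
  refine (D.incl_mergeAlg V W (D.cotensorCoact V x) (D.cotensorCoact W y)).trans ?_
  refine Eq.trans ?_ (D.incl_cotensorCoact (Comod.tensor V W) (D.muLin V W (x ⊗ₜ y))).symm
  refine Eq.trans ?_ (mergeAlg_map D.right x.1 y.1).symm
  exact congrArg₂ (fun a b => mergeAlg k (P ⊗[k] B) V.carrier W.carrier (a ⊗ₜ b))
    (D.incl_cotensorCoact V x) (D.incl_cotensorCoact W y)

/-- The morphism `(V □ P) ⊗ (W □ P) ⟶ (V ⊗ W) □ P`. -/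
def muHom : D.functor.obj V ⊗ D.functor.obj W ⟶ D.functor.obj (V ⊗ W) :=
  ⟨D.muLin V W, D.muLin_comm V W⟩

theorem one_mem (c : k) : (c ⊗ₜ 1 : k ⊗[k] P) ∈ D.cotensor (Comod.unit k A) := by
  refine (D.mem_cotensor (Comod.unit k A)).2 ?_
  have h1 : (Comod.unit k A).extCoact P (c ⊗ₜ 1) = c ⊗ₜ[k] ((1 : A) ⊗ₜ[k] (1 : P)) := rfl
  have h2 : D.left.toLinearMap.lTensor (Comod.unit k A).carrier (c ⊗ₜ 1) =
    c ⊗ₜ[k] D.left 1 := rfl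
  refine h1.trans (Eq.trans ?_ h2.symm)
  rw [map_one]
  rfl

/-- The map `k → k □ P`, `c ↦ c ⊗ 1`. -/
def epsLin : k →ₗ[k] D.cotensor (Comod.unit k A) :=
  LinearMap.codRestrict _ ((TensorProduct.mk k k P).flip 1) D.one_mem

theorem epsLin_comm : D.epsLin.rTensor B ∘ₗ (Comod.unit k B).coact =
    D.cotensorCoact (Comod.unit k A) ∘ₗ D.epsLin := by
  refine LinearMap.ext fun c => D.incl_injective (Comod.unit k A) ?_
  refine Eq.trans ?_ (D.incl_cotensorCoact (Comod.unit k A) (D.epsLin c)).symm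
  have h1 : D.right.toLinearMap.lTensor (Comod.unit k A).carrier (D.epsLin c).1 =
    c ⊗ₜ[k] D.right 1 := rfl
  rw [h1, map_one]
  rfl

/-- The morphism from the trivial comodule to `k □ P`. -/
def epsHom : 𝟙_ (Comod k B) ⟶ D.functor.obj (𝟙_ (Comod k A)) :=
  ⟨D.epsLin, D.epsLin_comm⟩

/-- The unit `V ≅ (V □ P) □ Q` is compatible with tensor products. -/
theorem unitIso_tensor :
    (D.unitIso.hom.app V ⊗ₘ D.unitIso.hom.app W) ≫
      D.symm.muHom (D.functor.obj V) (D.functor.obj W) ≫ D.symm.functor.map (D.muHom V W) =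
    D.unitIso.hom.app (V ⊗ W) := by
  ext1
  refine TensorProduct.ext' fun v w => Subtype.ext (D.incl_injective (Comod.tensor V W) ?_)
  refine (D.incl_mergeAlg V W (D.coev V v) (D.coev W w)).trans ?_
  refine Eq.trans ?_ (D.incl_coev (Comod.tensor V W) (v ⊗ₜ w)).symm
  rw [incl_coev, incl_coev]
  exact (mergeAlg_map D.split (V.coact v) (W.coact w)).symm

/-- The unit `V ≅ (V □ P) □ Q` is compatible with the trivial comodule. -/
theorem unitIso_unit :
    D.symm.epsHom ≫ D.symm.functor.map D.epsHom = D.unitIso.hom.app (𝟙_ (Comod k A)) := by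
  ext1
  refine LinearMap.ext fun c => Subtype.ext (D.incl_injective (Comod.unit k A) ?_)
  refine Eq.trans ?_ (D.incl_coev (Comod.unit k A) c).symm
  have h1 : D.split.toLinearMap.lTensor (Comod.unit k A).carrier ((Comod.unit k A).coact c) =
    c ⊗ₜ[k] D.split 1 := rfl
  rw [h1, map_one]
  rfl

instance : D.functor.IsEquivalence := D.equivalence.isEquivalence_functor

/-- The image of `muHom` under the second cotensor functor has a section by `unitIso_tensor`. -/
theorem isSplitEpi_muHom : IsSplitEpi (D.muHom V W) := by
  have h : IsSplitEpi (D.symm.functor.map (D.muHom V W)) :=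
    ⟨⟨inv (D.unitIso.hom.app (V ⊗ W)) ≫ (D.unitIso.hom.app V ⊗ₘ D.unitIso.hom.app W) ≫
      D.symm.muHom (D.functor.obj V) (D.functor.obj W), by
      simp only [Category.assoc]
      rw [unitIso_tensor, IsIso.inv_hom_id]⟩⟩
  obtain ⟨⟨s⟩⟩ := h
  exact ⟨⟨(D.symm.functor.splitEpiEquiv _).symm s⟩⟩

theorem isSplitEpi_epsHom : IsSplitEpi D.epsHom := by
  have h : IsSplitEpi (D.symm.functor.map D.epsHom) :=
    ⟨⟨inv (D.unitIso.hom.app (𝟙_ (Comod k A))) ≫ D.symm.epsHom, by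
      rw [Category.assoc, unitIso_unit, IsIso.inv_hom_id]⟩⟩
  obtain ⟨⟨s⟩⟩ := h
  exact ⟨⟨(D.symm.functor.splitEpiEquiv _).symm s⟩⟩

/-- Multiplication is an isomorphism `(V □ P) ⊗ (W □ P) ≅ (V ⊗ W) □ P`: it is a split epimorphism,
and so is the corresponding map for `Q`, which is also a split monomorphism on the objects
`V □ P`. -/
instance isIso_muHom : IsIso (D.muHom V W) := by
  have h : IsIso (D.symm.muHom (D.functor.obj V) (D.functor.obj W)) := by
    have := D.symm.isSplitEpi_muHom (D.functor.obj V) (D.functor.obj W)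
    have : IsSplitMono (D.symm.muHom (D.functor.obj V) (D.functor.obj W)) :=
      ⟨⟨D.symm.functor.map (D.muHom V W) ≫ inv (D.unitIso.hom.app (V ⊗ W)) ≫
        (D.unitIso.hom.app V ⊗ₘ D.unitIso.hom.app W), by
        rw [← cancel_epi (D.unitIso.hom.app V ⊗ₘ D.unitIso.hom.app W)]
        have h := D.unitIso_tensor V W =≫ inv (D.unitIso.hom.app (V ⊗ W)) ≫
          (D.unitIso.hom.app V ⊗ₘ D.unitIso.hom.app W)
        rw [IsIso.hom_inv_id_assoc] at h
        simp only [Category.assoc] at h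
        exact h.trans (Category.comp_id _).symm⟩⟩
    exact isIso_of_epi_of_isSplitMono _
  have h1 : IsIso (D.symm.functor.map (D.muHom V W)) := by
    have h2 := D.unitIso_tensor V W
    rw [← IsIso.eq_inv_comp, ← IsIso.eq_inv_comp] at h2
    rw [h2]
    infer_instance
  exact isIso_of_reflects_iso (D.muHom V W) D.symm.functor

instance isIso_epsHom : IsIso D.epsHom := by
  have h : IsIso D.symm.epsHom := by
    have := D.symm.isSplitEpi_epsHom
    have : IsSplitMono D.symm.epsHom :=
      ⟨⟨D.symm.functor.map D.epsHom ≫ inv (D.unitIso.hom.app (𝟙_ (Comod k A))), by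
        rw [← Category.assoc, unitIso_unit, IsIso.hom_inv_id]⟩⟩
    exact isIso_of_epi_of_isSplitMono _
  have h1 : IsIso (D.symm.functor.map D.epsHom) := by
    have h2 := D.unitIso_unit
    rw [← IsIso.eq_inv_comp] at h2
    rw [h2]
    infer_instance
  exact isIso_of_reflects_iso D.epsHom D.symm.functor

end Tensorator

/-- Cotensoring with `P` is a monoidal functor. -/
def coreMonoidal : D.functor.CoreMonoidal where
  εIso := asIso D.epsHom
  μIso V W := asIso (D.muHom V W)
  μIso_hom_natural_left {V V'} f W := by
    ext1
    refine TensorProduct.ext' fun x y => Subtype.ext ?_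
    refine Eq.trans ?_ (mergeAlg_natural f.lin LinearMap.id x.1 y.1).symm
    rw [LinearMap.rTensor_id]
    rfl
  μIso_hom_natural_right {W W'} V f := by
    ext1
    refine TensorProduct.ext' fun x y => Subtype.ext ?_
    refine Eq.trans ?_ (mergeAlg_natural LinearMap.id f.lin x.1 y.1).symm
    rw [LinearMap.rTensor_id]
    rfl
  associativity V W X := by
    ext1
    refine TensorProduct.ext_threefold fun x y z => Subtype.ext ?_
    exact mergeAlg_assoc x.1 y.1 z.1
  left_unitality V := by
    ext1
    refine TensorProduct.ext' fun c x => Subtype.ext ?_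
    exact (mergeAlg_lid x.1 c).symm
  right_unitality V := by
    ext1
    refine TensorProduct.ext' fun x c => Subtype.ext ?_
    exact (mergeAlg_rid x.1 c).symm

theorem monoidallyEquivalent (D : BiGalois k A B P Q) : MonoidallyEquivalent k A B :=
  ⟨D.equivalence, D.coreMonoidal.toMonoidal, inferInstanceAs D.functor.Additive,
    inferInstanceAs (D.functor.Linear k)⟩

end BiGalois

end

/-! ### Bi-Galois data from universal algebras -/

section Cogroupoid

variable {k : Type u} [Field k] {m n p l : ℕ}

/-- `f` is the comultiplication `U ↦ U₁ ⊗ U₂`, `V ↦ V₁ ⊗ V₂`, the products being those of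
matrices. -/
structure IsComul {R S T : Type u} [Ring R] [Algebra k R] [Ring S] [Algebra k S] [Ring T]
    [Algebra k T] (U V : Matrix (Fin m) (Fin p) R) (U₁ V₁ : Matrix (Fin m) (Fin n) S)
    (U₂ V₂ : Matrix (Fin n) (Fin p) T) (f : R →ₐ[k] S ⊗[k] T) : Prop where
  map_u : U.map f = U₁.map (Algebra.TensorProduct.includeLeft : S →ₐ[k] S ⊗[k] T) *
    U₂.map (Algebra.TensorProduct.includeRight : T →ₐ[k] S ⊗[k] T)
  map_v : V.map f = V₁.map (Algebra.TensorProduct.includeLeft : S →ₐ[k] S ⊗[k] T) *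
    V₂.map (Algebra.TensorProduct.includeRight : T →ₐ[k] S ⊗[k] T)

theorem map_include_mul_apply {S T : Type u} [Ring S] [Algebra k S] [Ring T] [Algebra k T]
    (X : Matrix (Fin m) (Fin n) S) (Y : Matrix (Fin n) (Fin p) T) (i : Fin m) (j : Fin p) :
    (X.map (Algebra.TensorProduct.includeLeft : S →ₐ[k] S ⊗[k] T) *
      Y.map (Algebra.TensorProduct.includeRight : T →ₐ[k] S ⊗[k] T)) i j =
        ∑ l, X i l ⊗ₜ[k] Y l j := by
  simp [Matrix.mul_apply]

variable {E : GL (Fin m) k} {F : GL (Fin n) k} {G : GL (Fin p) k} {L : GL (Fin l) k}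
  {R S T : Type u} [Ring R] [Algebra k R] [Ring S] [Algebra k S] [Ring T] [Algebra k T]

namespace IsComul

variable {U V : Matrix (Fin m) (Fin p) R} {U₁ V₁ : Matrix (Fin m) (Fin n) S}
  {U₂ V₂ : Matrix (Fin n) (Fin p) T} {f : R →ₐ[k] S ⊗[k] T}

theorem apply_u (hf : IsComul U V U₁ V₁ U₂ V₂ f) (i : Fin m) (j : Fin p) :
    f (U i j) = ∑ l, U₁ i l ⊗ₜ[k] U₂ l j :=
  (congrFun (congrFun hf.map_u i) j).trans (map_include_mul_apply _ _ _ _)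

theorem apply_v (hf : IsComul U V U₁ V₁ U₂ V₂ f) (i : Fin m) (j : Fin p) :
    f (V i j) = ∑ l, V₁ i l ⊗ₜ[k] V₂ l j :=
  (congrFun (congrFun hf.map_v i) j).trans (map_include_mul_apply _ _ _ _)

end IsComul

namespace IsUniversal

theorem exists_comul {U V : Matrix (Fin m) (Fin p) R} {U₁ V₁ : Matrix (Fin m) (Fin n) S}
    {U₂ V₂ : Matrix (Fin n) (Fin p) T} (h : IsUniversal E G R U V)
    (h₁ : RectSolution E F U₁ V₁) (h₂ : RectSolution F G U₂ V₂) :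
    ∃ f : R →ₐ[k] S ⊗[k] T, IsComul U V U₁ V₁ U₂ V₂ f := by
  obtain ⟨f, hu, hv⟩ := h.exists_lift ((h₁.map
    (Algebra.TensorProduct.includeLeft : S →ₐ[k] S ⊗[k] T)).mul
      (h₂.map (Algebra.TensorProduct.includeRight : T →ₐ[k] S ⊗[k] T))
      (by intro i j i' j'; simp [Commute, SemiconjBy])
      (by intro i j i' j'; simp [Commute, SemiconjBy]))
  exact ⟨f, hu, hv⟩

/-- The comultiplications are coassociative. -/
theorem coassoc {S' T' Y : Type u} [Ring S'] [Algebra k S'] [Ring T'] [Algebra k T'] [Ring Y]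
    [Algebra k Y] {U V : Matrix (Fin m) (Fin p) R} (h : IsUniversal E G R U V)
    {U₁ V₁ : Matrix (Fin m) (Fin n) S} {U₂ V₂ : Matrix (Fin n) (Fin p) T}
    {U₁' V₁' : Matrix (Fin m) (Fin l) S'} {U₂' V₂' : Matrix (Fin l) (Fin p) T'}
    {X Z : Matrix (Fin l) (Fin n) Y} {f : R →ₐ[k] S ⊗[k] T} {g : S →ₐ[k] S' ⊗[k] Y}
    {f' : R →ₐ[k] S' ⊗[k] T'} {g' : T' →ₐ[k] Y ⊗[k] T} (hf : IsComul U V U₁ V₁ U₂ V₂ f)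
    (hg : IsComul U₁ V₁ U₁' V₁' X Z g) (hf' : IsComul U V U₁' V₁' U₂' V₂' f')
    (hg' : IsComul U₂' V₂' X Z U₂ V₂ g') (x : R) :
    TensorProduct.assoc k S' Y T (g.toLinearMap.rTensor T (f x)) =
      g'.toLinearMap.lTensor S' (f' x) := by
  have key : (Algebra.TensorProduct.assoc k k k S' Y T).toAlgHom.comp
      ((Algebra.TensorProduct.map g (AlgHom.id k T)).comp f) =
        (Algebra.TensorProduct.map (AlgHom.id k S') g').comp f' := by
    apply h.hom_ext <;> ext i j
    · simp only [Matrix.map_apply, AlgHom.comp_apply, hf.apply_u, hf'.apply_u, map_sum,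
        Algebra.TensorProduct.map_tmul, hg.apply_u, hg'.apply_u, AlgHom.id_apply,
        TensorProduct.sum_tmul, TensorProduct.tmul_sum]
      exact Finset.sum_comm
    · simp only [Matrix.map_apply, AlgHom.comp_apply, hf.apply_v, hf'.apply_v, map_sum,
        Algebra.TensorProduct.map_tmul, hg.apply_v, hg'.apply_v, AlgHom.id_apply,
        TensorProduct.sum_tmul, TensorProduct.tmul_sum]
      exact Finset.sum_comm
  exact DFunLike.congr_fun key x

end IsUniversal

/-- The bialgebra `B` is the universal algebra with a solution of the relations for `F`, and its
comultiplication and counit are those of `H(F)`. -/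
structure IsUniversalBialgebra (F : GL (Fin n) k) (B : Type u) [Ring B] [Bialgebra k B]
    (U V : Matrix (Fin n) (Fin n) B) : Prop extends IsUniversal F F B U V where
  isComul : IsComul U V U V U V (Bialgebra.comulAlgHom k B)
  counit_u : U.map (Bialgebra.counitAlgHom k B) = 1
  counit_v : V.map (Bialgebra.counitAlgHom k B) = 1

section Pairing

variable {A P Q : Type u} [Ring A] [Bialgebra k A] [Ring P] [Algebra k P] [Ring Q] [Algebra k Q]

/-- The comultiplications are counital. -/
theorem rid_counit {B : Type u} [Ring B] [Bialgebra k B] {UB VB : Matrix (Fin n) (Fin n) B}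
    (hB : IsUniversalBialgebra F B UB VB) {U V : Matrix (Fin m) (Fin n) P}
    (hP : IsUniversal E F P U V) {f : P →ₐ[k] P ⊗[k] B} (hf : IsComul U V U V UB VB f) (x : P) :
    TensorProduct.rid k P ((Coalgebra.counit (R := k) (A := B)).lTensor P (f x)) = x := by
  have key : (Algebra.TensorProduct.rid k k P).toAlgHom.comp
      ((Algebra.TensorProduct.map (AlgHom.id k P) (Bialgebra.counitAlgHom k B)).comp f) =
        AlgHom.id k P := by
    have hsum : ∀ (X : Matrix (Fin m) (Fin n) P) (i : Fin m) (j : Fin n),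
        ∑ l, (1 : Matrix (Fin n) (Fin n) k) l j • X i l = X i j := by
      intro X i j
      simp [Matrix.one_apply, ite_smul]
    have hu : ∀ i j, Bialgebra.counitAlgHom k B (UB i j) = (1 : Matrix (Fin n) (Fin n) k) i j :=
      fun i j => congrFun (congrFun hB.counit_u i) j
    have hv : ∀ i j, Bialgebra.counitAlgHom k B (VB i j) = (1 : Matrix (Fin n) (Fin n) k) i j :=
      fun i j => congrFun (congrFun hB.counit_v i) j
    apply hP.hom_ext <;> ext i j
    · simp only [Matrix.map_apply, AlgHom.comp_apply, hf.apply_u, map_sum,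
        Algebra.TensorProduct.map_tmul, hu, AlgHom.id_apply]
      exact hsum U i j
    · simp only [Matrix.map_apply, AlgHom.comp_apply, hf.apply_v, map_sum,
        Algebra.TensorProduct.map_tmul, hv, AlgHom.id_apply]
      exact hsum V i j
  exact DFunLike.congr_fun key x

/-- The antipode `Q → P` composed with a functional on `P` that sends `1` to `1` gives a functional
on `P ⊗ Q` that restricts to the counit of `A`. -/
theorem exists_ev [Nontrivial P] {UA VA : Matrix (Fin m) (Fin m) A}
    (hA : IsUniversalBialgebra E A UA VA) {U V : Matrix (Fin m) (Fin n) P}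
    (hP : RectSolution E F U V) {U' V' : Matrix (Fin n) (Fin m) Q} (hQ : IsUniversal F E Q U' V')
    {f : A →ₐ[k] P ⊗[k] Q} (hf : IsComul UA VA U V U' V' f) :
    ∃ ev : P ⊗[k] Q →ₗ[k] k, ∀ a, ev (f a) = Coalgebra.counit (R := k) a := by
  obtain ⟨s, hsu, hsv⟩ := hQ.exists_lift hP.antipode
  obtain ⟨ω, hω⟩ := LinearMap.exists_leftInverse_of_injective (Algebra.linearMap k P)
    (LinearMap.ker_eq_bot.2 (algebraMap k P).injective)
  let t : Q →ₗ[k] P := (MulOpposite.opLinearEquiv k).symm.toLinearMap ∘ₗ s.toLinearMap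
  have ht1 : t 1 = 1 := by simp [t]
  have htm : ∀ x y, t (x * y) = t y * t x := fun x y => by simp [t]
  have htu : ∀ i j, t (U' i j) = V j i := fun i j =>
    congrArg MulOpposite.unop (congrFun (congrFun hsu i) j)
  have htv : ∀ i j, t (V' i j) =
      (scalarMat P F.val * U.transpose * scalarMat P E⁻¹.val) i j := fun i j =>
    congrArg MulOpposite.unop (congrFun (congrFun hsv i) j)
  let μ : P ⊗[k] Q →ₗ[k] P := LinearMap.mul' k P ∘ₗ t.lTensor P
  have hμ : ∀ p q, μ (p ⊗ₜ q) = p * t q := fun p q => by simp [μ]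
  have hcu : ∀ i j, Coalgebra.counit (R := k) (UA i j) = (1 : Matrix (Fin m) (Fin m) k) i j :=
    fun i j => congrFun (congrFun hA.counit_u i) j
  have hcv : ∀ i j, Coalgebra.counit (R := k) (VA i j) = (1 : Matrix (Fin m) (Fin m) k) i j :=
    fun i j => congrFun (congrFun hA.counit_v i) j
  have key : ∀ a, μ (f a) = algebraMap k P (Coalgebra.counit (R := k) a) := by
    intro a
    induction a using hA.induction with
    | hs c => simp [Algebra.TensorProduct.algebraMap_apply, hμ, ht1]
    | hu i j =>
      rw [hf.apply_u, hcu, one_apply_algebraMap, ← hP.u_vt, map_sum, Matrix.mul_apply]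
      simp only [hμ, htu, Matrix.transpose_apply]
    | hv i j =>
      rw [hf.apply_v, hcv, one_apply_algebraMap, ← hP.v_ut, Matrix.mul_assoc, Matrix.mul_assoc,
        ← Matrix.mul_assoc (scalarMat _ _), map_sum, Matrix.mul_apply]
      simp only [hμ, htv]
    | hadd x y hx hy => simp only [map_add, hx, hy]
    | hmul x y hx hy =>
      have h : ∀ z w : P ⊗[k] Q, μ w ∈ Set.range (algebraMap k P) → μ (z * w) = μ z * μ w := by
        rintro z w ⟨c, hc⟩
        induction z with
        | zero => simp
        | add z z' hz hz' => rw [add_mul, map_add, map_add, hz, hz', add_mul]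
        | tmul a b =>
          have h' : μ (a ⊗ₜ[k] b * w) = a * μ w * t b := by
            clear hc
            induction w with
            | zero => simp
            | add w w' hw hw' => simp only [mul_add, add_mul, map_add, hw, hw']
            | tmul p q => simp [hμ, htm, mul_assoc]
          rw [h', ← hc, mul_assoc, Algebra.commutes c, hμ, mul_assoc]
      rw [map_mul, h _ _ ⟨_, hy.symm⟩, hx, hy, Bialgebra.counit_mul, map_mul]
  refine ⟨ω ∘ₗ μ, fun a => ?_⟩
  rw [LinearMap.comp_apply, key]
  exact LinearMap.congr_fun hω _

end Pairing

/-- Non-zero universal algebras for the rectangular relations make the comodule categories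
equivalent. -/
theorem IsUniversalBialgebra.monoidallyEquivalent_of_nontrivial {A B P Q : Type u} [Ring A]
    [Bialgebra k A] [Ring B] [Bialgebra k B] [Ring P] [Algebra k P] [Ring Q] [Algebra k Q]
    [Nontrivial P] [Nontrivial Q] {UA VA : Matrix (Fin m) (Fin m) A}
    (hA : IsUniversalBialgebra E A UA VA) {UB VB : Matrix (Fin n) (Fin n) B}
    (hB : IsUniversalBialgebra F B UB VB) {UP VP : Matrix (Fin m) (Fin n) P}
    (hP : IsUniversal E F P UP VP) {UQ VQ : Matrix (Fin n) (Fin m) Q}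
    (hQ : IsUniversal F E Q UQ VQ) : MonoidallyEquivalent k A B := by
  obtain ⟨left, hl⟩ := hP.exists_comul hA.sol hP.sol
  obtain ⟨right, hr⟩ := hP.exists_comul hP.sol hB.sol
  obtain ⟨left', hl'⟩ := hQ.exists_comul hB.sol hQ.sol
  obtain ⟨right', hr'⟩ := hQ.exists_comul hQ.sol hA.sol
  obtain ⟨split, hs⟩ := hA.exists_comul hP.sol hQ.sol
  obtain ⟨split', hs'⟩ := hB.exists_comul hQ.sol hP.sol
  obtain ⟨ev, hev⟩ := exists_ev hA hP.sol hQ hs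
  obtain ⟨ev', hev'⟩ := exists_ev hB hQ.sol hP hs'
  exact BiGalois.monoidallyEquivalent
    { left := left
      right := right
      left' := left'
      right' := right'
      split := split
      split' := split'
      ev := ev
      ev' := ev'
      ev_split := hev
      ev_split' := hev'
      right_coassoc p := by simpa using hP.coassoc hr hr hr hB.isComul p
      right_coassoc' q := by simpa using hQ.coassoc hr' hr' hr' hA.isComul q
      right_counit := rid_counit hB hP hr
      right_counit' := rid_counit hA hQ hr'
      left_right := hP.coassoc hr hl hl hr
      left_right' := hQ.coassoc hr' hl' hl' hr'
      split_left := hP.coassoc hl hs hr hs'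
      split_left' := hQ.coassoc hl' hs' hr' hs
      left_split x := by simpa using hA.coassoc hs hl hA.isComul hs x
      left_split' x := by simpa using hB.coassoc hs' hl' hB.isComul hs' x
      right_split := hA.coassoc hs hr hs hl'
      right_split' := hB.coassoc hs' hr' hs' hl
      split_right x := by simpa using hA.coassoc hA.isComul hs hs hr' x
      split_right' x := by simpa using hB.coassoc hB.isComul hs' hs' hr x }

theorem IsUniversalBialgebra.monoidallyEquivalent [IsAlgClosed k] {A B : Type u} [Ring A]
    [Bialgebra k A] [Ring B] [Bialgebra k B] {UA VA : Matrix (Fin m) (Fin m) A}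
    (hA : IsUniversalBialgebra E A UA VA) {UB VB : Matrix (Fin n) (Fin n) B}
    (hB : IsUniversalBialgebra F B UB VB) (hm : 2 ≤ m) (hn : 2 ≤ n)
    (htr : E.val.trace = F.val.trace) (htr' : E⁻¹.val.trace = F⁻¹.val.trace) :
    MonoidallyEquivalent k A B := by
  have hP := RectAlg.isUniversal E F
  have hQ := RectAlg.isUniversal F E
  have : Nontrivial (RectAlg E F) := hP.nontrivial hm hn htr htr'
  have : Nontrivial (RectAlg F E) := hQ.nontrivial hn hm htr.symm htr'.symm
  exact hA.monoidallyEquivalent_of_nontrivial hB hP hQ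

end Cogroupoid

section Standard

variable {k : Type u} [Field k] {n : ℕ} (F : GL (Fin n) k)

theorem H.isUniversalBialgebra : IsUniversalBialgebra F (H F) (H.u F) (H.v F) where
  sol := ⟨(H.isSolution F).u_vt, (H.isSolution F).vt_u, (H.isSolution F).v_ut,
    (H.isSolution F).ut_v⟩
  exists_lift {B _ _ U V} h := by
    refine ⟨H.lift U V ⟨h.u_vt, h.vt_u, h.v_ut, h.ut_v⟩, ?_, ?_⟩ <;> ext i j <;> simp
  hom_ext hu hv := H.algHom_ext (fun i j => congrFun (congrFun hu i) j)
    fun i j => congrFun (congrFun hv i) j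
  isComul := by
    refine ⟨?_, ?_⟩ <;> ext i j <;> rw [map_include_mul_apply]
    exacts [H.comul_u F i j, H.comul_v F i j]
  counit_u := by ext i j; exact H.counit_u F i j
  counit_v := by ext i j; exact H.counit_v F i j

variable {F} {B : Type u} [Ring B] [Bialgebra k B] {U V : Matrix (Fin n) (Fin n) B}

theorem RectSolution.smul {A : Type u} [Ring A] [Algebra k A] {U V : Matrix (Fin n) (Fin n) A}
    (h : RectSolution F F U V) (c : kˣ) : RectSolution (c • F) (c • F) U V := by
  have h1 : scalarMat A (c • F).val = (c : k) • scalarMat A F.val := by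
    ext i j
    exact (map_mul (algebraMap k A) _ _).trans (Algebra.smul_def _ _).symm
  have h2 : scalarMat A (c • F)⁻¹.val = (c : k)⁻¹ • scalarMat A F⁻¹.val := by
    have h3 : (c • F)⁻¹.val = (c : k)⁻¹ • F⁻¹.val := by ext i j; simp [Units.smul_def]
    rw [h3]
    ext i j
    exact (map_mul (algebraMap k A) _ _).trans (Algebra.smul_def _ _).symm
  refine ⟨h.u_vt, h.vt_u, ?_, ?_⟩
  · rw [h1, h2]
    simp only [Matrix.mul_smul, Matrix.smul_mul, smul_smul]
    rw [inv_mul_cancel₀ c.ne_zero, one_smul, h.v_ut]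
  · rw [h1, h2]
    simp only [Matrix.mul_smul, Matrix.smul_mul, smul_smul]
    rw [inv_mul_cancel₀ c.ne_zero, one_smul, h.ut_v]

/-- The relations for `F` and for a scalar multiple of `F` are the same. -/
theorem IsUniversalBialgebra.smul (h : IsUniversalBialgebra F B U V) (c : kˣ) :
    IsUniversalBialgebra (c • F) B U V where
  sol := h.sol.smul c
  exists_lift h' := h.exists_lift (by simpa using h'.smul c⁻¹)
  hom_ext := h.hom_ext
  isComul := h.isComul
  counit_u := h.counit_u
  counit_v := h.counit_v

theorem scalarMat_transpose {A : Type u} [Ring A] [Algebra k A] (M : Matrix (Fin n) (Fin n) k) :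
    scalarMat A M.transpose = (scalarMat A M).transpose := rfl

/-- The matrix `V` and the transpose of `F ᵗU F⁻¹` satisfy the relations for `ᵗF⁻¹`. -/
theorem RectSolution.contragredient {A : Type u} [Ring A] [Algebra k A]
    {U V : Matrix (Fin n) (Fin n) A} (h : RectSolution F F U V) :
    RectSolution (transposeGL F)⁻¹ (transposeGL F)⁻¹ V
      (scalarMat A F⁻¹.val.transpose * U * scalarMat A F.val.transpose) := by
  have hT : (scalarMat A F⁻¹.val.transpose * U * scalarMat A F.val.transpose).transpose =
      scalarMat A F.val * U.transpose * scalarMat A F⁻¹.val := by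
    rw [transpose_mul_scalarMat, transpose_scalarMat_mul, scalarMat_transpose, scalarMat_transpose,
      Matrix.transpose_transpose, Matrix.transpose_transpose, Matrix.mul_assoc]
  have h1 : scalarMat A F.val.transpose * scalarMat A F⁻¹.val.transpose = 1 :=
    scalarMat_val_inv (F := transposeGL F)
  have h2 : scalarMat A F⁻¹.val.transpose * scalarMat A F.val.transpose = 1 :=
    scalarMat_inv_val (F := transposeGL F)
  have e1 : ((transposeGL F)⁻¹).val = F⁻¹.val.transpose := rfl
  have e2 : ((transposeGL F)⁻¹)⁻¹.val = F.val.transpose := by rw [inv_inv]; rfl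
  refine ⟨?_, ?_, ?_, ?_⟩
  · rw [hT, ← Matrix.mul_assoc, ← Matrix.mul_assoc, h.v_ut]
  · rw [hT, h.ut_v]
  · rw [e1, e2]
    calc _ = scalarMat A F⁻¹.val.transpose * U *
          (scalarMat A F.val.transpose * scalarMat A F⁻¹.val.transpose) * V.transpose *
            scalarMat A F.val.transpose := by simp only [Matrix.mul_assoc]
      _ = scalarMat A F⁻¹.val.transpose * (U * V.transpose) * scalarMat A F.val.transpose := by
        rw [h1, Matrix.mul_one]; simp only [Matrix.mul_assoc]
      _ = 1 := by rw [h.u_vt, Matrix.mul_one, h2]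
  · rw [e1, e2]
    calc _ = scalarMat A F⁻¹.val.transpose * V.transpose *
          (scalarMat A F.val.transpose * scalarMat A F⁻¹.val.transpose) * U *
            scalarMat A F.val.transpose := by simp only [Matrix.mul_assoc]
      _ = scalarMat A F⁻¹.val.transpose * (V.transpose * U) * scalarMat A F.val.transpose := by
        rw [h1, Matrix.mul_one]; simp only [Matrix.mul_assoc]
      _ = 1 := by rw [h.vt_u, Matrix.mul_one, h2]

/-- Every solution of the relations for `ᵗF⁻¹` arises from one for `F` as in
`RectSolution.contragredient`. -/
theorem RectSolution.of_contragredient {A : Type u} [Ring A] [Algebra k A]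
    {U V : Matrix (Fin n) (Fin n) A}
    (h : RectSolution (transposeGL F)⁻¹ (transposeGL F)⁻¹ U V) :
    RectSolution F F (scalarMat A F.val.transpose * V * scalarMat A F⁻¹.val.transpose) U := by
  have hT : (scalarMat A F.val.transpose * V * scalarMat A F⁻¹.val.transpose).transpose =
      scalarMat A F⁻¹.val * V.transpose * scalarMat A F.val := by
    rw [transpose_mul_scalarMat, transpose_scalarMat_mul, scalarMat_transpose, scalarMat_transpose,
      Matrix.transpose_transpose, Matrix.transpose_transpose, Matrix.mul_assoc]
  have h1 : scalarMat A F.val.transpose * scalarMat A F⁻¹.val.transpose = 1 :=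
    scalarMat_val_inv (F := transposeGL F)
  have h2 : scalarMat A F⁻¹.val.transpose * scalarMat A F.val.transpose = 1 :=
    scalarMat_inv_val (F := transposeGL F)
  have e1 : ((transposeGL F)⁻¹).val = F⁻¹.val.transpose := rfl
  have e2 : ((transposeGL F)⁻¹)⁻¹.val = F.val.transpose := by rw [inv_inv]; rfl
  have h3 := h.v_ut
  have h4 := h.ut_v
  rw [e1, e2] at h3 h4
  refine ⟨?_, ?_, ?_, ?_⟩
  · calc _ = scalarMat A F.val.transpose * (V * scalarMat A F⁻¹.val.transpose * U.transpose *
          (scalarMat A F.val.transpose * scalarMat A F⁻¹.val.transpose)) := by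
          rw [h1, Matrix.mul_one]; simp only [Matrix.mul_assoc]
      _ = scalarMat A F.val.transpose * (V * scalarMat A F⁻¹.val.transpose * U.transpose *
          scalarMat A F.val.transpose) * scalarMat A F⁻¹.val.transpose := by
          simp only [Matrix.mul_assoc]
      _ = 1 := by rw [h3, Matrix.mul_one, h1]
  · calc _ = (scalarMat A F.val.transpose * scalarMat A F⁻¹.val.transpose) * U.transpose *
          scalarMat A F.val.transpose * V * scalarMat A F⁻¹.val.transpose := by
          rw [h1, Matrix.one_mul]; simp only [Matrix.mul_assoc]
      _ = scalarMat A F.val.transpose * (scalarMat A F⁻¹.val.transpose * U.transpose *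
          scalarMat A F.val.transpose * V) * scalarMat A F⁻¹.val.transpose := by
          simp only [Matrix.mul_assoc]
      _ = 1 := by rw [h4, Matrix.mul_one, h1]
  · rw [hT]
    calc _ = U * (scalarMat A F.val * scalarMat A F⁻¹.val) * V.transpose *
          (scalarMat A F.val * scalarMat A F⁻¹.val) := by simp only [Matrix.mul_assoc]
      _ = 1 := by rw [scalarMat_val_inv, Matrix.mul_one, Matrix.mul_one, h.u_vt]
  · rw [hT]
    calc _ = (scalarMat A F.val * scalarMat A F⁻¹.val) * V.transpose *
          (scalarMat A F.val * scalarMat A F⁻¹.val) * U := by simp only [Matrix.mul_assoc]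
      _ = 1 := by rw [scalarMat_val_inv, Matrix.mul_one, Matrix.one_mul, h.vt_u]

/-- The bialgebras `H(F)` and `H(ᵗF⁻¹)` agree, with `u` and `v` exchanged up to conjugation. -/
theorem IsUniversalBialgebra.contragredient (h : IsUniversalBialgebra F B U V) :
    IsUniversalBialgebra (transposeGL F)⁻¹ B V
      (scalarMat B F⁻¹.val.transpose * U * scalarMat B F.val.transpose) := by
  have h1 : ∀ (A : Type u) [Ring A] [Algebra k A],
      scalarMat A F.val.transpose * scalarMat A F⁻¹.val.transpose = 1 :=
    fun A _ _ => scalarMat_val_inv (F := transposeGL F)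
  have h2 : ∀ (A : Type u) [Ring A] [Algebra k A],
      scalarMat A F⁻¹.val.transpose * scalarMat A F.val.transpose = 1 :=
    fun A _ _ => scalarMat_inv_val (F := transposeGL F)
  refine ⟨⟨h.sol.contragredient, fun {A _ _ U' V'} h' => ?_, fun {A _ _ f g} hV hU => ?_⟩,
    ⟨h.isComul.map_v, ?_⟩, h.counit_v, ?_⟩
  · obtain ⟨f, hu, hv⟩ := h.exists_lift h'.of_contragredient
    refine ⟨f, hv, ?_⟩
    rw [Matrix.map_mul, Matrix.map_mul, hu, scalarMat_map, scalarMat_map]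
    calc _ = (scalarMat A F⁻¹.val.transpose * scalarMat A F.val.transpose) * V' *
          (scalarMat A F⁻¹.val.transpose * scalarMat A F.val.transpose) := by
          simp only [Matrix.mul_assoc]
      _ = V' := by rw [h2, Matrix.one_mul, Matrix.mul_one]
  · refine h.hom_ext ?_ hV
    have hU' := congrArg (fun M => scalarMat A F.val.transpose * M *
      scalarMat A F⁻¹.val.transpose) hU
    have hc : ∀ M : Matrix (Fin n) (Fin n) A, scalarMat A F.val.transpose *
        (scalarMat A F⁻¹.val.transpose * M * scalarMat A F.val.transpose) *
          scalarMat A F⁻¹.val.transpose = M := by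
      intro M
      calc _ = (scalarMat A F.val.transpose * scalarMat A F⁻¹.val.transpose) * M *
            (scalarMat A F.val.transpose * scalarMat A F⁻¹.val.transpose) := by
            simp only [Matrix.mul_assoc]
        _ = M := by rw [h1, Matrix.one_mul, Matrix.mul_one]
    simpa only [Matrix.map_mul, scalarMat_map, hc] using hU'
  · rw [Matrix.map_mul, Matrix.map_mul, h.isComul.map_u, scalarMat_map, scalarMat_map,
      Matrix.map_mul, Matrix.map_mul, Matrix.map_mul, Matrix.map_mul, scalarMat_map, scalarMat_map,
      scalarMat_map, scalarMat_map]
    have h3 := h1 (B ⊗[k] B)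
    simp only [Matrix.mul_assoc] at h3 ⊢
    rw [← Matrix.mul_assoc (scalarMat (B ⊗[k] B) F.val.transpose)
      (scalarMat (B ⊗[k] B) F⁻¹.val.transpose), h3, Matrix.one_mul]
  · rw [Matrix.map_mul, Matrix.map_mul, h.counit_u, scalarMat_map, scalarMat_map, Matrix.mul_one,
      h2]

end Standard

/-! ### Traces -/

section

variable {k : Type u} [Field k] {m n : ℕ}

theorem trace_smul_val (c : kˣ) (F : GL (Fin n) k) : (c • F).val.trace = c * F.val.trace := by
  change ((c • F.val).trace : k) = _
  rw [Matrix.trace_smul, Units.smul_def, smul_eq_mul]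

theorem trace_smul_inv_val (c : kˣ) (F : GL (Fin n) k) :
    (c • F)⁻¹.val.trace = (c : k)⁻¹ * F⁻¹.val.trace := by
  have h : (c • F)⁻¹ = c⁻¹ • F⁻¹ := by
    ext i j; simp
  rw [h, trace_smul_val, Units.val_inv_eq_inv_val]

theorem trace_Fq (q : kˣ) : (Fq q).val.trace = (q : k)⁻¹ + q := by
  simp [Fq, Matrix.trace_fin_two]

theorem trace_Fq_inv (q : kˣ) : (Fq q)⁻¹.val.trace = (q : k)⁻¹ + q := by
  have h : (Fq q)⁻¹.val = !![(q : k), 0; 0, (q⁻¹ : kˣ)] := rfl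
  rw [h]
  simp [Matrix.trace_fin_two, add_comm]

variable [IsAlgClosed k]

/-- A matrix is normalizable unless exactly one of the traces of the matrix and of its inverse
vanishes. -/
theorem trace_of_not_isNormalizable {F : GL (Fin n) k} (h : ¬ IsNormalizable F) :
    (F.val.trace = 0 ∧ F⁻¹.val.trace ≠ 0) ∨ (F.val.trace ≠ 0 ∧ F⁻¹.val.trace = 0) := by
  by_cases h1 : F.val.trace = 0 <;> by_cases h2 : F⁻¹.val.trace = 0
  · exact absurd ⟨1, by rw [one_smul, IsNormalized, h1, h2]⟩ h
  · exact Or.inl ⟨h1, h2⟩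
  · exact Or.inr ⟨h1, h2⟩
  · obtain ⟨c, hc⟩ := IsAlgClosed.exists_pow_nat_eq (F⁻¹.val.trace / F.val.trace) two_pos
    have hc0 : c ≠ 0 := by
      rintro rfl
      exact div_ne_zero h2 h1 (by simpa using hc.symm)
    refine absurd ⟨Units.mk0 c hc0, ?_⟩ h
    rw [IsNormalized, trace_smul_val, trace_smul_inv_val, Units.val_mk0]
    field_simp at hc ⊢
    exact hc

theorem exists_unit_root (t : k) : ∃ q : kˣ, (q : k) ^ 2 - t * q + 1 = 0 := by
  obtain ⟨q, hq⟩ := IsAlgClosed.exists_root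
    (Polynomial.X ^ 2 - Polynomial.C t * Polynomial.X + 1 : Polynomial k) (by
      have : (Polynomial.X ^ 2 - Polynomial.C t * Polynomial.X + 1 : Polynomial k).degree = 2 := by
        compute_degree!
      rw [this]
      exact two_ne_zero)
  have hq' : q ^ 2 - t * q + 1 = 0 := by simpa using hq
  have h0 : q ≠ 0 := by
    rintro rfl
    simp at hq'
  exact ⟨Units.mk0 q h0, hq'⟩

theorem IsUniversalBialgebra.monoidallyEquivalent_Fq {A : Type u} [Ring A] [Bialgebra k A]
    {F : GL (Fin n) k} {U V : Matrix (Fin n) (Fin n) A} (hA : IsUniversalBialgebra F A U V)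
    (hn : 2 ≤ n) (hF : IsNormalized F) {q : kˣ} (hq : (q : k) ^ 2 - F.val.trace * q + 1 = 0) :
    MonoidallyEquivalent k A (H (Fq q)) := by
  have htr : F.val.trace = (q : k)⁻¹ + q := by
    have h0 := q.ne_zero
    field_simp
    linear_combination -hq
  exact hA.monoidallyEquivalent (H.isUniversalBialgebra (Fq q)) hn le_rfl
    (htr.trans (trace_Fq q).symm) (hF.symm.trans (htr.trans (trace_Fq_inv q).symm))

theorem IsUniversalBialgebra.monoidallyEquivalent_of_trace_eq_zero {A : Type u} [Ring A]
    [Bialgebra k A] {F : GL (Fin n) k} {U V : Matrix (Fin n) (Fin n) A}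
    (hA : IsUniversalBialgebra F A U V) (hm : 2 ≤ m) (hn : 2 ≤ n) (h : F.val.trace = 0)
    (h' : F⁻¹.val.trace ≠ 0) {E : GL (Fin m) k} (hE : E.val.trace = 0) (hE' : E⁻¹.val.trace ≠ 0) :
    MonoidallyEquivalent k A (H E) := by
  let c : kˣ := Units.mk0 (F⁻¹.val.trace / E⁻¹.val.trace) (div_ne_zero h' hE')
  refine (hA.smul c).monoidallyEquivalent (H.isUniversalBialgebra E) hn hm ?_ ?_
  · rw [trace_smul_val, h, hE, mul_zero]
  · rw [trace_smul_inv_val, Units.val_mk0, inv_div, div_mul_cancel₀ _ h']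

end

end CosovHopf

end

theorem corollary2p5 {k : Type*} [Field k] [IsAlgClosed k] (n : ℕ) (hn : 2 ≤ n)
    (F : Matrix.GeneralLinearGroup (Fin n) k) :
    (CosovHopf.IsNormalizable F →
      ∃ q : kˣ, CosovHopf.MonoidallyEquivalent k (CosovHopf.H F) (CosovHopf.H (CosovHopf.Fq q))) ∧
    (CosovHopf.IsNormalized F →
      ∀ q : kˣ, (q : k) ^ 2 - F.val.trace * (q : k) + 1 = 0 →
        CosovHopf.MonoidallyEquivalent k (CosovHopf.H F) (CosovHopf.H (CosovHopf.Fq q))) ∧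
    (¬ CosovHopf.IsNormalizable F →
      ∀ E : Matrix.GeneralLinearGroup (Fin 3) k, E.val.trace = 0 → E⁻¹.val.trace ≠ 0 →
        CosovHopf.MonoidallyEquivalent k (CosovHopf.H F) (CosovHopf.H E)) := by
  have hH := CosovHopf.H.isUniversalBialgebra F
  refine ⟨?_, fun hF q hq => hH.monoidallyEquivalent_Fq hn hF hq, fun hF E hE hE' => ?_⟩
  · rintro ⟨c, hc⟩
    obtain ⟨q, hq⟩ := CosovHopf.exists_unit_root (c • F).val.trace
    exact ⟨q, (hH.smul c).monoidallyEquivalent_Fq hn hc hq⟩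
  · rcases CosovHopf.trace_of_not_isNormalizable hF with ⟨h, h'⟩ | ⟨h, h'⟩
    · exact hH.monoidallyEquivalent_of_trace_eq_zero (by decide) hn h h' hE hE'
    · refine hH.contragredient.monoidallyEquivalent_of_trace_eq_zero (by decide) hn ?_ ?_ hE hE'
      · exact (Matrix.trace_transpose _).trans h'
      · rw [inv_inv]
        exact fun h0 => h ((Matrix.trace_transpose _).symm.trans h0)
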